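/- Let $M$ be a smooth manifold of dimension $n\ge 2$ with a projective structure, i.e. a full class $[\nabla]$ of smooth torsion-free affine connections related by $\hat\nabla_XY=\nabla_XY+\Upsilon(X)Y+\Upsilon(Y)X$, $\Upsilon\in\Omega^1(M)$. Let $\mathcal E(w)$ be the density bundles, normalized by $\mathcal E(-n-1)=|\Lambda^nT^*M|$. For $\nabla\in[\nabla]$ write $(\nabla_a\nabla_b-\nabla_b\nabla_a)f^c=R_{ab}{}^c{}_df^d$ and $$R_{ab}{}^c{}_d=W_{ab}{}^c{}_d+\delta_a^cP_{bd}-\delta_b^cP_{ad}+(P_{ba}-P_{ab})\delta^c_d,\qquad A_{abc}=\nabla_aP_{bc}-\nabla_bP_{ac},$$ with $W$ totally trace-free (the projective Weyl tensor; $P$ is the Schouten and $A$ the Cotton tensor). The standard tractor bundle $\mathcal E^A$ is, in the splitting given by $\nabla$, $\mathcal E^a(-1)\oplus\mathcal E(-1)\ni(\sigma^a,\rho)=Y^A_a\sigma^a+X^A\rho$; under a change of connection by $\Upsilon$ the pair becomes $(\sigma^a,\rho-\Upsilon_a\sigma^a)$; its normal connection is $\nabla_c(\sigma^a,\rho)=(\nabla_c\sigma^a+\rho\,\delta_c^a,\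 \nabla_c\rho-P_{cp}\sigma^p)$. Let $V=\mathcal E^{(BC)}=S^2\mathcal E^A$ with the induced connection $\nabla$ and its exterior covariant derivative $(d^\nabla F)_{a^0\mathbf a}=\nabla_{[a^0}F_{\mathbf a]}$ on $V$-valued $k$-forms $F_{\mathbf a}$, $\mathbf a=a^1\cdots a^k$. Write $$F_{\mathbf a}^{BC}=Y_b^BY_c^C\sigma_{\mathbf a}^{bc}+X^{(B}Y^{C)}_c\rho_{\mathbf a}^c+X^BX^C\nu_{\mathbf a}.$$ $V$ is filtered by $V\supset\{\sigma=0\}\supset\{\sigma=0,\rho=0\}$. The Kostant codifferential $\partial^*$ maps a $V$-valued $(k+1)$-form with slots $(\sigma,\rho,\nu)$ to the $k$-form with slots $(0,\,2\sigma_{r\mathbf a}^{rc},\,\rho_{r\mathbf a}^r)$. Brackets $[\ ]$ and $(\ )$ denote (skew-)symmetrization of total weight one; indices between bars are excluded. (1) For every $k\ge0$ there is a unique linear operator $\tilde d=d^\nabla+\Phi$ from smooth $V$-valued $k$-forms to smooth $V$-valued $(k+1)$-forms such that $\Phi$ is homogeneous of degree $\ge1$ (it maps forms with values in each filtration component of $V$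 to forms with values in the same component), $\Phi$ has values in $\operatorname{im}\partial^*$, and $\partial^*\circ d^\nabla\circ\tilde d=0$. If $k\le n-2$, then in the splitting of each $\nabla\in[\nabla]$ $$(\tilde dF)^{BC}_{a^0\mathbf a}=(d^\nabla F)_{a^0\mathbf a}^{BC}-\frac{k+2}{n-k}\Big[2X^{(B}Y_c^{C)}\alpha_{a^0\mathbf a}^c-\frac{1}{2(n-k-1)}X^BX^C\Big(2\nabla_s\alpha_{a^0\mathbf a}^s-(n-k)\mu_{a^0\mathbf a}\Big)\Big],$$ $$\alpha_{a^0\mathbf a}^c=W_{[ra^0}{}^{(r}{}_{|p|}\sigma_{\mathbf a]}^{c)p},\qquad \mu_{a^0\mathbf a}=\tfrac12W_{[ra^0}{}^r{}_{|p|}\rho_{\mathbf a]}^p-A_{[ra^0|p|}\sigma_{\mathbf a]}^{pr}.$$ If $k\ge n-1$, then $\tilde d=d^\nabla$. (2) For $k=0$ this reads $$(\tilde dF)_a^{BC}=\nabla_aF^{BC}-\tfrac2nX^{(B}Y_c^{C)}W_{ra}{}^c{}_p\sigma^{rp}+\tfrac1nX^BX^C\Big(2A_{rap}\sigma^{pr}+\tfrac1{n-1}W_{ra}{}^s{}_p\nabla_s\sigma^{rp}\Big).$$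 (3) There is a unique connection $\tilde\nabla=\nabla+\Phi$ on $V$ with $\Phi\in\Omega^1(\operatorname{End}V)$ homogeneous of degree $\ge1$, with $\Phi\in\operatorname{im}(\partial^*_V\otimes\mathrm{id}_{V^*})$, whose curvature $\tilde\Omega$ satisfies $(\partial_V^*\otimes\mathrm{id}_{V^*})(\tilde\Omega)=0$ (the prolongation connection). It is $$\tilde\nabla_aF^{BC}=\nabla_aF^{BC}-\tfrac2n\Big(X^{(B}Y_c^{C)}W_{ra}{}^c{}_p\sigma^{pr}-X^BX^CA_{rap}\sigma^{pr}\Big).$$ (4) With $\rho^c=-2\mu^c$, the connection $\tilde\nabla$ is the Eastwood–Matveev connection $$(\sigma^{bc},\mu^b,\nu)\mapsto\Big(\nabla_a\sigma^{bc}-\delta_a^b\mu^c-\delta_a^c\mu^b,\ \ \nabla_a\mu^b-\delta_a^b\nu+P_{ac}\sigma^{bc}-\tfrac1nW_{ac}{}^b{}_d\sigma^{cd},\ \ \nabla_a\nu+2P_{ab}\mu^b-\tfrac2nA_{abc}\sigma^{bc}\Big).$$ -/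

import Mathlib

open scoped Manifold ContDiff

noncomputable section

namespace ProjectiveTractor

/-! ### Weighted tensor fields on a manifold

In Mathlib the tangent space of `M` at `p` is the model space `ℝⁿ`, a vector being represented by its
components in the preferred chart `chartAt p`.  Accordingly a tensor at `p` is the array of its
components in this chart, the lower indices being listed first. -/

/-- Arrays `T_{b₁ … b_ℓ}^{c₁ … c_m}`. -/
abbrev Tensor (n ℓ m : ℕ) := (Fin ℓ → Fin n) → (Fin m → Fin n) → ℝ

/-- Tensor fields with `ℓ` lower and `m` upper indices (no regularity imposed). -/
abbrev TensorField (n : ℕ) (M : Type*) (ℓ m : ℕ) := M → Tensor n ℓ m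

section fields

variable {n : ℕ} {M : Type*} [TopologicalSpace M] [ChartedSpace (EuclideanSpace ℝ (Fin n)) M]
  [IsManifold (𝓡 n) ∞ M] {ℓ m k : ℕ}

/-- The Jacobian matrix at `z` of the change of coordinates from the preferred chart of `p` to the
preferred chart of `q`. -/
def jac (p q z : M) : Matrix (Fin n) (Fin n) ℝ :=
  fun c d => tangentCoordChange (𝓡 n) p q z (EuclideanSpace.single d 1) c

/-- The components at `q` of the tensor field `T` of weight `w`, in the preferred chart of `p`.
Densities of weight `-(n+1)` are the sections of `|Λⁿ T^*M|`. -/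
def inChart (w : ℝ) (T : TensorField n M ℓ m) (p q : M) : Tensor n ℓ m := fun b c =>
  |(jac q p q : Matrix (Fin n) (Fin n) ℝ).det| ^ (w / (n + 1)) *
    ∑ b' : Fin ℓ → Fin n, ∑ c' : Fin m → Fin n,
      (∏ i, jac p q q (b' i) (b i)) * (∏ j, jac q p q (c j) (c' j)) * T q b' c'

/-- Smoothness on `U` of a tensor field of weight `w`. -/
def TensorSmoothOn (w : ℝ) (T : TensorField n M ℓ m) (U : Set M) : Prop :=
  ∀ (p : M) (b : Fin ℓ → Fin n) (c : Fin m → Fin n),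
    ContMDiffOn (𝓡 n) 𝓘(ℝ, ℝ) ∞ (fun q => inChart w T p q b c)
      ((chartAt (EuclideanSpace ℝ (Fin n)) p).source ∩ U)

/-- The partial derivative `∂_a f` at `p`, in the preferred chart of `p`. -/
def pd (f : M → ℝ) (p : M) (a : Fin n) : ℝ :=
  mvfderiv (𝓡 n) f p (EuclideanSpace.single a (1 : ℝ) : EuclideanSpace ℝ (Fin n))

end fields

/-! ### Affine connections and their curvature -/

/-- Affine connections on `M`: Mathlib's covariant derivatives on the tangent bundle. -/
abbrev AffineConnection (n : ℕ) (M : Type*) [TopologicalSpace M]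
    [ChartedSpace (EuclideanSpace ℝ (Fin n)) M] [IsManifold (𝓡 n) ∞ M] :=
  CovariantDerivative (𝓡 n) (EuclideanSpace ℝ (Fin n)) (TangentSpace (𝓡 n) : M → Type _)

section connections

variable {n : ℕ} {M : Type*} [TopologicalSpace M] [ChartedSpace (EuclideanSpace ℝ (Fin n)) M]
  [IsManifold (𝓡 n) ∞ M] {ℓ m k : ℕ}

/-- The coordinate vector field `∂_b` of the preferred chart of `p`. -/
def coordField (p : M) (b : Fin n) : (q : M) → TangentSpace (𝓡 n) q :=
  fun q => tangentCoordChange (𝓡 n) p q q (EuclideanSpace.single b 1)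

/-- The Christoffel symbols at `q` in the preferred chart of `p`:
`∇_{∂_a} ∂_b = ∑_c Γ^c_{ab} ∂_c`, with `christoffel D p q c a b = Γ^c_{ab}`. -/
def christoffel (D : AffineConnection n M) (p q : M) (c a b : Fin n) : ℝ :=
  tangentCoordChange (𝓡 n) q p q (D (coordField p b) q (coordField p a q)) c

/-- The coupled covariant derivative `∇_a T_b^c` at `p` of a tensor field of weight `w`. -/
def cov (D : AffineConnection n M) (w : ℝ) (T : TensorField n M ℓ m) (p : M) (a : Fin n) :
    Tensor n ℓ m := fun b c =>
  pd (fun q => inChart w T p q b c) p a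
    - ∑ i, ∑ e, christoffel D p p e a (b i) * T p (Function.update b i e) c
    + ∑ j, ∑ e, christoffel D p p (c j) a e * T p b (Function.update c j e)
    + w / (n + 1) * (∑ e, christoffel D p p e a e) * T p b c

/-- The curvature `R_{ab}^c_d`, with `(∇_a ∇_b - ∇_b ∇_a) f^c = R_{ab}^c_d f^d`. -/
def riem (D : AffineConnection n M) (p : M) (a b c d : Fin n) : ℝ :=
  pd (fun q => christoffel D p q c b d) p a - pd (fun q => christoffel D p q c a d) p b
    + ∑ e, (christoffel D p p c a e * christoffel D p p e b d
      - christoffel D p p c b e * christoffel D p p e a d)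

/-- The Ricci tensor `Ric_{bd} = R_{ab}^a_d`. -/
def ricci (D : AffineConnection n M) (p : M) (b d : Fin n) : ℝ := ∑ a, riem D p a b a d

/-- The projective Schouten tensor: the solution of `Ric_{bd} = n P_{bd} - P_{db}`, which is the
trace of the decomposition of `R` into the trace-free `W` and `P`. -/
def schouten (D : AffineConnection n M) (p : M) (b d : Fin n) : ℝ :=
  (n * ricci D p b d + ricci D p d b) / ((n : ℝ) ^ 2 - 1)

/-- The projective Weyl tensor, defined by
`R_{ab}^c_d = W_{ab}^c_d + δ_a^c P_{bd} - δ_b^c P_{ad} + β_{ab} δ^c_d`, `β_{ab} = P_{ba} - P_{ab}`.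
The order of arguments is `weyl D p a b c d = W_{ab}^c_d`. -/
def weyl (D : AffineConnection n M) (p : M) (a b c d : Fin n) : ℝ :=
  riem D p a b c d
    - (if a = c then schouten D p b d else 0) + (if b = c then schouten D p a d else 0)
    - (if c = d then schouten D p b a - schouten D p a b else 0)

/-- The Cotton tensor `A_{abc} = ∇_a P_{bc} - ∇_b P_{ac}`. -/
def cotton (D : AffineConnection n M) (p : M) (a b c : Fin n) : ℝ :=
  cov D 0 (fun (q : M) (i : Fin 2 → Fin n) (_ : Fin 0 → Fin n) => schouten D q (i 0) (i 1))
      p a ![b, c] ![]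
    - cov D 0 (fun (q : M) (i : Fin 2 → Fin n) (_ : Fin 0 → Fin n) => schouten D q (i 0) (i 1))
      p b ![a, c] ![]

/-- The components of a tangent vector at `p` in the preferred chart of `p`. -/
def vecComp {p : M} (v : TangentSpace (𝓡 n) p) (a : Fin n) : ℝ :=
  let w : EuclideanSpace ℝ (Fin n) := v
  w a

/-- `D'` is obtained from `D` by the projective change with the smooth one-form `Υ`:
`D'_X Y = D_X Y + Υ(X) Y + Υ(Y) X`. -/
def IsProjectiveChange (Υ : TensorField n M 1 0) (D D' : AffineConnection n M) : Prop :=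
  TensorSmoothOn 0 Υ Set.univ ∧
  ∀ (Y : (q : M) → TangentSpace (𝓡 n) q) (p : M),
    MDifferentiableAt (𝓡 n) ((𝓡 n).prod 𝓘(ℝ, EuclideanSpace ℝ (Fin n)))
      (fun q => (⟨q, Y q⟩ : TangentBundle (𝓡 n) M)) p →
    ∀ X : TangentSpace (𝓡 n) p,
      D' Y p X = D Y p X + (∑ a, Υ p ![a] ![] * vecComp X a) • Y p
        + (∑ a, Υ p ![a] ![] * vecComp (Y p) a) • X

end connections

/-- A projective structure: a full class of projectively equivalent smooth torsion-free
connections. -/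
structure ProjectiveStructure (n : ℕ) (M : Type*) [TopologicalSpace M]
    [ChartedSpace (EuclideanSpace ℝ (Fin n)) M] [IsManifold (𝓡 n) ∞ M] where
  conns : Set (AffineConnection n M)
  nonempty : conns.Nonempty
  smooth : ∀ D ∈ conns, D.ContMDiffCovariantDerivative ∞
  torsionFree : ∀ D ∈ conns, D.torsion = 0
  mem_iff : ∀ D ∈ conns, ∀ D', D' ∈ conns ↔ ∃ Υ, IsProjectiveChange Υ D D'

/-! ### Algebra of the fibres of `Λ^k T^*M ⊗ S² 𝓣`

In the splitting given by a connection of the class, the fibre of the standard tractor bundle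
`𝓣 = 𝓔^A` is `ℝⁿ ⊕ ℝ`.  A tractor index `A` is an element of `Option (Fin n)`: `some a` is the slot
of `Y_a^A`, and `none` is the slot of `X^A`.  Hence, for `F^{BC}` symmetric,
`F^{BC} = Y_b^B Y_c^C σ^{bc} + X^{(B} Y_c^{C)} ρ^c + X^B X^C ν` with `σ^{bc} = F (some b) (some c)`,
`ρ^c = 2 F (some c) none` and `ν = F none none`. -/

/-- Elements `F^{BC}`. -/
abbrev TMat (n : ℕ) := Matrix (Option (Fin n)) (Option (Fin n)) ℝ

/-- Elements `F_{a₁ … a_k}^{BC}`. -/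
abbrev TForm (n k : ℕ) := (Fin k → Fin n) → TMat n

/-- Fields of such elements (no regularity or symmetry imposed). -/
abbrev TFormField (n : ℕ) (M : Type*) (k : ℕ) := M → TForm n k

section algebra

variable {n k : ℕ}

/-- Skew in the form indices and symmetric in the tractor indices. -/
def IsSkewSymm (F : TForm n k) : Prop :=
  (∀ (π : Equiv.Perm (Fin k)) (a : Fin k → Fin n), F (a ∘ π) = ((Equiv.Perm.sign π : ℤ) : ℝ) • F a) ∧
  ∀ a, (F a).IsSymm

/-- Antisymmetrization (with total weight one) over all form indices. -/
def alt {ℓ : ℕ} {A : Type*} [AddCommGroup A] [Module ℝ A] (T : (Fin ℓ → Fin n) → A) :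
    (Fin ℓ → Fin n) → A := fun a =>
  ((Nat.factorial ℓ : ℝ)⁻¹) • ∑ π : Equiv.Perm (Fin ℓ), ((Equiv.Perm.sign π : ℤ) : ℝ) • T (a ∘ π)

/-- The tensorial action `(γ ♯ F)^{BC} = γ^B_P F^{PC} + γ^C_P F^{BP}`. -/
def act (γ F : TMat n) : TMat n := γ * F + F * γ.transpose

/-- The endomorphism `X^E X_F^r`. -/
def iota (r : Fin n) : TMat n := Matrix.single none (some r) 1

/-- The Kostant codifferential `f_{r a} ↦ (X^E X_F^r) ♯ f_{r a}`. -/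
def codiff (F : TForm n (k + 1)) : TForm n k := fun a => ∑ r, act (iota r) (F (Fin.cons r a))

/-- `X^{(B} Y_c^{C)} v^c`. -/
def injXY (v : Fin n → ℝ) : TMat n
  | some c, none => v c / 2
  | none, some c => v c / 2
  | _, _ => 0

/-- `X^B X^C s`. -/
def injXX (s : ℝ) : TMat n
  | none, none => s
  | _, _ => 0

/-- The change of splitting `(σ^a, ρ) ↦ (σ^a, ρ - Υ_a σ^a)` of a standard tractor. -/
def splitChange (υ : Fin n → ℝ) : TMat n := 1 - ∑ a, υ a • Matrix.single none (some a) 1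

/-- Membership in the first filtration component: `σ = 0`. -/
def InFilt1 (v : TMat n) : Prop := ∀ b c, v (some b) (some c) = 0

/-- Membership in the second filtration component: `σ = 0` and `ρ = 0`. -/
def InFilt2 (v : TMat n) : Prop := InFilt1 v ∧ ∀ b, v (some b) none = 0 ∧ v none (some b) = 0

end algebra

/-! ### The tractor connection -/

section tractor

variable {n : ℕ} {M : Type*} [TopologicalSpace M] [ChartedSpace (EuclideanSpace ℝ (Fin n)) M]
  [IsManifold (𝓡 n) ∞ M] {k : ℕ}

/-- `σ_a^{bc} = X_B^b X_C^c F_a^{BC}`, of weight `-2`. -/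
def sigma (F : TFormField n M k) : TensorField n M k 2 := fun p a c => F p a (some (c 0)) (some (c 1))

/-- `ρ_a^b = 2 X_B^b Y_C F_a^{BC}`, of weight `-2`. -/
def rho (F : TFormField n M k) : TensorField n M k 1 := fun p a c => 2 * F p a (some (c 0)) none

/-- `ν_a = Y_B Y_C F_a^{BC}`, of weight `-2`. -/
def nu (F : TFormField n M k) : TensorField n M k 0 := fun p a _ => F p a none none

/-- Smooth `k`-forms with values in `S² 𝓣` over the set `U`, in a given splitting. -/
structure IsTractorFormOn (F : TFormField n M k) (U : Set M) : Prop where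
  skewSymm : ∀ p ∈ U, IsSkewSymm (F p)
  smooth_sigma : TensorSmoothOn (-2) (sigma F) U
  smooth_rho : TensorSmoothOn (-2) (rho F) U
  smooth_nu : TensorSmoothOn (-2) (nu F) U

/-- The element of the fibre with given `σ^{bc}`, `ρ^c`, `ν`. -/
def ofSlots (σ : Fin n → Fin n → ℝ) (ρ : Fin n → ℝ) (ν : ℝ) : TMat n
  | some b, some c => σ b c
  | some c, none => ρ c / 2
  | none, some c => ρ c / 2
  | none, none => ν

/-- The matrix of `∇_c Y_a^A = -P_{ca} X^A`, `∇_c X^A = Y_c^A`. -/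
def connMatrix (D : AffineConnection n M) (p : M) (c : Fin n) : TMat n
  | some a, none => if a = c then 1 else 0
  | none, some a => - schouten D p c a
  | _, _ => 0

/-- The normal tractor connection, coupled to `D` on the form indices: `∇_c F_a^{BC}`, computed in
the splitting of `D` by the Leibniz rule. -/
def covTractor (D : AffineConnection n M) (F : TFormField n M k) (p : M) (c : Fin n) : TForm n k :=
  fun a =>
    ofSlots (fun b d => cov D (-2) (sigma F) p c a ![b, d]) (fun b => cov D (-2) (rho F) p c a ![b])
      (cov D (-2) (nu F) p c a ![]) + act (connMatrix D p c) (F p a)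

/-- The exterior covariant derivative `(d^∇ F)_{a₀ a} = ∇_{[a₀} F_{a]}`. -/
def extD (D : AffineConnection n M) (F : TFormField n M k) : TFormField n M (k + 1) :=
  fun p => alt fun a => covTractor D F p (a 0) (Fin.tail a)

/-- `α_{a₀ a}^c = W_{[r a₀}^{(r}_{|p|} σ_{a]}^{c)p}`. -/
def weylSigma (D : AffineConnection n M) (F : TFormField n M k) : TensorField n M (k + 1) 1 :=
  fun x a c => ∑ r,
    (alt (fun b : Fin (k + 2) → Fin n =>
        ∑ p, weyl D x (b 0) (b 1) r p * sigma F x (Fin.tail (Fin.tail b)) ![c 0, p]) (Fin.cons r a)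
      + alt (fun b : Fin (k + 2) → Fin n =>
        ∑ p, weyl D x (b 0) (b 1) (c 0) p * sigma F x (Fin.tail (Fin.tail b)) ![r, p])
          (Fin.cons r a)) / 2

/-- `∇_s (W_{[r a₀}^{(r}_{|p|} σ_{a]}^{s)p})`. -/
def divWeylSigma (D : AffineConnection n M) (F : TFormField n M k) (x : M)
    (a : Fin (k + 1) → Fin n) : ℝ :=
  ∑ s, cov D (-2) (weylSigma D F) x s a ![s]

/-- `½ W_{[r a₀}^r_{|p|} ρ_{a]}^p - A_{[r a₀ |p|} σ_{a]}^{pr}`. -/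
def weylRhoCottonSigma (D : AffineConnection n M) (F : TFormField n M k) (x : M)
    (a : Fin (k + 1) → Fin n) : ℝ :=
  ∑ r, (1 / 2 * alt (fun b : Fin (k + 2) → Fin n =>
        ∑ p, weyl D x (b 0) (b 1) r p * rho F x (Fin.tail (Fin.tail b)) ![p]) (Fin.cons r a)
      - alt (fun b : Fin (k + 2) → Fin n =>
        ∑ p, cotton D x (b 0) (b 1) p * sigma F x (Fin.tail (Fin.tail b)) ![p, r]) (Fin.cons r a))

/-- `∇ + Φ` on sections, and its exterior covariant derivative on forms:
`F_a ↦ ∇_{[a₀} F_{a]} + Φ_{[a₀} F_{a]}`. -/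
def extDMod (D : AffineConnection n M) (Φ : M → Fin n → TMat n →ₗ[ℝ] TMat n)
    (F : TFormField n M k) : TFormField n M (k + 1) :=
  fun p => alt fun a =>
    covTractor D F p (a 0) (Fin.tail a) + Φ p (a 0) (F p (Fin.tail a))

end tractor

/-! ### Tractor-valued forms of a projective structure -/

section inChartLinear

variable {n : ℕ} {M : Type*} [TopologicalSpace M] [ChartedSpace (EuclideanSpace ℝ (Fin n)) M]
  [IsManifold (𝓡 n) ∞ M] {ℓ m : ℕ}

theorem tensorSmoothOn_zero (w : ℝ) (U : Set M) :
    TensorSmoothOn w (0 : TensorField n M ℓ m) U := by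
  intro p b c
  have : (fun q => inChart w (0 : TensorField n M ℓ m) p q b c) = fun _ => 0 := by
    funext q; simp [inChart]
  rw [this]
  exact contMDiffOn_const

theorem TensorSmoothOn.add {w : ℝ} {S T : TensorField n M ℓ m} {U : Set M}
    (hS : TensorSmoothOn w S U) (hT : TensorSmoothOn w T U) : TensorSmoothOn w (S + T) U := by
  intro p b c
  have : (fun q => inChart w (S + T) p q b c) =
      fun q => inChart w S p q b c + inChart w T p q b c := by
    funext q; simp [inChart, mul_add, Finset.sum_add_distrib]
  rw [this]
  exact (hS p b c).add (hT p b c)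

theorem TensorSmoothOn.smul {w : ℝ} {T : TensorField n M ℓ m} {U : Set M} (r : ℝ)
    (hT : TensorSmoothOn w T U) : TensorSmoothOn w (r • T) U := by
  intro p b c
  have : (fun q => inChart w (r • T) p q b c) = fun q => r * inChart w T p q b c := by
    funext q
    simp only [inChart, Pi.smul_apply, smul_eq_mul, Finset.mul_sum]
    refine Finset.sum_congr rfl fun _ _ => Finset.sum_congr rfl fun _ _ => ?_
    ring
  rw [this]
  exact contMDiffOn_const.mul (hT p b c)

end inChartLinear

namespace ProjectiveStructure

variable {n : ℕ} {M : Type*} [TopologicalSpace M] [ChartedSpace (EuclideanSpace ℝ (Fin n)) M]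
  [IsManifold (𝓡 n) ∞ M]

/-- Smooth `k`-forms with values in `𝓔^{(BC)} = S² 𝓣`: families, indexed by the connections of the
class, of tractor-valued forms in the corresponding splittings, related by the change of splitting. -/
def TractorForm (Pr : ProjectiveStructure n M) (k : ℕ) :
    Submodule ℝ (Pr.conns → TFormField n M k) where
  carrier := {F | (∀ D, IsTractorFormOn (F D) Set.univ) ∧
    ∀ (D D' : Pr.conns) (Υ : TensorField n M 1 0), IsProjectiveChange Υ D.1 D'.1 → ∀ p a,
      F D' p a = splitChange (fun i => Υ p ![i] ![]) * F D p a *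
        (splitChange (fun i => Υ p ![i] ![])).transpose}
  zero_mem' := by
    refine ⟨fun D => ⟨fun p _ => ⟨fun π a => by simp, fun a => by simp [Matrix.IsSymm]⟩, ?_, ?_, ?_⟩,
      fun D D' Υ _ p a => by simp⟩
    · exact tensorSmoothOn_zero _ _
    · have : rho ((0 : Pr.conns → TFormField n M k) D) = 0 := by
        funext p a c; simp [rho]
      rw [this]
      exact tensorSmoothOn_zero _ _
    · exact tensorSmoothOn_zero _ _
  add_mem' := by
    rintro F G ⟨hF, hF'⟩ ⟨hG, hG'⟩
    refine ⟨fun D => ⟨fun p hp => ⟨fun π a => ?_, fun a => ?_⟩, ?_, ?_, ?_⟩, fun D D' Υ h p a => ?_⟩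
    · simp only [Pi.add_apply, smul_add]
      rw [((hF D).skewSymm p hp).1 π a, ((hG D).skewSymm p hp).1 π a]
    · exact (((hF D).skewSymm p hp).2 a).add (((hG D).skewSymm p hp).2 a)
    · exact (hF D).smooth_sigma.add (hG D).smooth_sigma
    · have : rho ((F + G) D) = rho (F D) + rho (G D) := by
        funext p a c; simp [rho, mul_add]
      rw [this]
      exact (hF D).smooth_rho.add (hG D).smooth_rho
    · exact (hF D).smooth_nu.add (hG D).smooth_nu
    · simp only [Pi.add_apply]
      rw [hF' D D' Υ h p a, hG' D D' Υ h p a, Matrix.mul_add, Matrix.add_mul]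
  smul_mem' := by
    rintro r F ⟨hF, hF'⟩
    refine ⟨fun D => ⟨fun p hp => ⟨fun π a => ?_, fun a => ?_⟩, ?_, ?_, ?_⟩, fun D D' Υ h p a => ?_⟩
    · simp only [Pi.smul_apply]
      rw [((hF D).skewSymm p hp).1 π a, smul_comm]
    · exact (((hF D).skewSymm p hp).2 a).smul r
    · exact (hF D).smooth_sigma.smul r
    · have : rho ((r • F) D) = r • rho (F D) := by
        funext p a c; simp [rho, mul_left_comm]
      rw [this]
      exact (hF D).smooth_rho.smul r
    · exact (hF D).smooth_nu.smul r
    · simp only [Pi.smul_apply]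
      rw [hF' D D' Υ h p a, Matrix.mul_smul, Matrix.smul_mul]

variable {Pr : ProjectiveStructure n M} {k : ℕ}

/-- The difference `Φ F = d̃ F - d^∇ F`, in the splitting of `D`. -/
def modification (dt : Pr.TractorForm k →ₗ[ℝ] Pr.TractorForm (k + 1)) (F : Pr.TractorForm k)
    (D : Pr.conns) : TFormField n M (k + 1) :=
  (dt F).1 D - extD D.1 (F.1 D)

/-- The normalized exterior covariant derivative: `d̃ = d^∇ + Φ`, where `Φ` is homogeneous of
degree at least one, has values in the image of `∂^*`, and `∂^* d^∇ d̃ = 0`.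
Since one-forms have degree one, `Φ` has degree at least one if and only if it maps `k`-forms with
values in a filtration component of `S² 𝓣` to `(k+1)`-forms with values in the same component. -/
structure IsNormalizedExtD (dt : Pr.TractorForm k →ₗ[ℝ] Pr.TractorForm (k + 1)) : Prop where
  filt1 : ∀ F : Pr.TractorForm k, (∀ D p a, InFilt1 (F.1 D p a)) →
    ∀ D p a, InFilt1 (modification dt F D p a)
  filt2 : ∀ F : Pr.TractorForm k, (∀ D p a, InFilt2 (F.1 D p a)) →
    ∀ D p a, InFilt2 (modification dt F D p a)
  im_codiff : ∀ F : Pr.TractorForm k, ∃ H : Pr.TractorForm (k + 2),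
    ∀ D p, modification dt F D p = codiff (H.1 D p)
  normalized : ∀ (F : Pr.TractorForm k) (D : Pr.conns) (p : M),
    codiff (extD D.1 ((dt F).1 D) p) = 0

/-- One-forms `Φ` with values in `End(S² 𝓣)`, given in each splitting, such that `∇ + Φ` is the
prolongation covariant derivative: `Φ` is smooth, homogeneous of degree at least one, has values in
the image of `∂^*_V ⊗ id`, and the curvature `Ω̃` of `∇ + Φ` satisfies `(∂^*_V ⊗ id) Ω̃ = 0`.
Only the restriction of `Φ` to symmetric arguments is relevant. -/
structure IsProlongation (Φ : Pr.conns → M → Fin n → TMat n →ₗ[ℝ] TMat n) : Prop where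
  symm : ∀ D p a (v : TMat n), v.IsSymm → (Φ D p a v).IsSymm
  smooth : ∀ D (U : Set M), IsOpen U → ∀ s : TFormField n M 0, IsTractorFormOn s U →
    IsTractorFormOn (fun p (a : Fin 1 → Fin n) => Φ D p (a 0) (s p ![])) U
  compat : ∀ (D D' : Pr.conns) (Υ : TensorField n M 1 0), IsProjectiveChange Υ D.1 D'.1 →
    ∀ p a (v : TMat n), v.IsSymm →
      Φ D' p a (splitChange (fun i => Υ p ![i] ![]) * v *
          (splitChange (fun i => Υ p ![i] ![])).transpose) =
        splitChange (fun i => Υ p ![i] ![]) * Φ D p a v *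
          (splitChange (fun i => Υ p ![i] ![])).transpose
  filt1 : ∀ D p a (v : TMat n), v.IsSymm → InFilt1 v → InFilt1 (Φ D p a v)
  filt2 : ∀ D p a (v : TMat n), v.IsSymm → InFilt2 v → InFilt2 (Φ D p a v)
  im_codiff : ∀ D p (v : TMat n), v.IsSymm → ∃ h : TForm n 2, IsSkewSymm h ∧
    (fun a : Fin 1 → Fin n => Φ D p (a 0) v) = codiff h
  normalized : ∀ (D : Pr.conns) (U : Set M), IsOpen U → ∀ s : TFormField n M 0,
    IsTractorFormOn s U → ∀ p ∈ U, codiff (extDMod D.1 (Φ D) (extDMod D.1 (Φ D) s) p) = 0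

end ProjectiveStructure

/-! ### The Eastwood–Matveev connection -/

section EastwoodMatveev

variable {n : ℕ} {M : Type*} [TopologicalSpace M] [ChartedSpace (EuclideanSpace ℝ (Fin n)) M]
  [IsManifold (𝓡 n) ∞ M]

/-- The element of `S² 𝓣` corresponding to a triple `(σ^{bc}, μ^c, ρ)` in the conventions of Eastwood
and Matveev. -/
def emInj (σ : Tensor n 0 2) (μ : Tensor n 0 1) (ρ : Tensor n 0 0) : TMat n :=
  ofSlots (fun b c => σ ![] ![b, c]) (fun c => -2 * μ ![] ![c]) (ρ ![] ![])

/-- The metrizability connection of Eastwood and Matveev in direction `a`: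
`∇_a σ^{bc} - δ_a^b μ^c - δ_a^c μ^b`,
`∇_a μ^b - δ_a^b ρ + P_{ac} σ^{bc} - (1/n) W_{ac}^b_d σ^{cd}`,
`∇_a ρ + 2 P_{ab} μ^b - (4/n) Y_{abc} σ^{bc}` with `2 Y_{abc} = ∇_a P_{bc} - ∇_b P_{ac}`. -/
def emConnection (D : AffineConnection n M) (σ : TensorField n M 0 2) (μ : TensorField n M 0 1)
    (ρ : TensorField n M 0 0) (p : M) (a : Fin n) : Tensor n 0 2 × Tensor n 0 1 × Tensor n 0 0 :=
  (fun i c => cov D (-2) σ p a i c - (if a = c 0 then μ p ![] ![c 1] else 0)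
      - (if a = c 1 then μ p ![] ![c 0] else 0),
   fun i b => cov D (-2) μ p a i b - (if a = b 0 then ρ p ![] ![] else 0)
      + ∑ c, schouten D p a c * σ p ![] ![b 0, c]
      - 1 / (n : ℝ) * ∑ c, ∑ d, weyl D p a c (b 0) d * σ p ![] ![c, d],
   fun i j => cov D (-2) ρ p a i j + 2 * ∑ b, schouten D p a b * μ p ![] ![b]
      - 4 / (n : ℝ) * ∑ b, ∑ c, (cotton D p a b c / 2) * σ p ![] ![b, c])

end EastwoodMatveev

end ProjectiveTractor

end

open scoped Manifold ContDiff

noncomputable section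

set_option linter.unusedSectionVars false

namespace ProjectiveTractor

/-! ### Differential calculus in a preferred chart -/

section chartCalculus

variable {n : ℕ} {M : Type*} [TopologicalSpace M] [ChartedSpace (EuclideanSpace ℝ (Fin n)) M]

/-! Two things carry the theorem: the curvature of the normal tractor connection, and the action of
`∂^* d^∇` on the image of `∂^*`. In a fixed chart the tractor connection is a matrix-valued one-form
`lgam`, and a tractor-valued form becomes an array `loc` of functions. Changes of chart and of
connection are both gauge transformations. The curvature `tcurv` has the Weyl tensor as its main
block, minus the Cotton tensor below it, and zeros elsewhere (`weyl_eq`, `cotton_eq`,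
`tcurv_some_none`, `tcurv_none_none`). Its trace-freeness (`tcurv_trace`) determines the Schouten
entry of the connection matrix, so the tractor connection is independent of the chosen connection in
the class (`changedGam_eq`). Hence `d^∇` and `∂^*` descend to invariant operators `extDT` and
`codiffT`, and `d^∇ d^∇` is the algebraic action of the curvature (`extD_extD`).

An element `E` of `im ∂^*` in degree `k + 1` has `σ = 0` and a trace-free `ρ`. On such `E` the
operator `∂^* d^∇` is triangular: it multiplies `ρ` by `(n - k)/(k + 2)`, and `ν` by `2(n - k -
1)/(k + 2)` up to a divergence of `ρ` (`codiff_extD_some_none`, `codiff_extD_none_none`). For `k ≤ n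
- 2` both factors are non-zero. Two normalized operators differ by an element of `im ∂^*` killed by
`∂^* d^∇`, so they agree. For existence, the failure `∂^* d^∇ d^∇ F` is removed in two steps, first
in the `ρ`-slot (`preT`) and then in the `ν`-slot (`normT`), dividing by the two factors. Evaluating
the curvature slots gives the explicit formula. For `k ≥ n - 1` there are no non-zero `(k +
2)`-forms, so `im ∂^*` vanishes and `d^∇` is already normalized.

For sections the traces of the Weyl tensor vanish, and the contracted Bianchi identity `∇_s
W_{ra}^s_t = (n - 2) A_{rat}` (`sum_dc_tcurv`) evaluates the divergence, giving the simplified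
formula.

The prolongation connection must use an algebraic `Φ`, so derivatives of `σ` are not available for
the correction. The curvature of `∇ + Φ` contains the additional term `Φ ∧ (∇ + Φ)`. Normalizing the
`ρ`-slot forces `ρ(Φ) = -(2/n) W σ`; then in the `ν`-slot the `W ∇σ` coming from `d^∇ Φ` cancels
against the one coming from that additional term, and what is left forces `ν(Φ) = (2/n) A σ`
(`codiff_curvature_none_none`). The result is `-(2/n) ∂^* Ω`, with `Ω` the tractor curvature
(`prolong_eq`), which makes its smoothness and invariance automatic. Comparing slots under `ρ = -2
μ` identifies it with the Eastwood–Matveev connection. -/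

variable (n) in
/-- Smoothness of a real function at a point. -/
abbrev SmoothAt (f : M → ℝ) (q : M) : Prop := ContMDiffAt (𝓡 n) 𝓘(ℝ, ℝ) ∞ f q

variable (n) in
/-- The domain of the preferred chart of `p`. -/
abbrev dom (p : M) : Set M := (chartAt (EuclideanSpace ℝ (Fin n)) p).source

/-- The partial derivative `∂_a f` at `q` in the preferred chart of `p`. -/
def dc (p : M) (f : M → ℝ) (q : M) (a : Fin n) : ℝ :=
  fderiv ℝ (f ∘ (chartAt (EuclideanSpace ℝ (Fin n)) p).symm)
    (chartAt (EuclideanSpace ℝ (Fin n)) p q) (EuclideanSpace.single a 1)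

theorem dom_mem_nhds {p q : M} (hq : q ∈ dom n p) : dom n p ∈ nhds q :=
  (chartAt (EuclideanSpace ℝ (Fin n)) p).open_source.mem_nhds hq

theorem self_mem_dom (p : M) : p ∈ dom n p := mem_chart_source _ p

variable {p q : M} {f g : M → ℝ}

theorem dc_congr (hq : q ∈ dom n p) (h : f =ᶠ[nhds q] g) (a : Fin n) : dc p f q a = dc p g q a := by
  have hc := (chartAt (EuclideanSpace ℝ (Fin n)) p).continuousAt_symm
    ((chartAt (EuclideanSpace ℝ (Fin n)) p).map_source hq)
  rw [ContinuousAt, (chartAt (EuclideanSpace ℝ (Fin n)) p).left_inv hq] at hc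
  have : f ∘ (chartAt (EuclideanSpace ℝ (Fin n)) p).symm =ᶠ[nhds
      (chartAt (EuclideanSpace ℝ (Fin n)) p q)] g ∘ (chartAt (EuclideanSpace ℝ (Fin n)) p).symm :=
    hc.eventually h
  rw [dc, dc, this.fderiv_eq]

variable [IsManifold (𝓡 n) ∞ M]

theorem smoothAt_iff (hq : q ∈ dom n p) : SmoothAt n f q ↔
    ContDiffAt ℝ ∞ (f ∘ (chartAt (EuclideanSpace ℝ (Fin n)) p).symm)
      (chartAt (EuclideanSpace ℝ (Fin n)) p q) := by
  rw [SmoothAt, contMDiffAt_iff_source_of_mem_source (x := p) hq, contMDiffWithinAt_iff_contDiffWithinAt]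
  simp [contDiffWithinAt_univ]

theorem SmoothAt.differentiableAt (hf : SmoothAt n f q) (hq : q ∈ dom n p) :
    DifferentiableAt ℝ (f ∘ (chartAt (EuclideanSpace ℝ (Fin n)) p).symm)
      (chartAt (EuclideanSpace ℝ (Fin n)) p q) :=
  ((smoothAt_iff hq).1 hf).differentiableAt (by simp)

theorem dc_add (hq : q ∈ dom n p) (hf : SmoothAt n f q) (hg : SmoothAt n g q) (a : Fin n) :
    dc p (fun z => f z + g z) q a = dc p f q a + dc p g q a := by
  have := fderiv_add (hf.differentiableAt hq) (hg.differentiableAt hq)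
  exact congrArg (fun L => L (EuclideanSpace.single a 1)) this

theorem dc_mul (hq : q ∈ dom n p) (hf : SmoothAt n f q) (hg : SmoothAt n g q) (a : Fin n) :
    dc p (fun z => f z * g z) q a = dc p f q a * g q + f q * dc p g q a := by
  have := fderiv_mul (hf.differentiableAt hq) (hg.differentiableAt hq)
  have := congrArg (fun L => L (EuclideanSpace.single a 1)) this
  refine this.trans ?_
  simp [dc, (chartAt (EuclideanSpace ℝ (Fin n)) p).left_inv hq]
  ring

theorem smoothAt_const (c : ℝ) : SmoothAt n (fun _ : M => c) q := contMDiffAt_const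

theorem SmoothAt.fun_mul (hf : SmoothAt n f q) (hg : SmoothAt n g q) :
    SmoothAt n (fun z => f z * g z) q := ContMDiffAt.mul hf hg

theorem SmoothAt.fun_add (hf : SmoothAt n f q) (hg : SmoothAt n g q) :
    SmoothAt n (fun z => f z + g z) q := ContMDiffAt.add hf hg

theorem SmoothAt.fun_sub (hf : SmoothAt n f q) (hg : SmoothAt n g q) :
    SmoothAt n (fun z => f z - g z) q := ContMDiffAt.sub hf hg

theorem SmoothAt.fun_neg (hf : SmoothAt n f q) : SmoothAt n (fun z => - f z) q := ContMDiffAt.neg hf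

theorem dc_const (p q : M) (c : ℝ) (a : Fin n) : dc p (fun _ => c) q a = 0 := by
  have : (fun _ : M => c) ∘ (chartAt (EuclideanSpace ℝ (Fin n)) p).symm = fun _ => c := rfl
  rw [dc, this]; simp

theorem dc_const_mul (hq : q ∈ dom n p) (hf : SmoothAt n f q) (c : ℝ) (a : Fin n) :
    dc p (fun z => c * f z) q a = c * dc p f q a := by
  rw [dc_mul hq contMDiffAt_const hf, dc_const]; ring

theorem dc_neg (hq : q ∈ dom n p) (hf : SmoothAt n f q) (a : Fin n) :
    dc p (fun z => - f z) q a = - dc p f q a := by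
  have := dc_const_mul hq hf (-1) a
  simpa using this

theorem dc_sub (hq : q ∈ dom n p) (hf : SmoothAt n f q) (hg : SmoothAt n g q) (a : Fin n) :
    dc p (fun z => f z - g z) q a = dc p f q a - dc p g q a := by
  have := dc_add hq hf hg.neg a
  simp only [sub_eq_add_neg]
  rw [← dc_neg hq hg]
  exact this

theorem smoothAt_sum {ι : Type*} {s : Finset ι} {F : ι → M → ℝ} (h : ∀ i ∈ s, SmoothAt n (F i) q) :
    SmoothAt n (fun z => ∑ i ∈ s, F i z) q := by
  classical
  induction s using Finset.induction_on with
  | empty => simpa using contMDiffAt_const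
  | insert i s hi ih =>
    simp only [Finset.sum_insert hi]
    exact (h i (by simp)).add (ih fun j hj => h j (by simp [hj]))

theorem smoothAt_prod {ι : Type*} {s : Finset ι} {F : ι → M → ℝ} (h : ∀ i ∈ s, SmoothAt n (F i) q) :
    SmoothAt n (fun z => ∏ i ∈ s, F i z) q := by
  classical
  induction s using Finset.induction_on with
  | empty => simpa using contMDiffAt_const
  | insert i s hi ih =>
    simp only [Finset.prod_insert hi]
    exact (h i (by simp)).mul (ih fun j hj => h j (by simp [hj]))

theorem dc_sum (hq : q ∈ dom n p) {ι : Type*} {s : Finset ι} {F : ι → M → ℝ}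
    (h : ∀ i ∈ s, SmoothAt n (F i) q) (a : Fin n) :
    dc p (fun z => ∑ i ∈ s, F i z) q a = ∑ i ∈ s, dc p (F i) q a := by
  classical
  induction s using Finset.induction_on with
  | empty => simpa using dc_const p q 0 a
  | insert i s hi ih =>
    simp only [Finset.sum_insert hi]
    rw [dc_add hq (h i (by simp)) (smoothAt_sum fun j hj => h j (by simp [hj])),
      ih fun j hj => h j (by simp [hj])]

theorem dc_prod (hq : q ∈ dom n p) {ι : Type*} [DecidableEq ι] {s : Finset ι} {F : ι → M → ℝ}
    (h : ∀ i ∈ s, SmoothAt n (F i) q) (a : Fin n) :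
    dc p (fun z => ∏ i ∈ s, F i z) q a =
      ∑ i ∈ s, (∏ j ∈ s.erase i, F j q) * dc p (F i) q a := by
  induction s using Finset.induction_on with
  | empty => simpa using dc_const p q 1 a
  | insert i s hi ih =>
    simp only [Finset.prod_insert hi]
    rw [dc_mul hq (h i (by simp)) (smoothAt_prod fun j hj => h j (by simp [hj])),
      ih fun j hj => h j (by simp [hj]), Finset.sum_insert hi, Finset.erase_insert hi, Finset.mul_sum,
      mul_comm]
    congr 1
    refine Finset.sum_congr rfl fun j hj => ?_
    have hij : i ≠ j := fun e => hi (e ▸ hj)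
    rw [Finset.erase_insert_of_ne hij, Finset.prod_insert (by simp [hi]), mul_assoc]

theorem smoothAt_dc (hq : q ∈ dom n p) (hf : SmoothAt n f q) (a : Fin n) :
    SmoothAt n (fun z => dc p f z a) q := by
  rw [smoothAt_iff hq]
  have h1 : ContDiffAt ℝ ∞ (fun x => fderiv ℝ (f ∘ (chartAt (EuclideanSpace ℝ (Fin n)) p).symm) x
      (EuclideanSpace.single a 1)) (chartAt (EuclideanSpace ℝ (Fin n)) p q) :=
    (((smoothAt_iff hq).1 hf).fderiv_right (m := ∞) (by simp)).clm_apply contDiffAt_const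
  refine h1.congr_of_eventuallyEq ?_
  filter_upwards [(chartAt (EuclideanSpace ℝ (Fin n)) p).open_target.mem_nhds
    ((chartAt (EuclideanSpace ℝ (Fin n)) p).map_source hq)] with x hx
  simp [dc, (chartAt (EuclideanSpace ℝ (Fin n)) p).right_inv hx]

/-- Symmetry of the second Fréchet derivative. The inner partial derivative agrees with an `fderiv`
only on the target of the chart, hence the passage through an eventual equality. -/
theorem dc_comm (hq : q ∈ dom n p) (hf : SmoothAt n f q) (a b : Fin n) :
    dc p (fun z => dc p f z b) q a = dc p (fun z => dc p f z a) q b := by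
  have hf' := (smoothAt_iff hq).1 hf
  have key : ∀ a b : Fin n, dc p (fun z => dc p f z b) q a =
      fderiv ℝ (fderiv ℝ (f ∘ (chartAt (EuclideanSpace ℝ (Fin n)) p).symm))
        (chartAt (EuclideanSpace ℝ (Fin n)) p q) (EuclideanSpace.single a 1)
        (EuclideanSpace.single b 1) := by
    intro a b
    have he : (fun z => dc p f z b) ∘ (chartAt (EuclideanSpace ℝ (Fin n)) p).symm =ᶠ[nhds
        (chartAt (EuclideanSpace ℝ (Fin n)) p q)]
        fun x => fderiv ℝ (f ∘ (chartAt (EuclideanSpace ℝ (Fin n)) p).symm) x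
          (EuclideanSpace.single b 1) := by
      filter_upwards [(chartAt (EuclideanSpace ℝ (Fin n)) p).open_target.mem_nhds
        ((chartAt (EuclideanSpace ℝ (Fin n)) p).map_source hq)] with x hx
      simp [dc, (chartAt (EuclideanSpace ℝ (Fin n)) p).right_inv hx]
    have hd : DifferentiableAt ℝ (fderiv ℝ (f ∘ (chartAt (EuclideanSpace ℝ (Fin n)) p).symm))
        (chartAt (EuclideanSpace ℝ (Fin n)) p q) :=
      (hf'.fderiv_right (m := ∞) (by simp)).differentiableAt (by simp)
    rw [dc, he.fderiv_eq, fderiv_clm_apply hd (differentiableAt_const _)]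
    simp
  rw [key, key]
  exact hf'.isSymmSndFDerivAt (by simpa using (WithTop.coe_le_coe.2 le_top : ((2 : ℕ∞) : WithTop ℕ∞) ≤ ∞)) _ _

/-- `pd` changes its chart with the base point, so it cannot be iterated. This is the bridge to
`dc`, where the chart stays fixed while the point moves. -/
theorem pd_eq_dc (hf : SmoothAt n f p) (a : Fin n) : pd f p a = dc p f p a := by
  have h : MDifferentiableAt (𝓡 n) 𝓘(ℝ, ℝ) f p := hf.mdifferentiableAt (by simp)
  have h2 : mfderiv (𝓡 n) 𝓘(ℝ, ℝ) f p =
      fderiv ℝ (f ∘ (chartAt (EuclideanSpace ℝ (Fin n)) p).symm)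
        (chartAt (EuclideanSpace ℝ (Fin n)) p p) := by
    refine h.mfderiv.trans ?_
    simp [writtenInExtChartAt, fderivWithin_univ]
    rfl
  simp only [pd, dc, mvfderiv, h2]
  rfl

/-- The coordinate functions of the preferred chart of `p`. -/
def coord (p : M) (c : Fin n) (z : M) : ℝ := chartAt (EuclideanSpace ℝ (Fin n)) p z c

theorem smoothAt_coord (hq : q ∈ dom n p) (c : Fin n) : SmoothAt n (coord p c) q := by
  rw [smoothAt_iff hq]
  have : ContDiffAt ℝ ∞ (fun x : EuclideanSpace ℝ (Fin n) => x c)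
      (chartAt (EuclideanSpace ℝ (Fin n)) p q) := by fun_prop
  refine this.congr_of_eventuallyEq ?_
  filter_upwards [(chartAt (EuclideanSpace ℝ (Fin n)) p).open_target.mem_nhds
    ((chartAt (EuclideanSpace ℝ (Fin n)) p).map_source hq)] with x hx
  simp [coord, (chartAt (EuclideanSpace ℝ (Fin n)) p).right_inv hx]

theorem hasFDerivAt_transition {p p' q : M} (hq : q ∈ dom n p) (hq' : q ∈ dom n p') :
    HasFDerivAt (chartAt (EuclideanSpace ℝ (Fin n)) p' ∘ (chartAt (EuclideanSpace ℝ (Fin n)) p).symm)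
      (tangentCoordChange (𝓡 n) p p' q) (chartAt (EuclideanSpace ℝ (Fin n)) p q) := by
  have := hasFDerivWithinAt_tangentCoordChange (I := 𝓡 n) (x := p) (y := p') (z := q)
    ⟨by simpa using hq, by simpa using hq'⟩
  simpa [hasFDerivWithinAt_univ] using this

theorem jac_eq_dc {p p' q : M} (hq : q ∈ dom n p) (hq' : q ∈ dom n p') (c d : Fin n) :
    jac p p' q c d = dc p (coord p' c) q d := by
  have h := hasFDerivAt_transition hq hq'
  have h2 := (EuclideanSpace.proj c : EuclideanSpace ℝ (Fin n) →L[ℝ] ℝ).hasFDerivAt.comp _ h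
  have h3 : coord p' c ∘ (chartAt (EuclideanSpace ℝ (Fin n)) p).symm =
    (EuclideanSpace.proj c : EuclideanSpace ℝ (Fin n) →L[ℝ] ℝ) ∘
      (chartAt (EuclideanSpace ℝ (Fin n)) p' ∘ (chartAt (EuclideanSpace ℝ (Fin n)) p).symm) := rfl
  rw [dc, h3, h2.fderiv]
  rfl

theorem smoothAt_jac {p p' q : M} (hq : q ∈ dom n p) (hq' : q ∈ dom n p') (c d : Fin n) :
    SmoothAt n (fun z => jac p p' z c d) q := by
  refine (smoothAt_dc hq (smoothAt_coord hq' c) d).congr_of_eventuallyEq ?_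
  filter_upwards [dom_mem_nhds hq, dom_mem_nhds hq'] with z hz hz'
  exact jac_eq_dc hz hz' c d

/-- The derivatives of the Jacobian matrix of a change of coordinates are symmetric. -/
theorem dc_jac_comm {p p' q : M} (hq : q ∈ dom n p) (hq' : q ∈ dom n p') (c a b : Fin n) :
    dc p (fun z => jac p p' z c b) q a = dc p (fun z => jac p p' z c a) q b := by
  have key : ∀ b : Fin n, (fun z => jac p p' z c b) =ᶠ[nhds q] fun z => dc p (coord p' c) z b := by
    intro b
    filter_upwards [dom_mem_nhds hq, dom_mem_nhds hq'] with z hz hz'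
    exact jac_eq_dc hz hz' c b
  rw [dc_congr hq (key b), dc_congr hq (key a), dc_comm hq (smoothAt_coord hq' c)]

theorem euclidean_eq_sum (v : EuclideanSpace ℝ (Fin n)) :
    v = ∑ e, v e • (EuclideanSpace.single e (1 : ℝ) : EuclideanSpace ℝ (Fin n)) := by
  ext i
  simp [Finset.sum_apply, Pi.single_apply]

/-- Change of coordinates for partial derivatives. -/
theorem dc_chain {p p' q : M} (hq : q ∈ dom n p) (hq' : q ∈ dom n p') (hf : SmoothAt n f q)
    (a : Fin n) : dc p f q a = ∑ e, jac p p' q e a * dc p' f q e := by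
  have h := hasFDerivAt_transition hq hq'
  have hd := (hf.differentiableAt hq').hasFDerivAt
  have hx : chartAt (EuclideanSpace ℝ (Fin n)) p' q = (chartAt (EuclideanSpace ℝ (Fin n)) p' ∘
    (chartAt (EuclideanSpace ℝ (Fin n)) p).symm) (chartAt (EuclideanSpace ℝ (Fin n)) p q) := by
    simp [(chartAt (EuclideanSpace ℝ (Fin n)) p).left_inv hq]
  have hd' := hd
  rw [hx] at hd
  have h2 := hd.comp _ h
  have h3 : f ∘ (chartAt (EuclideanSpace ℝ (Fin n)) p).symm =ᶠ[nhds
      (chartAt (EuclideanSpace ℝ (Fin n)) p q)]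
      (f ∘ (chartAt (EuclideanSpace ℝ (Fin n)) p').symm) ∘
      (chartAt (EuclideanSpace ℝ (Fin n)) p' ∘ (chartAt (EuclideanSpace ℝ (Fin n)) p).symm) := by
    have hc := (chartAt (EuclideanSpace ℝ (Fin n)) p).continuousAt_symm
      ((chartAt (EuclideanSpace ℝ (Fin n)) p).map_source hq)
    rw [ContinuousAt, (chartAt (EuclideanSpace ℝ (Fin n)) p).left_inv hq] at hc
    filter_upwards [hc (dom_mem_nhds hq')] with x hx
    simp only [Function.comp_apply]
    rw [(chartAt (EuclideanSpace ℝ (Fin n)) p').left_inv hx]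
  rw [dc, h3.fderiv_eq, h2.fderiv, ContinuousLinearMap.comp_apply]
  conv_lhs => rw [euclidean_eq_sum (tangentCoordChange (𝓡 n) p p' q (EuclideanSpace.single a 1))]
  rw [map_sum]
  refine Finset.sum_congr rfl fun e _ => ?_
  rw [map_smul, smul_eq_mul, ← hx]
  rfl

theorem jac_self {p q : M} (hq : q ∈ dom n p) : (jac p p q : Matrix (Fin n) (Fin n) ℝ) = 1 := by
  ext c d
  rw [jac, tangentCoordChange_self (by simpa using hq)]
  simp [Matrix.one_apply]

theorem jac_mul {p p' r q : M} (hp : q ∈ dom n p) (hp' : q ∈ dom n p') (hr : q ∈ dom n r) :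
    (jac p' r q * jac p p' q : Matrix (Fin n) (Fin n) ℝ) = jac p r q := by
  ext c d
  rw [Matrix.mul_apply]
  simp only [jac]
  rw [← tangentCoordChange_comp (I := 𝓡 n) (w := p) (x := p') (y := r) (z := q) ⟨⟨by simpa using hp, by simpa using hp'⟩, by simpa using hr⟩]
  conv_rhs => rw [euclidean_eq_sum (tangentCoordChange (𝓡 n) p p' q (EuclideanSpace.single d 1))]
  rw [map_sum]
  simp [mul_comm]

theorem jac_mul_jac {p p' q : M} (hp : q ∈ dom n p) (hp' : q ∈ dom n p') :
    (jac p' p q * jac p p' q : Matrix (Fin n) (Fin n) ℝ) = 1 := by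
  rw [jac_mul hp hp' hp, jac_self hp]

end chartCalculus

/-! ### Christoffel symbols -/

section christoffelSymbols

variable {n : ℕ} {M : Type*} [TopologicalSpace M] [ChartedSpace (EuclideanSpace ℝ (Fin n)) M]
  [IsManifold (𝓡 n) ∞ M] {p p' q : M}

/-- Smoothness at `q` of a vector field. -/
abbrev FieldSmoothAt (Y : (z : M) → TangentSpace (𝓡 n) z) (q : M) : Prop :=
  ContMDiffAt (𝓡 n) ((𝓡 n).prod 𝓘(ℝ, EuclideanSpace ℝ (Fin n))) ∞
    (fun z => (⟨z, Y z⟩ : TangentBundle (𝓡 n) M)) q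

theorem fieldSmoothAt_iff (hq : q ∈ dom n p) (Y : (z : M) → TangentSpace (𝓡 n) z) :
    FieldSmoothAt Y q ↔
      ∀ c : Fin n, SmoothAt n (fun z => tangentCoordChange (𝓡 n) z p z (Y z) c) q := by
  have h := (trivializationAt (EuclideanSpace ℝ (Fin n)) (TangentSpace (𝓡 n) : M → Type _)
    p).contMDiffAt_section_iff (IB := 𝓡 n) (n := ∞) (s := Y) (x₀ := q) hq
  refine h.trans ?_
  constructor
  · intro h c
    have h2 : ContMDiff 𝓘(ℝ, EuclideanSpace ℝ (Fin n)) 𝓘(ℝ, ℝ) ∞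
        (fun x : EuclideanSpace ℝ (Fin n) => x c) := by
      rw [contMDiff_iff_contDiff]; fun_prop
    exact h2.contMDiffAt.comp q h
  · intro h
    have h3 : ∀ f : M → EuclideanSpace ℝ (Fin n), (∀ c, SmoothAt n (fun z => f z c) q) →
        ContMDiffAt (𝓡 n) 𝓘(ℝ, EuclideanSpace ℝ (Fin n)) ∞ f q := by
      intro f hf
      have h4 : ContMDiffAt (𝓡 n) 𝓘(ℝ, Fin n → ℝ) ∞ (fun z => (f z).ofLp) q :=
        contMDiffAt_pi_space.2 hf
      have h5 : ContMDiff 𝓘(ℝ, Fin n → ℝ) 𝓘(ℝ, EuclideanSpace ℝ (Fin n)) ∞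
          (fun x : Fin n → ℝ => WithLp.toLp 2 x) := by
        rw [contMDiff_iff_contDiff]; fun_prop
      exact h5.contMDiffAt.comp q h4
    exact h3 _ h

theorem coordField_apply (p : M) (b : Fin n) (q : M) (e : Fin n) :
    vecComp (coordField p b q) e = jac p q q e b := rfl

theorem coordField_comp (hp : q ∈ dom n p) (hp' : q ∈ dom n p') (b e : Fin n) :
    tangentCoordChange (𝓡 n) q p' q (coordField p b q) e = jac p p' q e b := by
  rw [coordField, tangentCoordChange_comp ⟨⟨by simpa using hp, by simp⟩, by simpa using hp'⟩]
  rfl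

theorem fieldSmoothAt_coordField (hq : q ∈ dom n p) (b : Fin n) :
    FieldSmoothAt (coordField p b) q := by
  rw [fieldSmoothAt_iff hq]
  intro c
  refine (smoothAt_jac hq hq c b).congr_of_eventuallyEq ?_
  filter_upwards [dom_mem_nhds hq] with z hz
  exact coordField_comp hz hz b c

theorem FieldSmoothAt.mdifferentiableAt {Y : (z : M) → TangentSpace (𝓡 n) z}
    (h : FieldSmoothAt Y q) :
    MDifferentiableAt (𝓡 n) ((𝓡 n).prod 𝓘(ℝ, EuclideanSpace ℝ (Fin n)))
      (fun z => (⟨z, Y z⟩ : TangentBundle (𝓡 n) M)) q :=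
  ContMDiffAt.mdifferentiableAt h (by simp)

/-- A coordinate field is smooth only on its chart domain. It is cut off by a bump function equal to
one near `q`; by locality the connection does not see the cut-off there. -/
theorem smoothAt_christoffel [T2Space M] (D : AffineConnection n M)
    (hD : D.ContMDiffCovariantDerivative ∞) (hq : q ∈ dom n p) (c a b : Fin n) :
    SmoothAt n (fun z => christoffel D p z c a b) q := by
  obtain ⟨ψ, -, hψ⟩ := (SmoothBumpFunction.nhds_basis_tsupport (I := 𝓡 n) q).mem_iff.1
    (dom_mem_nhds hq)
  have hY : ContMDiff (𝓡 n) ((𝓡 n).prod 𝓘(ℝ, EuclideanSpace ℝ (Fin n))) ∞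
      (fun z => (⟨z, ((ψ : M → ℝ) • coordField p b) z⟩ : TangentBundle (𝓡 n) M)) :=
    ContMDiffOn.smul_section_of_tsupport (u := dom n p) ψ.contMDiff.contMDiffOn
      (chartAt (EuclideanSpace ℝ (Fin n)) p).open_source hψ
      fun z hz => ContMDiffAt.contMDiffWithinAt (fieldSmoothAt_coordField hz b)
  have h1 := hD.contMDiff.contMDiff (σ := (ψ : M → ℝ) • coordField p b)
    (by simpa using hY.contMDiffOn)
  have h2 := ContMDiffAt.clm_bundle_apply (h1.contMDiffAt Filter.univ_mem)
    (fieldSmoothAt_coordField hq a)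
  have h3 := (fieldSmoothAt_iff hq _).1 h2 c
  refine h3.congr_of_eventuallyEq ?_
  filter_upwards [dom_mem_nhds hq, ψ.eventuallyEq_one.eventuallyEq_nhds] with z hz hψz
  have h4 : D (coordField p b) z = D ((ψ : M → ℝ) • coordField p b) z := by
    refine D.isCovariantDerivativeOnUniv.congr_of_eventuallyEq
      (fieldSmoothAt_coordField hz b).mdifferentiableAt
      (FieldSmoothAt.mdifferentiableAt (hY z)) Filter.univ_mem ?_
    filter_upwards [hψz] with y hy
    simp [hy]
  simp only [christoffel]
  rw [h4]

/-- Coordinate fields are pullbacks under the chart of constant fields on the model space, and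
brackets commute with pullback. -/
theorem mlieBracket_coordField (hq : q ∈ dom n p) (a b : Fin n) :
    VectorField.mlieBracket (𝓡 n) (coordField p a) (coordField p b) q = 0 := by
  let V : Fin n → (x : EuclideanSpace ℝ (Fin n)) → TangentSpace 𝓘(ℝ, EuclideanSpace ℝ (Fin n)) x :=
    fun a _ => (EuclideanSpace.single a 1 : EuclideanSpace ℝ (Fin n))
  have key : ∀ a : Fin n, coordField p a =ᶠ[nhds q]
      VectorField.mpullback (𝓡 n) 𝓘(ℝ, EuclideanSpace ℝ (Fin n)) (extChartAt (𝓡 n) p) (V a) := by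
    intro a
    filter_upwards [dom_mem_nhds hq] with z hz
    have h1 : mfderiv (𝓡 n) 𝓘(ℝ, EuclideanSpace ℝ (Fin n)) (extChartAt (𝓡 n) p) z =
      tangentCoordChange (𝓡 n) z p z := by
      have := mfderiv_chartAt_eq_tangentCoordChange (I := 𝓡 n) hz
      exact this
    refine Eq.symm (((isInvertible_mfderiv_extChartAt
      (by simpa using hz)).inverse_apply_eq (y := V a (extChartAt (𝓡 n) p z))).2 ?_)
    rw [h1]
    exact ((tangentCoordChange_comp (I := 𝓡 n) (w := p) (x := z) (y := p) (z := z)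
      ⟨⟨by simpa using hz, by simp⟩, by simpa using hz⟩).trans
        (tangentCoordChange_self (by simpa using hz))).symm
  have hV : ∀ a, VectorField.mlieBracket 𝓘(ℝ, EuclideanSpace ℝ (Fin n)) (V a) (V b) = 0 := by
    intro a
    rw [← VectorField.mlieBracketWithin_univ, VectorField.mlieBracketWithin_eq_lieBracketWithin]
    ext x
    simp [VectorField.lieBracketWithin, V]
    rfl
  have hd : ∀ a x, MDifferentiableAt 𝓘(ℝ, EuclideanSpace ℝ (Fin n))
      (𝓘(ℝ, EuclideanSpace ℝ (Fin n)).prod 𝓘(ℝ, EuclideanSpace ℝ (Fin n)))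
      (fun x => (⟨x, V a x⟩ : TangentBundle 𝓘(ℝ, EuclideanSpace ℝ (Fin n))
        (EuclideanSpace ℝ (Fin n)))) x := by
    intro a x
    have : ContMDiffAt 𝓘(ℝ, EuclideanSpace ℝ (Fin n))
      (𝓘(ℝ, EuclideanSpace ℝ (Fin n)).prod 𝓘(ℝ, EuclideanSpace ℝ (Fin n))) 1
      (fun x => (⟨x, V a x⟩ : TangentBundle 𝓘(ℝ, EuclideanSpace ℝ (Fin n))
        (EuclideanSpace ℝ (Fin n)))) x :=
      contMDiffAt_vectorSpace_iff_contDiffAt.2 contDiffAt_const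
    exact this.mdifferentiableAt one_ne_zero
  have : IsManifold (𝓡 n) (minSmoothness ℝ 2) M := by
    rw [minSmoothness_of_isRCLikeNormedField]; infer_instance
  rw [Filter.EventuallyEq.mlieBracket_vectorField_eq (key a) (key b),
    ← VectorField.mpullback_mlieBracket (n := 2) (hd a _) (hd b _) ?_ (by simp), hV]
  · simp
  · exact contMDiffAt_extChartAt' hq

theorem christoffel_symm (D : AffineConnection n M) (hD : D.torsion = 0) (hq : q ∈ dom n p)
    (c a b : Fin n) : christoffel D p q c a b = christoffel D p q c b a := by
  have h := D.torsion_eq_zero_iff.1 hD (fieldSmoothAt_coordField hq a).mdifferentiableAt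
    (fieldSmoothAt_coordField hq b).mdifferentiableAt
  rw [mlieBracket_coordField hq, sub_eq_zero] at h
  rw [christoffel, christoffel, h]

theorem mvfderiv_coordField {f : M → ℝ} (hq : q ∈ dom n p) (hf : SmoothAt n f q) (a : Fin n) :
    mvfderiv (𝓡 n) f q (coordField p a q) = dc p f q a := by
  rw [dc_chain hq (self_mem_dom q) hf]
  have h : coordField p a q = ∑ e, jac p q q e a •
      (EuclideanSpace.single e (1 : ℝ) : EuclideanSpace ℝ (Fin n)) := by
    refine (euclidean_eq_sum _).trans ?_
    rfl
  have h2 : ∀ v : EuclideanSpace ℝ (Fin n), v = ∑ e, v e •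
      (EuclideanSpace.single e (1 : ℝ) : EuclideanSpace ℝ (Fin n)) → mvfderiv (𝓡 n) f q v =
      ∑ e, v e • mvfderiv (𝓡 n) f q
        (EuclideanSpace.single e (1 : ℝ) : EuclideanSpace ℝ (Fin n)) := by
    intro v hv
    conv_lhs => rw [hv]
    refine (map_sum (mvfderiv (𝓡 n) f q).toLinearMap _ _).trans ?_
    exact Finset.sum_congr rfl fun e _ => (mvfderiv (𝓡 n) f q).map_smul _ _
  refine (h2 _ h).trans ?_
  refine Finset.sum_congr rfl fun e _ => ?_
  rw [← pd_eq_dc hf]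
  rfl

/-- The matrix `(Γ_a)^c_b` of the Christoffel symbols at `q` in the preferred chart of `p`. -/
def chr (D : AffineConnection n M) (p q : M) (a : Fin n) : Matrix (Fin n) (Fin n) ℝ :=
  fun c b => christoffel D p q c a b

theorem coordField_eq_sum (hp : q ∈ dom n p) (hp' : q ∈ dom n p') (b : Fin n) :
    coordField p b q = ∑ d, (jac p p' q d b : ℝ) • coordField p' d q := by
  have h : tangentCoordChange (𝓡 n) p p' q (EuclideanSpace.single b 1) =
      ∑ d, (jac p p' q d b : ℝ) • (EuclideanSpace.single d (1 : ℝ) : EuclideanSpace ℝ (Fin n)) :=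
    euclidean_eq_sum _
  have h2 : coordField p b q = tangentCoordChange (𝓡 n) p' q q
      (tangentCoordChange (𝓡 n) p p' q (EuclideanSpace.single b 1)) :=
    (tangentCoordChange_comp (I := 𝓡 n) (w := p) (x := p') (y := q) (z := q)
      ⟨⟨by simpa using hp, by simpa using hp'⟩, by simp⟩).symm
  rw [h2, h, map_sum]
  refine Finset.sum_congr rfl fun d _ => ?_
  rw [map_smul]
  rfl

/-- Additivity and the Leibniz rule are available only for differentiable fields, so the induction
proves the smoothness of the partial sums along with the formula. -/
theorem connection_sum (D : AffineConnection n M) {ι : Type*} (s : Finset ι) (g : ι → M → ℝ)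
    (Y : ι → (z : M) → TangentSpace (𝓡 n) z) (hg : ∀ i, SmoothAt n (g i) q)
    (hY : ∀ i, FieldSmoothAt (Y i) q) (X : TangentSpace (𝓡 n) q) :
    FieldSmoothAt (∑ i ∈ s, g i • Y i) q ∧
    D (∑ i ∈ s, g i • Y i) q X =
      ∑ i ∈ s, (g i q • D (Y i) q X + mvfderiv (𝓡 n) (g i) q X • Y i q) := by
  classical
  induction s using Finset.induction_on with
  | empty =>
    simp only [Finset.sum_empty]
    refine ⟨(Bundle.contMDiff_zeroSection ℝ (TangentSpace (𝓡 n) : M → Type _)).contMDiffAt, ?_⟩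
    rw [D.zero]; rfl
  | insert i s hi ih =>
    rw [Finset.sum_insert hi, Finset.sum_insert hi]
    have h1 : FieldSmoothAt (g i • Y i) q := ContMDiffAt.smul_section (hg i) (hY i)
    refine ⟨ContMDiffAt.add_section h1 ih.1, ?_⟩
    rw [D.isCovariantDerivativeOnUniv.add h1.mdifferentiableAt ih.1.mdifferentiableAt,
      add_apply, ih.2,
      D.isCovariantDerivativeOnUniv.leibniz (hY i).mdifferentiableAt
        (ContMDiffAt.mdifferentiableAt (hg i) (by simp))]
    rfl

/-- Transformation of the Christoffel symbols under a change of coordinates. -/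
theorem chr_transform (D : AffineConnection n M) (hp : q ∈ dom n p) (hp' : q ∈ dom n p')
    (a : Fin n) :
    chr D p q a = jac p' p q * (∑ e, jac p p' q e a • chr D p' q e) * jac p p' q +
      jac p' p q * (Matrix.of fun c b => dc p (fun z => jac p p' z c b) q a) := by
  have hJ : ∀ c d, SmoothAt n (fun z => jac p p' z c d) q := smoothAt_jac hp hp'
  ext c b
  have hs := connection_sum D Finset.univ (fun d z => jac p p' z d b) (fun d => coordField p' d)
    (fun d => hJ d b) (fun d => fieldSmoothAt_coordField hp' d) (coordField p a q)
  -- The expansion in the other coordinate frame holds only on the overlap of the two charts;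
  -- locality of the connection transfers it to the derivative.
  have h1 : D (coordField p b) q = D (∑ d, (fun z => jac p p' z d b) • coordField p' d) q := by
    refine D.isCovariantDerivativeOnUniv.congr_of_eventuallyEq
      (fieldSmoothAt_coordField hp b).mdifferentiableAt hs.1.mdifferentiableAt Filter.univ_mem ?_
    filter_upwards [dom_mem_nhds hp, dom_mem_nhds hp'] with z hz hz'
    rw [coordField_eq_sum hz hz', Finset.sum_apply]
    rfl
  have h2 : D (coordField p b) q (coordField p a q) = ∑ d, ((jac p p' q d b : ℝ) •
      ∑ e, (jac p p' q e a : ℝ) • D (coordField p' d) q (coordField p' e q)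
      + dc p (fun z => jac p p' z d b) q a • coordField p' d q) := by
    rw [h1, hs.2]
    refine Finset.sum_congr rfl fun d _ => ?_
    rw [mvfderiv_coordField hp (hJ d b)]
    congr 2
    rw [coordField_eq_sum hp hp' a, map_sum]
    exact Finset.sum_congr rfl fun e _ => (D (coordField p' d) q).map_smul _ _
  have h3 : ∀ v : EuclideanSpace ℝ (Fin n), tangentCoordChange (𝓡 n) q p q v c =
      ∑ f, jac p' p q c f * tangentCoordChange (𝓡 n) q p' q v f := by
    intro v
    rw [← tangentCoordChange_comp (I := 𝓡 n) (w := q) (x := p') (y := p) (z := q)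
      ⟨⟨by simp, by simpa using hp'⟩, by simpa using hp⟩]
    conv_lhs => rw [euclidean_eq_sum (tangentCoordChange (𝓡 n) q p' q v)]
    rw [map_sum]
    simp only [map_smul, WithLp.ofLp_sum, WithLp.ofLp_smul, Finset.sum_apply, Pi.smul_apply,
      smul_eq_mul]
    exact Finset.sum_congr rfl fun f _ => mul_comm _ _
  have h4 : ∀ f, tangentCoordChange (𝓡 n) q p' q (D (coordField p b) q (coordField p a q)) f =
      ∑ d, (jac p p' q d b * ∑ e, jac p p' q e a * christoffel D p' q f e d) +
        dc p (fun z => jac p p' z f b) q a := by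
    intro f
    let L : TangentSpace (𝓡 n) q →ₗ[ℝ] ℝ :=
      (EuclideanSpace.proj f : EuclideanSpace ℝ (Fin n) →L[ℝ] ℝ).toLinearMap ∘ₗ
        (tangentCoordChange (𝓡 n) q p' q).toLinearMap
    have hL : ∀ v : TangentSpace (𝓡 n) q, tangentCoordChange (𝓡 n) q p' q v f = L v := fun _ => rfl
    rw [hL, h2]
    simp only [map_sum, map_add, map_smul, Finset.sum_add_distrib, smul_eq_mul]
    congr 1
    have h5 : ∀ d, L (coordField p' d q) = if f = d then 1 else 0 := by
      intro d
      rw [← hL, coordField_comp hp' hp', jac_self hp', Matrix.one_apply]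
    simp [h5]
  refine (h3 (D (coordField p b) q (coordField p a q))).trans ?_
  refine (Finset.sum_congr rfl fun f _ => congrArg (jac p' p q c f * ·) (h4 f)).trans ?_
  simp only [Matrix.add_apply, Matrix.mul_assoc]
  simp only [Matrix.mul_apply, mul_add, Finset.sum_add_distrib, Matrix.of_apply, Matrix.sum_apply,
    Matrix.smul_apply, smul_eq_mul, chr]
  congr 1
  refine Finset.sum_congr rfl fun f _ => ?_
  congr 1
  refine Finset.sum_congr rfl fun d _ => ?_
  ring

end christoffelSymbols

/-! ### Matrix-valued functions and their curvature -/

section matrixCalculus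

variable {n : ℕ} {M : Type*} [TopologicalSpace M] [ChartedSpace (EuclideanSpace ℝ (Fin n)) M]
  {ι : Type*} {p p' q : M}

variable (n) in
/-- Smoothness of a matrix-valued function at a point. -/
def MatSmoothAt (A : M → Matrix ι ι ℝ) (q : M) : Prop := ∀ i j, SmoothAt n (fun z => A z i j) q

/-- The entrywise partial derivative in the preferred chart of `p`. -/
def mdc (p : M) (A : M → Matrix ι ι ℝ) (q : M) (a : Fin n) : Matrix ι ι ℝ :=
  Matrix.of fun i j => dc p (fun z => A z i j) q a

/-- The curvature `∂_a γ_b - ∂_b γ_a + [γ_a, γ_b]` of a matrix-valued one-form, in the preferred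
chart of `p`. -/
def curv [Fintype ι] (p : M) (γ : M → Fin n → Matrix ι ι ℝ) (q : M) (a b : Fin n) :
    Matrix ι ι ℝ :=
  mdc p (fun z => γ z b) q a - mdc p (fun z => γ z a) q b + (γ q a * γ q b - γ q b * γ q a)

theorem curv_swap [Fintype ι] (p : M) (γ : M → Fin n → Matrix ι ι ℝ) (q : M) (a b : Fin n) :
    curv p γ q b a = - curv p γ q a b := by
  simp only [curv]; abel

theorem mdc_congr (hq : q ∈ dom n p) {A B : M → Matrix ι ι ℝ} (h : A =ᶠ[nhds q] B) (a : Fin n) :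
    mdc p A q a = mdc p B q a := by
  ext i j
  exact dc_congr hq (h.mono fun z hz => by simp only [hz]) a

theorem curv_congr [Fintype ι] (hq : q ∈ dom n p) {γ γ' : M → Fin n → Matrix ι ι ℝ}
    (h : γ =ᶠ[nhds q] γ') (a b : Fin n) : curv p γ q a b = curv p γ' q a b := by
  have h1 : ∀ a, (fun z => γ z a) =ᶠ[nhds q] fun z => γ' z a := fun a => h.mono fun z hz => by
    simp only [hz]
  rw [curv, curv, mdc_congr hq (h1 a), mdc_congr hq (h1 b), h.self_of_nhds]

variable [IsManifold (𝓡 n) ∞ M]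

theorem MatSmoothAt.congr {A B : M → Matrix ι ι ℝ} (hA : MatSmoothAt n A q) (h : B =ᶠ[nhds q] A) :
    MatSmoothAt n B q := fun i j =>
  (hA i j).congr_of_eventuallyEq (h.mono fun z hz => by simp only [hz])

theorem MatSmoothAt.add {A B : M → Matrix ι ι ℝ} (hA : MatSmoothAt n A q)
    (hB : MatSmoothAt n B q) : MatSmoothAt n (fun z => A z + B z) q :=
  fun i j => (hA i j).add (hB i j)

theorem MatSmoothAt.sub {A B : M → Matrix ι ι ℝ} (hA : MatSmoothAt n A q)
    (hB : MatSmoothAt n B q) : MatSmoothAt n (fun z => A z - B z) q :=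
  fun i j => (hA i j).sub (hB i j)

theorem MatSmoothAt.mul [Fintype ι] {A B : M → Matrix ι ι ℝ} (hA : MatSmoothAt n A q)
    (hB : MatSmoothAt n B q) : MatSmoothAt n (fun z => A z * B z) q := by
  intro i j
  simp only [Matrix.mul_apply]
  exact smoothAt_sum fun k _ => (hA i k).mul (hB k j)

theorem MatSmoothAt.transpose {A : M → Matrix ι ι ℝ} (hA : MatSmoothAt n A q) :
    MatSmoothAt n (fun z => (A z).transpose) q := fun i j => hA j i

theorem MatSmoothAt.smul {A : M → Matrix ι ι ℝ} {f : M → ℝ} (hf : SmoothAt n f q)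
    (hA : MatSmoothAt n A q) : MatSmoothAt n (fun z => f z • A z) q :=
  fun i j => hf.mul (hA i j)

theorem MatSmoothAt.sum {κ : Type*} {s : Finset κ} {A : κ → M → Matrix ι ι ℝ}
    (hA : ∀ k ∈ s, MatSmoothAt n (A k) q) : MatSmoothAt n (fun z => ∑ k ∈ s, A k z) q := by
  intro i j
  simp only [Matrix.sum_apply]
  exact smoothAt_sum fun k hk => hA k hk i j

theorem MatSmoothAt.const (A : Matrix ι ι ℝ) : MatSmoothAt n (fun _ : M => A) q :=
  fun _ _ => contMDiffAt_const

theorem MatSmoothAt.mdc {A : M → Matrix ι ι ℝ} (hq : q ∈ dom n p) (hA : MatSmoothAt n A q)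
    (a : Fin n) : MatSmoothAt n (fun z => mdc p A z a) q :=
  fun i j => smoothAt_dc hq (hA i j) a

theorem mdc_const (p q : M) (A : Matrix ι ι ℝ) (a : Fin n) : mdc p (fun _ => A) q a = 0 := by
  ext i j; exact dc_const p q _ a

theorem mdc_add (hq : q ∈ dom n p) {A B : M → Matrix ι ι ℝ} (hA : MatSmoothAt n A q)
    (hB : MatSmoothAt n B q) (a : Fin n) :
    mdc p (fun z => A z + B z) q a = mdc p A q a + mdc p B q a := by
  ext i j; exact dc_add hq (hA i j) (hB i j) a

theorem mdc_sub (hq : q ∈ dom n p) {A B : M → Matrix ι ι ℝ} (hA : MatSmoothAt n A q)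
    (hB : MatSmoothAt n B q) (a : Fin n) :
    mdc p (fun z => A z - B z) q a = mdc p A q a - mdc p B q a := by
  ext i j; exact dc_sub hq (hA i j) (hB i j) a

theorem mdc_mul [Fintype ι] (hq : q ∈ dom n p) {A B : M → Matrix ι ι ℝ} (hA : MatSmoothAt n A q)
    (hB : MatSmoothAt n B q) (a : Fin n) :
    mdc p (fun z => A z * B z) q a = mdc p A q a * B q + A q * mdc p B q a := by
  ext i j
  simp only [mdc, Matrix.of_apply, Matrix.mul_apply, Matrix.add_apply]
  rw [dc_sum hq fun k _ => (hA i k).fun_mul (hB k j), ← Finset.sum_add_distrib]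
  exact Finset.sum_congr rfl fun k _ => dc_mul hq (hA i k) (hB k j) a

theorem mdc_transpose (p q : M) (A : M → Matrix ι ι ℝ) (a : Fin n) :
    mdc p (fun z => (A z).transpose) q a = (mdc p A q a).transpose := rfl

theorem mdc_smul (hq : q ∈ dom n p) {A : M → Matrix ι ι ℝ} {f : M → ℝ} (hf : SmoothAt n f q)
    (hA : MatSmoothAt n A q) (a : Fin n) :
    mdc p (fun z => f z • A z) q a = dc p f q a • A q + f q • mdc p A q a := by
  ext i j; exact dc_mul hq hf (hA i j) a

theorem mdc_sum (hq : q ∈ dom n p) {κ : Type*} {s : Finset κ} {A : κ → M → Matrix ι ι ℝ}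
    (hA : ∀ k ∈ s, MatSmoothAt n (A k) q) (a : Fin n) :
    mdc p (fun z => ∑ k ∈ s, A k z) q a = ∑ k ∈ s, mdc p (A k) q a := by
  ext i j
  simp only [mdc, Matrix.of_apply, Matrix.sum_apply]
  exact dc_sum hq (fun k hk => hA k hk i j) a

theorem mdc_comm (hq : q ∈ dom n p) {A : M → Matrix ι ι ℝ} (hA : MatSmoothAt n A q) (a b : Fin n) :
    mdc p (fun z => mdc p A z b) q a = mdc p (fun z => mdc p A z a) q b := by
  ext i j; exact dc_comm hq (hA i j) a b

theorem mdc_chain (hp : q ∈ dom n p) (hp' : q ∈ dom n p') {A : M → Matrix ι ι ℝ}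
    (hA : MatSmoothAt n A q) (a : Fin n) :
    mdc p A q a = ∑ e, jac p p' q e a • mdc p' A q e := by
  ext i j
  simp only [Matrix.sum_apply, Matrix.smul_apply, smul_eq_mul]
  exact dc_chain hp hp' (hA i j) a

/-- Differentiate `h g = 1`. -/
theorem mdc_inverse [Fintype ι] [DecidableEq ι] (hq : q ∈ dom n p) {g h : M → Matrix ι ι ℝ}
    (hg : MatSmoothAt n g q) (hh : MatSmoothAt n h q) (hhg : ∀ᶠ z in nhds q, h z * g z = 1)
    (a : Fin n) : mdc p h q a = - (h q * mdc p g q a * h q) := by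
  have h1 := mdc_mul hq hh hg a
  rw [mdc_congr hq (B := fun _ => 1) hhg, mdc_const] at h1
  have h2 : g q * h q = 1 := mul_eq_one_comm.1 hhg.self_of_nhds
  have h3 : mdc p h q a * g q = - (h q * mdc p g q a) := eq_neg_of_add_eq_zero_left h1.symm
  calc mdc p h q a = mdc p h q a * (g q * h q) := by rw [h2, mul_one]
    _ = _ := by rw [← mul_assoc, h3, neg_mul]

theorem MatSmoothAt.curv [Fintype ι] (hq : q ∈ dom n p) {γ : M → Fin n → Matrix ι ι ℝ}
    (hγ : ∀ a, MatSmoothAt n (fun z => γ z a) q) (a b : Fin n) :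
    MatSmoothAt n (fun z => curv p γ z a b) q :=
  (((hγ b).mdc hq a).sub ((hγ a).mdc hq b)).add (((hγ a).mul (hγ b)).sub ((hγ b).mul (hγ a)))

/-- Behaviour of the curvature under a gauge transformation. -/
theorem curv_gauge [Fintype ι] [DecidableEq ι] (hq : q ∈ dom n p)
    {γ γ' : M → Fin n → Matrix ι ι ℝ} {g h : M → Matrix ι ι ℝ}
    (hγ : ∀ a, MatSmoothAt n (fun z => γ z a) q)
    (hg : MatSmoothAt n g q) (hh : MatSmoothAt n h q) (hhg : ∀ᶠ z in nhds q, h z * g z = 1)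
    (hγ' : ∀ᶠ z in nhds q, γ' z = fun a => h z * γ z a * g z + h z * mdc p g z a) (a b : Fin n) :
    curv p γ' q a b = h q * curv p γ q a b * g q := by
  rw [curv_congr hq hγ']
  have h2 : g q * h q = 1 := mul_eq_one_comm.1 hhg.self_of_nhds
  have key : ∀ a b : Fin n, mdc p (fun z => h z * γ z b * g z + h z * mdc p g z b) q a =
      mdc p h q a * γ q b * g q + h q * mdc p (fun z => γ z b) q a * g q +
        h q * γ q b * mdc p g q a + mdc p h q a * mdc p g q b +
        h q * mdc p (fun z => mdc p g z b) q a := by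
    intro a b
    rw [mdc_add hq ((hh.mul (hγ b)).mul hg) (hh.mul (hg.mdc hq b)), mdc_mul hq (hh.mul (hγ b)) hg,
      mdc_mul hq hh (hγ b), mdc_mul hq hh (hg.mdc hq b)]
    noncomm_ring
  have hprod : ∀ a b : Fin n,
      (h q * γ q a * g q + h q * mdc p g q a) * (h q * γ q b * g q + h q * mdc p g q b) =
      h q * γ q a * γ q b * g q + h q * γ q a * mdc p g q b + h q * mdc p g q a * h q * γ q b * g q
        + h q * mdc p g q a * h q * mdc p g q b := by
    intro a b
    have : ∀ x y : Matrix ι ι ℝ, x * g q * (h q * y) = x * y := fun x y => by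
      rw [mul_assoc, ← mul_assoc (g q), h2, one_mul]
    rw [add_mul, mul_add, mul_add, mul_assoc (h q) (γ q b) (g q), this, this]
    noncomm_ring
  simp only [curv]
  rw [key, key, hprod, hprod, mdc_inverse hq hg hh hhg a, mdc_inverse hq hg hh hhg b,
    mdc_comm hq hg a b]
  noncomm_ring

/-- Change of coordinates for the components of a matrix-valued one-form. -/
def pullConn (p p' : M) (γ : M → Fin n → Matrix ι ι ℝ) (z : M) (a : Fin n) : Matrix ι ι ℝ :=
  ∑ e, jac p p' z e a • γ z e

theorem MatSmoothAt.pullConn (hp : q ∈ dom n p) (hp' : q ∈ dom n p')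
    {γ : M → Fin n → Matrix ι ι ℝ} (hγ : ∀ a, MatSmoothAt n (fun z => γ z a) q) (a : Fin n) :
    MatSmoothAt n (fun z => pullConn p p' γ z a) q :=
  MatSmoothAt.sum fun e _ => MatSmoothAt.smul (smoothAt_jac hp hp' e a) (hγ e)

/-- The curvature is a tensorial two-form: the derivatives of the Jacobian contribute a term
symmetric in the two form indices (`dc_jac_comm`), which drops out after skewing. -/
theorem curv_pullConn [Fintype ι] (hp : q ∈ dom n p) (hp' : q ∈ dom n p')
    {γ : M → Fin n → Matrix ι ι ℝ} (hγ : ∀ a, MatSmoothAt n (fun z => γ z a) q) (a b : Fin n) :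
    curv p (pullConn p p' γ) q a b =
      ∑ e, ∑ f, (jac p p' q e a * jac p p' q f b) • curv p' γ q e f := by
  have hJ := smoothAt_jac (n := n) hp hp'
  have key : ∀ a b : Fin n, mdc p (fun z => pullConn p p' γ z b) q a =
      ∑ f : Fin n, dc p (fun z => jac p p' z f b) q a • γ q f +
      ∑ e : Fin n, ∑ f : Fin n, (jac p p' q e a * jac p p' q f b) • mdc p' (fun z => γ z f) q e := by
    intro a b
    simp only [pullConn]
    rw [mdc_sum hp fun e _ => MatSmoothAt.smul (hJ e b) (hγ e), Finset.sum_comm,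
      ← Finset.sum_add_distrib]
    refine Finset.sum_congr rfl fun f _ => ?_
    rw [mdc_smul hp (hJ f b) (hγ f), mdc_chain hp hp' (hγ f), Finset.smul_sum]
    congr 1
    refine Finset.sum_congr rfl fun e _ => ?_
    rw [smul_smul, mul_comm]
  have hprod : ∀ a b, pullConn p p' γ q a * pullConn p p' γ q b =
      ∑ e, ∑ f, (jac p p' q e a * jac p p' q f b) • (γ q e * γ q f) := by
    intro a b
    simp only [pullConn, Finset.sum_mul, Finset.mul_sum]
    rw [Finset.sum_comm]
    refine Finset.sum_congr rfl fun e _ => Finset.sum_congr rfl fun f _ => ?_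
    rw [smul_mul_smul_comm]
  have hswap : ∀ X : Fin n → Fin n → Matrix ι ι ℝ,
      ∑ e, ∑ f, (jac p p' q e b * jac p p' q f a) • X e f =
      ∑ e, ∑ f, (jac p p' q e a * jac p p' q f b) • X f e := by
    intro X
    rw [Finset.sum_comm]
    refine Finset.sum_congr rfl fun e _ => Finset.sum_congr rfl fun f _ => ?_
    rw [mul_comm]
  rw [curv, key, key, hprod, hprod, hswap, hswap]
  simp only [dc_jac_comm hp hp' _ b a]
  simp only [curv, smul_add, smul_sub, Finset.sum_add_distrib, Finset.sum_sub_distrib]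
  abel

theorem matSmoothAt_jac (hp : q ∈ dom n p) (hp' : q ∈ dom n p') :
    MatSmoothAt n (fun z => (jac p p' z : Matrix (Fin n) (Fin n) ℝ)) q := fun c d => smoothAt_jac hp hp' c d

/-- Composition of a smooth function with a function of one real variable. -/
theorem dc_comp (hq : q ∈ dom n p) {f : M → ℝ} (hf : SmoothAt n f q) {φ : ℝ → ℝ} {φ' : ℝ}
    (hφ : HasDerivAt φ φ' (f q)) (a : Fin n) : dc p (fun z => φ (f z)) q a = φ' * dc p f q a := by
  have h1 := (hf.differentiableAt hq).hasFDerivAt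
  have hx : (f ∘ (chartAt (EuclideanSpace ℝ (Fin n)) p).symm)
      (chartAt (EuclideanSpace ℝ (Fin n)) p q) = f q := by
    simp [(chartAt (EuclideanSpace ℝ (Fin n)) p).left_inv hq]
  rw [← hx] at hφ
  have h2 := hφ.comp_hasFDerivAt _ h1
  have h3 : (fun z => φ (f z)) ∘ (chartAt (EuclideanSpace ℝ (Fin n)) p).symm =
    φ ∘ (f ∘ (chartAt (EuclideanSpace ℝ (Fin n)) p).symm) := rfl
  rw [dc, h3, h2.fderiv]
  rfl

/-- `Real.log` is the logarithm of the absolute value, so the density factor is an exponential; this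
makes it smooth away from zero on both half-lines at once. -/
theorem abs_rpow_eq_exp {x : ℝ} (hx : x ≠ 0) (r : ℝ) : |x| ^ r = Real.exp (r * Real.log x) := by
  rw [Real.rpow_def_of_pos (abs_pos.2 hx), Real.log_abs, mul_comm]

theorem hasDerivAt_abs_rpow {x : ℝ} (hx : x ≠ 0) (r : ℝ) :
    HasDerivAt (fun y : ℝ => |y| ^ r) (|x| ^ r * (r * x⁻¹)) x := by
  have h : HasDerivAt (fun y : ℝ => Real.exp (r * Real.log y)) (|x| ^ r * (r * x⁻¹)) x := by
    rw [abs_rpow_eq_exp hx]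
    exact ((Real.hasDerivAt_log hx).const_mul r).exp
  refine h.congr_of_eventuallyEq ?_
  filter_upwards [isOpen_ne.mem_nhds hx] with y hy
  exact abs_rpow_eq_exp hy r

theorem smoothAt_abs_rpow {f : M → ℝ} (hf : SmoothAt n f q) (h0 : f q ≠ 0) (r : ℝ) :
    SmoothAt n (fun z => |f z| ^ r) q := by
  have h : ContDiffAt ℝ ∞ (fun y : ℝ => |y| ^ r) (f q) := by
    have : ContDiffAt ℝ ∞ (fun y : ℝ => Real.exp (r * Real.log y)) (f q) :=
      (contDiffAt_const.mul (Real.contDiffAt_log.2 h0)).exp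
    refine this.congr_of_eventuallyEq ?_
    filter_upwards [isOpen_ne.mem_nhds h0] with y hy
    exact abs_rpow_eq_exp hy r
  exact h.contMDiffAt.comp q hf

theorem smoothAt_det [Fintype ι] [DecidableEq ι] {A : M → Matrix ι ι ℝ} (hA : MatSmoothAt n A q) :
    SmoothAt n (fun z => (A z).det) q := by
  simp only [Matrix.det_apply']
  exact smoothAt_sum fun σ _ => contMDiffAt_const.mul (smoothAt_prod fun i _ => hA _ _)

theorem dc_det_of_eq_one [Fintype ι] [DecidableEq ι] (hq : q ∈ dom n p) {A : M → Matrix ι ι ℝ}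
    (hA : MatSmoothAt n A q) (h1 : A q = 1) (a : Fin n) :
    dc p (fun z => (A z).det) q a = (mdc p A q a).trace := by
  simp only [Matrix.det_apply']
  rw [dc_sum hq fun σ _ => (smoothAt_const _).fun_mul (smoothAt_prod fun i _ => hA _ _)]
  rw [Finset.sum_eq_single 1]
  · rw [dc_const_mul hq (smoothAt_prod fun i _ => hA _ _), dc_prod hq fun i _ => hA _ _]
    simp [h1, Matrix.trace, mdc]
  · intro σ _ hσ
    rw [dc_const_mul hq (smoothAt_prod fun i _ => hA _ _), dc_prod hq fun i _ => hA _ _]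
    rw [Finset.sum_eq_zero, mul_zero]
    intro i _
    -- A non-trivial permutation moves at least two points. So after the factor with index `i` is
    -- differentiated, some off-diagonal entry of the identity still remains.
    obtain ⟨j, hj, hji⟩ : ∃ j, σ j ≠ j ∧ j ≠ i := by
      by_contra! hc
      refine hσ (Equiv.ext fun j => ?_)
      by_contra hne
      have e1 := hc j hne
      have e2 := hc (σ j) fun h => hne (σ.injective h)
      exact hne (e2.trans e1.symm)
    rw [Finset.prod_eq_zero (i := j) (by simp [hji]), zero_mul]
    rw [h1, Matrix.one_apply_ne hj]
  · simp

/-- Jacobi's formula, reduced to the identity matrix by multiplying with the constant inverse `B` of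
`A q`. -/
theorem dc_det [Fintype ι] [DecidableEq ι] (hq : q ∈ dom n p) {A : M → Matrix ι ι ℝ}
    (hA : MatSmoothAt n A q) {B : Matrix ι ι ℝ} (hB : B * A q = 1) (a : Fin n) :
    dc p (fun z => (A z).det) q a = (A q).det * (B * mdc p A q a).trace := by
  have h1 : (fun z => (A z).det) = fun z => (A q).det * (B * A z).det := by
    funext z
    rw [Matrix.det_mul, ← mul_assoc, ← Matrix.det_mul, mul_eq_one_comm.1 hB, Matrix.det_one, one_mul]
  have hs := (MatSmoothAt.const (n := n) (q := q) B).mul hA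
  rw [h1, dc_const_mul hq (smoothAt_det hs), dc_det_of_eq_one hq hs hB,
    mdc_mul hq (MatSmoothAt.const B) hA, mdc_const, zero_mul, zero_add]

end matrixCalculus

/-! ### Curvature in a chart -/

section localCurvature

variable {n : ℕ} {M : Type*} [TopologicalSpace M] [ChartedSpace (EuclideanSpace ℝ (Fin n)) M]
  [IsManifold (𝓡 n) ∞ M] {p p' q : M}

/-- Smooth torsion-free connections. -/
structure IsSmoothTorsionFree (D : AffineConnection n M) : Prop where
  smooth : D.ContMDiffCovariantDerivative ∞
  torsion : D.torsion = 0

/-- The components at `q` of the Riemann curvature, in the preferred chart of `p`. -/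
def lriem (D : AffineConnection n M) (p q : M) (a b : Fin n) : Matrix (Fin n) (Fin n) ℝ :=
  curv p (chr D p) q a b

/-- The components at `q` of the Ricci tensor, in the preferred chart of `p`. -/
def lric (D : AffineConnection n M) (p q : M) (b d : Fin n) : ℝ := ∑ a, lriem D p q a b a d

/-- The components at `q` of the Schouten tensor, in the preferred chart of `p`. -/
def lschouten (D : AffineConnection n M) (p q : M) (b d : Fin n) : ℝ :=
  (n * lric D p q b d + lric D p q d b) / ((n : ℝ) ^ 2 - 1)

variable {D : AffineConnection n M}

theorem chr_symm (hD : IsSmoothTorsionFree D) (hq : q ∈ dom n p) (c a b : Fin n) :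
    chr D p q a c b = chr D p q b c a := christoffel_symm D hD.torsion hq c a b

/-! ### Smoothness and tensoriality of the curvature and Schouten tensors. -/

section smoothness

variable [T2Space M]

theorem matSmoothAt_chr (hD : IsSmoothTorsionFree D) (hq : q ∈ dom n p) (a : Fin n) :
    MatSmoothAt n (fun z => chr D p z a) q :=
  fun c b => smoothAt_christoffel D hD.smooth hq c a b

theorem riem_eq (hD : IsSmoothTorsionFree D) (p : M) (a b c d : Fin n) :
    riem D p a b c d = lriem D p p a b c d := by
  have h := fun c a b => smoothAt_christoffel D hD.smooth (self_mem_dom p) c a b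
  simp only [riem, lriem, curv, Matrix.add_apply, Matrix.sub_apply, Matrix.mul_apply,
    Finset.sum_sub_distrib]
  rw [pd_eq_dc (h c b d), pd_eq_dc (h c a d)]
  rfl

theorem ricci_eq (hD : IsSmoothTorsionFree D) (p : M) (b d : Fin n) :
    ricci D p b d = lric D p p b d := by
  simp only [ricci, lric, riem_eq hD]

theorem schouten_eq (hD : IsSmoothTorsionFree D) (p : M) (b d : Fin n) :
    schouten D p b d = lschouten D p p b d := by
  simp only [schouten, lschouten, ricci_eq hD]

theorem matSmoothAt_lriem (hD : IsSmoothTorsionFree D) (hq : q ∈ dom n p) (a b : Fin n) :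
    MatSmoothAt n (fun z => lriem D p z a b) q :=
  MatSmoothAt.curv hq (matSmoothAt_chr hD hq) a b

theorem smoothAt_lschouten (hD : IsSmoothTorsionFree D) (hq : q ∈ dom n p) (b d : Fin n) :
    SmoothAt n (fun z => lschouten D p z b d) q := by
  have h : ∀ b d, SmoothAt n (fun z => lric D p z b d) q := fun b d =>
    smoothAt_sum fun a _ => matSmoothAt_lriem hD hq a b a d
  simp only [lschouten, div_eq_mul_inv]
  exact (((smoothAt_const _).fun_mul (h b d)).fun_add (h d b)).fun_mul (smoothAt_const _)

/-- The transformation law of the Christoffel symbols is a gauge transformation by the Jacobian of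
the pulled-back connection form, so this combines `curv_gauge` with `curv_pullConn`. -/
theorem lriem_transform (hD : IsSmoothTorsionFree D) (hp : q ∈ dom n p) (hp' : q ∈ dom n p')
    (a b : Fin n) :
    lriem D p q a b = jac p' p q *
      (∑ e, ∑ f, (jac p p' q e a * jac p p' q f b) • lriem D p' q e f) * jac p p' q := by
  rw [lriem, curv_gauge hp (γ := pullConn p p' (chr D p')) (g := fun z => jac p p' z)
    (h := fun z => jac p' p z) (MatSmoothAt.pullConn hp hp' (matSmoothAt_chr hD hp'))
    (matSmoothAt_jac hp hp') (matSmoothAt_jac hp' hp)]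
  · rw [curv_pullConn hp hp' (matSmoothAt_chr hD hp')]
    rfl
  · filter_upwards [dom_mem_nhds hp, dom_mem_nhds hp'] with z hz hz'
    exact jac_mul_jac hz hz'
  · filter_upwards [dom_mem_nhds hp, dom_mem_nhds hp'] with z hz hz'
    funext a
    exact chr_transform D hz hz' a

theorem lric_transform (hD : IsSmoothTorsionFree D) (hp : q ∈ dom n p) (hp' : q ∈ dom n p')
    (b d : Fin n) :
    lric D p q b d = ∑ e, ∑ f, jac p p' q e b * jac p p' q f d * lric D p' q e f := by
  have hJ : ∀ e c : Fin n, ∑ a, jac p p' q e a * jac p' p q a c = if e = c then 1 else 0 := by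
    intro e c
    have := congrFun (congrFun (jac_mul_jac (n := n) hp' hp) e) c
    rwa [Matrix.mul_apply, Matrix.one_apply] at this
  have h1 : ∀ a, lriem D p q a b a d = ∑ x, ∑ e, ∑ f, ∑ y,
      (jac p p' q e a * jac p' p q a y) * (jac p p' q f b * jac p p' q x d *
        lriem D p' q e f y x) := by
    intro a
    rw [lriem_transform hD hp hp']
    simp only [Matrix.mul_apply, Matrix.sum_apply, Matrix.smul_apply, smul_eq_mul, Finset.mul_sum,
      Finset.sum_mul]
    refine Finset.sum_congr rfl fun x _ => Finset.sum_congr rfl fun e _ =>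
      Finset.sum_congr rfl fun f _ => Finset.sum_congr rfl fun y _ => ?_
    ring
  have h2 : ∑ a, lriem D p q a b a d = ∑ x, ∑ e, ∑ f, ∑ y, ∑ a,
      (jac p p' q e a * jac p' p q a y) * (jac p p' q f b * jac p p' q x d *
        lriem D p' q e f y x) := by
    simp only [h1]
    rw [Finset.sum_comm]
    refine Finset.sum_congr rfl fun x _ => ?_
    rw [Finset.sum_comm]
    refine Finset.sum_congr rfl fun y _ => ?_
    rw [Finset.sum_comm]
    refine Finset.sum_congr rfl fun e _ => ?_
    rw [Finset.sum_comm]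
  simp only [lric]
  rw [h2]
  simp only [← Finset.sum_mul, hJ, ite_mul, one_mul, zero_mul, Finset.mul_sum]
  rw [Finset.sum_comm (γ := Fin n)
    (f := fun e f => ∑ a, jac p p' q e b * jac p p' q f d * lriem D p' q a e a f)]
  refine Finset.sum_congr rfl fun x _ => ?_
  rw [Finset.sum_comm (γ := Fin n)
    (f := fun e a => jac p p' q e b * jac p p' q x d * lriem D p' q a e a x)]
  refine Finset.sum_congr rfl fun e _ => Finset.sum_congr rfl fun f _ => ?_
  simp

theorem lschouten_transform (hD : IsSmoothTorsionFree D) (hp : q ∈ dom n p) (hp' : q ∈ dom n p')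
    (b d : Fin n) :
    lschouten D p q b d =
      ∑ e, ∑ f, jac p p' q e b * jac p p' q f d * lschouten D p' q e f := by
  simp only [lschouten]
  rw [lric_transform hD hp hp' b d, lric_transform hD hp hp' d b,
    Finset.sum_comm (f := fun e f => jac p p' q e d * jac p p' q f b * lric D p' q e f)]
  simp only [Finset.mul_sum, ← Finset.sum_add_distrib, Finset.sum_div]
  refine Finset.sum_congr rfl fun e _ => Finset.sum_congr rfl fun f _ => ?_
  ring

end smoothness

/-- The first Bianchi identity. -/
theorem lriem_bianchi (hD : IsSmoothTorsionFree D) (hq : q ∈ dom n p) (a b c d : Fin n) :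
    lriem D p q a b c d + lriem D p q b d c a + lriem D p q d a c b = 0 := by
  have h1 : ∀ a b c d : Fin n, dc p (fun z => chr D p z b c d) q a = dc p (fun z => chr D p z d c b) q a := by
    intro a b c d
    refine dc_congr hq ?_ a
    filter_upwards [dom_mem_nhds hq] with z hz
    exact chr_symm hD hz c b d
  have h2 : ∀ a b d c : Fin n, ∑ e, chr D p q a c e * chr D p q b e d =
      ∑ e, chr D p q a c e * chr D p q d e b := fun a b d c =>
    Finset.sum_congr rfl fun e _ => by rw [chr_symm hD hq e b d]
  simp only [lriem, curv, mdc, Matrix.add_apply, Matrix.sub_apply, Matrix.mul_apply, Matrix.of_apply]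
  rw [h1 a b c d, h1 b d c a, h1 d a c b, h2 a b d, h2 b d a, h2 d a b]
  ring

/-- Contract the first Bianchi identity. The trace of the curvature on its endomorphism indices
measures the skew part of the Ricci tensor, which need not vanish here. -/
theorem lriem_trace (hD : IsSmoothTorsionFree D) (hq : q ∈ dom n p) (a b : Fin n) :
    ∑ c, lriem D p q a b c c = lric D p q b a - lric D p q a b := by
  have h : ∀ c, lriem D p q a b c c = lriem D p q c b c a - lriem D p q c a c b := by
    intro c
    have h1 := lriem_bianchi hD hq a b c c
    have h2 : lriem D p q b c c a = - lriem D p q c b c a := by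
      rw [lriem, curv_swap]; rfl
    linarith
  simp only [h, Finset.sum_sub_distrib, lric]

/-- This inverts the definition of the Schouten tensor. The determinant of the system for `P` and
its transpose is `n² - 1`, non-zero since `n ≥ 2`. -/
theorem lric_eq (hn : 2 ≤ n) (D : AffineConnection n M) (p q : M) (b d : Fin n) :
    lric D p q b d = n * lschouten D p q b d - lschouten D p q d b := by
  have h2 : (2 : ℝ) ≤ n := by exact_mod_cast hn
  have : (n : ℝ) ^ 2 - 1 ≠ 0 := by nlinarith
  simp only [lschouten]
  field_simp
  ring

end localCurvature

/-! ### The tractor connection in a chart -/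

section blocks

variable {n : ℕ}

/-- The action of a linear automorphism of the tangent space on unweighted standard tractors. -/
def emb (A : Matrix (Fin n) (Fin n) ℝ) : TMat n
  | some c, some d => A c d
  | none, none => 1
  | _, _ => 0

theorem emb_mul (A B : Matrix (Fin n) (Fin n) ℝ) : emb A * emb B = emb (A * B) := by
  ext (_ | c) (_ | d) <;> simp [emb, Matrix.mul_apply, Fintype.sum_option]

theorem emb_one : emb (1 : Matrix (Fin n) (Fin n) ℝ) = 1 := by
  ext (_ | c) (_ | d) <;> simp [emb, Matrix.one_apply]

end blocks

/-! ### The connection matrix of the standard tractor bundle in a chart, and its curvature. -/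

section localTractor

variable {n : ℕ} {M : Type*} [TopologicalSpace M] [ChartedSpace (EuclideanSpace ℝ (Fin n)) M]
  [IsManifold (𝓡 n) ∞ M] {p p' r q : M}

/-- The matrix at `z` of the change of coordinates from the preferred chart of `p` to that of `p'`,
on standard tractors. -/
def tjac (p p' z : M) : TMat n :=
  -- Standard tractors have slots of weight `-1`, and densities of weight `-(n + 1)` are the
  -- sections of the density bundle of volume forms; hence the exponent.
  |(jac p p' z : Matrix (Fin n) (Fin n) ℝ).det| ^ (-1 / ((n : ℝ) + 1)) • emb (jac p p' z)

theorem det_jac_ne_zero (hp : q ∈ dom n p) (hp' : q ∈ dom n p') :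
    (jac p p' q : Matrix (Fin n) (Fin n) ℝ).det ≠ 0 := by
  have := congrArg Matrix.det (jac_mul_jac (n := n) hp hp')
  rw [Matrix.det_mul, Matrix.det_one] at this
  exact right_ne_zero_of_mul_eq_one this

theorem tjac_mul (hp : q ∈ dom n p) (hp' : q ∈ dom n p') (hr : q ∈ dom n r) :
    (tjac p' r q * tjac p p' q : TMat n) = tjac p r q := by
  rw [tjac, tjac, tjac, smul_mul_smul_comm, emb_mul, jac_mul hp hp' hr,
    ← Real.mul_rpow (abs_nonneg _) (abs_nonneg _), ← abs_mul, ← Matrix.det_mul, jac_mul hp hp' hr]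

theorem tjac_self (hp : q ∈ dom n p) : (tjac p p q : TMat n) = 1 := by
  simp [tjac, jac_self hp, emb_one]

theorem tjac_mul_tjac (hp : q ∈ dom n p) (hp' : q ∈ dom n p') :
    (tjac p' p q * tjac p p' q : TMat n) = 1 := by rw [tjac_mul hp hp' hp, tjac_self hp]

theorem matSmoothAt_emb {A : M → Matrix (Fin n) (Fin n) ℝ} (hA : MatSmoothAt n A q) :
    MatSmoothAt n (fun z => emb (A z)) q := by
  rintro (_ | c) (_ | d)
  exacts [smoothAt_const _, smoothAt_const _, smoothAt_const _, hA c d]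

theorem smoothAt_weight (hp : q ∈ dom n p) (hp' : q ∈ dom n p') (w : ℝ) :
    SmoothAt n (fun z => |(jac p p' z : Matrix (Fin n) (Fin n) ℝ).det| ^ w) q :=
  smoothAt_abs_rpow (smoothAt_det (matSmoothAt_jac hp hp')) (det_jac_ne_zero hp hp') w

theorem matSmoothAt_tjac (hp : q ∈ dom n p) (hp' : q ∈ dom n p') :
    MatSmoothAt n (fun z => (tjac p p' z : TMat n)) q :=
  MatSmoothAt.smul (smoothAt_weight hp hp' _) (matSmoothAt_emb (matSmoothAt_jac hp hp'))

/-- The matrix at `q` of the tractor connection in direction `a`, in the frame given by the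
preferred chart of `p`. -/
def lgam (D : AffineConnection n M) (p q : M) (a : Fin n) : TMat n
  -- The subtracted trace is the contribution of the weight `-1`, present in both diagonal blocks.
  | some c, some d => chr D p q a c d - if c = d then (chr D p q a).trace / (n + 1) else 0
  | some c, none => if c = a then 1 else 0
  | none, some d => - lschouten D p q a d
  | none, none => - ((chr D p q a).trace / (n + 1))

/-- The logarithmic derivative of the tractor Jacobian splits into that of the tangent Jacobian on
the `Y`-block and, by Jacobi's formula for the determinant factor, a multiple of the identity. -/
theorem tjac_mul_mdc (hp : q ∈ dom n p) (hp' : q ∈ dom n p') (a : Fin n) (i j : Option (Fin n)) :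
    ((tjac p' p q : TMat n) * mdc p (fun z => (tjac p p' z : TMat n)) q a) i j =
      (match i, j with
        | some c, some d => (jac p' p q * mdc p (fun z => jac p p' z) q a : Matrix _ _ ℝ) c d
        | _, _ => 0) -
      if i = j then (jac p' p q * mdc p (fun z => jac p p' z) q a : Matrix (Fin n) (Fin n) ℝ).trace
        / (n + 1) else 0 := by
  have hdet := det_jac_ne_zero (n := n) hp hp'
  have hJ := matSmoothAt_jac (n := n) hp hp'
  have h1 : dc p (fun z => |(jac p p' z : Matrix (Fin n) (Fin n) ℝ).det| ^ (-1 / ((n : ℝ) + 1))) q a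
      = |(jac p p' q : Matrix (Fin n) (Fin n) ℝ).det| ^ (-1 / ((n : ℝ) + 1)) *
        (- ((jac p' p q * mdc p (fun z => jac p p' z) q a : Matrix (Fin n) (Fin n) ℝ).trace
          / (n + 1))) := by
    rw [dc_comp hp (smoothAt_det hJ) (hasDerivAt_abs_rpow hdet _),
      dc_det hp hJ (jac_mul_jac hp hp')]
    field_simp
  have h2 : mdc p (fun z => (tjac p p' z : TMat n)) q a =
      (- ((jac p' p q * mdc p (fun z => jac p p' z) q a : Matrix (Fin n) (Fin n) ℝ).trace
          / (n + 1))) • (tjac p p' q : TMat n) +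
      |(jac p p' q : Matrix (Fin n) (Fin n) ℝ).det| ^ (-1 / ((n : ℝ) + 1)) •
        mdc p (fun z => emb (jac p p' z)) q a := by
    simp only [tjac]
    rw [mdc_smul hp (smoothAt_weight hp hp' _) (matSmoothAt_emb hJ), h1, smul_smul, mul_comm]
  have h3 : |(jac p' p q : Matrix (Fin n) (Fin n) ℝ).det| ^ (-1 / ((n : ℝ) + 1)) *
      |(jac p p' q : Matrix (Fin n) (Fin n) ℝ).det| ^ (-1 / ((n : ℝ) + 1)) = 1 := by
    rw [← Real.mul_rpow (abs_nonneg _) (abs_nonneg _), ← abs_mul, ← Matrix.det_mul,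
      jac_mul_jac hp hp']
    simp
  rw [h2, Matrix.mul_add, Matrix.mul_smul, tjac_mul_tjac hp hp']
  conv_lhs => rw [show (tjac p' p q : TMat n) = |(jac p' p q : Matrix (Fin n) (Fin n) ℝ).det| ^
    (-1 / ((n : ℝ) + 1)) • emb (jac p' p q) from rfl]
  rw [smul_mul_smul_comm, h3, one_smul, add_comm]
  rcases i with _ | c <;> rcases j with _ | d <;>
    simp [Matrix.mul_apply, Fintype.sum_option, mdc, emb, dc_const, Matrix.one_apply, sub_eq_add_neg]

variable {D : AffineConnection n M}

/-- The inhomogeneous terms come from the Christoffel symbols and, through their trace, from the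
density weight; together they are the logarithmic derivative in `tjac_mul_mdc`. The off-diagonal
blocks, the Kronecker delta and the Schouten tensor, are tensorial. -/
theorem lgam_transform [T2Space M] (hD : IsSmoothTorsionFree D) (hp : q ∈ dom n p)
    (hp' : q ∈ dom n p') (a : Fin n) :
    lgam D p q a = tjac p' p q * pullConn p p' (lgam D p') q a * tjac p p' q +
      tjac p' p q * mdc p (fun z => (tjac p p' z : TMat n)) q a := by
  have hJJ := jac_mul_jac (n := n) hp hp'
  have hc : chr D p q a = jac p' p q * pullConn p p' (chr D p') q a * jac p p' q +
      jac p' p q * mdc p (fun z => jac p p' z) q a := chr_transform D hp hp' a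
  have htr : (chr D p q a).trace = (pullConn p p' (chr D p') q a).trace +
      (jac p' p q * mdc p (fun z => jac p p' z) q a : Matrix (Fin n) (Fin n) ℝ).trace := by
    rw [hc, Matrix.trace_add, Matrix.trace_mul_cycle, jac_mul_jac hp' hp, Matrix.one_mul]
  have h3 : |(jac p' p q : Matrix (Fin n) (Fin n) ℝ).det| ^ (-1 / ((n : ℝ) + 1)) *
      |(jac p p' q : Matrix (Fin n) (Fin n) ℝ).det| ^ (-1 / ((n : ℝ) + 1)) = 1 := by
    rw [← Real.mul_rpow (abs_nonneg _) (abs_nonneg _), ← abs_mul, ← Matrix.det_mul,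
      jac_mul_jac hp hp']
    simp
  have h4 : (tjac p' p q * pullConn p p' (lgam D p') q a * tjac p p' q : TMat n) =
      emb (jac p' p q) * pullConn p p' (lgam D p') q a * emb (jac p p' q) := by
    rw [tjac, tjac, Matrix.smul_mul, smul_mul_smul_comm, h3, one_smul]
  have htr2 : (pullConn p p' (chr D p') q a).trace = ∑ e, jac p p' q e a * (chr D p' q e).trace := by
    simp [pullConn, Matrix.trace_sum, Matrix.trace_smul]
  have hpull : ∀ i j, pullConn p p' (lgam D p') q a i j =
      match i, j with
      | some c, some d => pullConn p p' (chr D p') q a c d -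
          if c = d then (pullConn p p' (chr D p') q a).trace / (n + 1) else 0
      | some c, none => jac p p' q c a
      | none, some d => - ∑ e, jac p p' q e a * lschouten D p' q e d
      | none, none => - ((pullConn p p' (chr D p') q a).trace / (n + 1)) := by
    rintro (_ | c) (_ | d)
    · simp [pullConn, Matrix.sum_apply, lgam, Finset.sum_div, mul_div_assoc]
    · simp [pullConn, Matrix.sum_apply, lgam]
    · simp [pullConn, Matrix.sum_apply, lgam]
    · rw [htr2]
      simp only [pullConn, Matrix.sum_apply, Matrix.smul_apply, lgam, smul_eq_mul, mul_sub,
        Finset.sum_sub_distrib]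
      congr 1
      split_ifs
      · simp [Finset.sum_div, mul_div_assoc]
      · simp
  rw [h4]
  ext i j
  rw [Matrix.add_apply, tjac_mul_mdc hp hp']
  have hmul : ∀ i j, (emb (jac p' p q) * pullConn p p' (lgam D p') q a * emb (jac p p' q) : TMat n) i j =
      match i, j with
      | some c, some d => (jac p' p q * pullConn p p' (chr D p') q a * jac p p' q : Matrix _ _ ℝ) c d -
          if c = d then (pullConn p p' (chr D p') q a).trace / (n + 1) else 0
      | some c, none => if c = a then 1 else 0
      | none, some d => - lschouten D p q a d
      | none, none => - ((pullConn p p' (chr D p') q a).trace / (n + 1)) := by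
    rintro (_ | c) (_ | d)
    · simp [Matrix.mul_apply, Fintype.sum_option, emb, hpull]
    · show _ = - lschouten D p q a d
      rw [lschouten_transform hD hp hp']
      simp only [Matrix.mul_apply, Fintype.sum_option, emb, hpull]
      simp only [zero_mul, Finset.sum_const_zero, add_zero, one_mul, mul_zero, zero_add]
      simp only [neg_mul, Finset.sum_mul, Finset.sum_neg_distrib]
      rw [Finset.sum_comm]
      congr 1
      refine Finset.sum_congr rfl fun e _ => Finset.sum_congr rfl fun f _ => ?_
      ring
    · have := congrFun (congrFun hJJ c) a
      rw [Matrix.mul_apply, Matrix.one_apply] at this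
      simp [Matrix.mul_apply, Fintype.sum_option, emb, hpull, this]
    · have h5 : (jac p' p q * (pullConn p p' (chr D p') q a -
          ((pullConn p p' (chr D p') q a).trace / (n + 1)) • 1) * jac p p' q : Matrix _ _ ℝ) c d =
          (jac p' p q * pullConn p p' (chr D p') q a * jac p p' q : Matrix _ _ ℝ) c d -
          if c = d then (pullConn p p' (chr D p') q a).trace / (n + 1) else 0 := by
        rw [Matrix.mul_sub, Matrix.sub_mul, Matrix.mul_smul, Matrix.smul_mul, Matrix.mul_one, hJJ]
        simp [Matrix.one_apply]
      refine Eq.trans ?_ h5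
      simp [Matrix.mul_apply, Fintype.sum_option, emb, hpull, Matrix.one_apply]
  rw [hmul]
  rcases i with _ | c <;> rcases j with _ | d
  · simp only [lgam, htr, if_true]; ring
  · simp [lgam]
  · simp [lgam]
  · simp only [lgam, htr]
    rw [hc, Matrix.add_apply]
    by_cases h : c = d
    · simp only [h, if_true]; ring
    · simp [h]

theorem matSmoothAt_lgam [T2Space M] (hD : IsSmoothTorsionFree D) (hq : q ∈ dom n p) (a : Fin n) :
    MatSmoothAt n (fun z => lgam D p z a) q := by
  have htr : SmoothAt n (fun z => (chr D p z a).trace / (n + 1)) q := by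
    simp only [div_eq_mul_inv]
    exact (smoothAt_sum fun c _ => matSmoothAt_chr hD hq a c c).fun_mul (smoothAt_const _)
  rintro (_ | c) (_ | d)
  · exact htr.fun_neg
  · exact (smoothAt_lschouten hD hq a d).fun_neg
  · exact smoothAt_const _
  · simp only [lgam]
    split_ifs
    · exact SmoothAt.fun_sub (matSmoothAt_chr hD hq a c d) htr
    · exact SmoothAt.fun_sub (matSmoothAt_chr hD hq a c d) (smoothAt_const _)

/-- The components at `q` of the tractor curvature, in the preferred chart of `p`. -/
def tcurv (D : AffineConnection n M) (p q : M) (a b : Fin n) : TMat n := curv p (lgam D p) q a b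

/-- The commutator is traceless, so only the exterior derivative of the trace of the connection form
remains. -/
theorem lriem_trace_eq (p q : M) (a b : Fin n) [T2Space M] (hD : IsSmoothTorsionFree D)
    (hq : q ∈ dom n p) :
    (lriem D p q a b).trace = dc p (fun z => (chr D p z b).trace) q a -
      dc p (fun z => (chr D p z a).trace) q b := by
  simp only [lriem, curv, Matrix.trace_add, Matrix.trace_sub, Matrix.trace_mul_comm (chr D p q a)]
  rw [sub_self, add_zero]
  simp only [Matrix.trace, Matrix.diag]
  rw [dc_sum hq fun c _ => matSmoothAt_chr hD hq b c c,
    dc_sum hq fun c _ => matSmoothAt_chr hD hq a c c]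
  rfl

theorem tcurv_some_some [T2Space M] (hD : IsSmoothTorsionFree D) (hq : q ∈ dom n p)
    (a b c d : Fin n) :
    tcurv D p q a b (some c) (some d) = lriem D p q a b c d
      - (if c = d then (lriem D p q a b).trace / (n + 1) else 0)
      - (if c = a then lschouten D p q b d else 0) + (if c = b then lschouten D p q a d else 0) := by
  have htr : ∀ a, SmoothAt n (fun z => (chr D p z a).trace) q := fun a =>
    smoothAt_sum fun c _ => matSmoothAt_chr hD hq a c c
  have h1 : ∀ a b : Fin n, dc p (fun z => lgam D p z b (some c) (some d)) q a =
      dc p (fun z => chr D p z b c d) q a -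
        if c = d then dc p (fun z => (chr D p z b).trace) q a / (n + 1) else 0 := by
    intro a b
    simp only [lgam]
    split_ifs
    · simp only [div_eq_mul_inv]
      rw [dc_sub hq (matSmoothAt_chr hD hq b c d) ((htr b).fun_mul (smoothAt_const _)),
        dc_mul hq (htr b) (smoothAt_const _), dc_const]
      ring
    · simp
  have h2 : ∀ a b : Fin n, (lgam D p q a * lgam D p q b) (some c) (some d) =
      (chr D p q a * chr D p q b) c d - (chr D p q a).trace / (n + 1) * chr D p q b c d
      - (chr D p q b).trace / (n + 1) * chr D p q a c d
      + (if c = d then (chr D p q a).trace / (n + 1) * ((chr D p q b).trace / (n + 1)) else 0)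
      - (if c = a then lschouten D p q b d else 0) := by
    intro a b
    simp only [Matrix.mul_apply, Fintype.sum_option, lgam, sub_mul, mul_sub, Finset.sum_sub_distrib,
      ite_mul, mul_ite, mul_zero, zero_mul, one_mul, Finset.sum_ite_eq, Finset.sum_ite_eq',
      Finset.mem_univ, if_true]
    split_ifs <;> ring
  simp only [tcurv, curv, Matrix.add_apply, Matrix.sub_apply, h2]
  simp only [mdc, Matrix.of_apply, h1]
  rw [lriem_trace_eq p q a b hD hq]
  simp only [lriem, curv, Matrix.add_apply, Matrix.sub_apply, mdc, Matrix.of_apply]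
  by_cases h : c = d
  · simp only [h, if_true]; ring
  · simp only [h, if_false]; ring

/-- This block is the torsion: what survives is the skew part of the Christoffel symbols in their
lower indices. -/
theorem tcurv_some_none (hD : IsSmoothTorsionFree D) (hq : q ∈ dom n p) (a b c : Fin n) :
    tcurv D p q a b (some c) none = 0 := by
  have h1 : ∀ a b : Fin n, dc p (fun z => lgam D p z b (some c) none) q a = 0 :=
    fun a b => dc_const p q _ a
  have h2 : ∀ a b : Fin n, (lgam D p q a * lgam D p q b) (some c) none =
      chr D p q a c b - (if c = b then (chr D p q a).trace / (n + 1) else 0)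
      - (if c = a then (chr D p q b).trace / (n + 1) else 0) := by
    intro a b
    simp [Matrix.mul_apply, Fintype.sum_option, lgam]
    split_ifs <;> ring
  simp only [tcurv, curv, Matrix.add_apply, Matrix.sub_apply, h2, mdc, Matrix.of_apply, h1]
  rw [chr_symm hD hq c a b]
  ring

/-- The density part contributes `-1/(n + 1)` times the trace of the curvature, which by the Bianchi
identity is the skew part of `P`; it cancels the skew part of `P` coming from the product of the
off-diagonal blocks. -/
theorem tcurv_none_none [T2Space M] (hn : 2 ≤ n) (hD : IsSmoothTorsionFree D) (hq : q ∈ dom n p)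
    (a b : Fin n) : tcurv D p q a b none none = 0 := by
  have htr : ∀ a, SmoothAt n (fun z => (chr D p z a).trace) q := fun a =>
    smoothAt_sum fun c _ => matSmoothAt_chr hD hq a c c
  have h1 : ∀ a b : Fin n, dc p (fun z => lgam D p z b none none) q a =
      - (dc p (fun z => (chr D p z b).trace) q a / (n + 1)) := by
    intro a b
    simp only [lgam, div_eq_mul_inv]
    rw [dc_neg hq ((htr b).fun_mul (smoothAt_const _)), dc_mul hq (htr b) (smoothAt_const _), dc_const]
    ring
  have h2 : ∀ a b : Fin n, (lgam D p q a * lgam D p q b) none none =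
      (chr D p q a).trace / (n + 1) * ((chr D p q b).trace / (n + 1)) - lschouten D p q a b := by
    intro a b
    simp [Matrix.mul_apply, Fintype.sum_option, lgam]
    ring
  have h3 := lriem_trace_eq p q a b hD hq
  have h4 := lriem_trace hD hq a b
  have h5 : (lriem D p q a b).trace = lric D p q b a - lric D p q a b := h4
  rw [lric_eq hn, lric_eq hn, h3] at h5
  have h6 : (n : ℝ) + 1 ≠ 0 := by positivity
  -- The traced Bianchi identity in terms of `P`: `tr R_{ab} = (n + 1)(P_{ba} - P_{ab})`.
  have h7 : dc p (fun z => (chr D p z b).trace) q a = dc p (fun z => (chr D p z a).trace) q b +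
    ((n + 1) * (lschouten D p q b a - lschouten D p q a b)) := by linarith
  simp only [tcurv, curv, Matrix.add_apply, Matrix.sub_apply, h2, mdc, Matrix.of_apply, h1]
  rw [h7]
  field_simp
  ring

/-- The right-hand side is minus the skew derivative of the Schouten tensor with its Christoffel
corrections in the last index only. The trace terms are symmetric in `a`, `b` and cancel. -/
theorem tcurv_none_some [T2Space M] (hD : IsSmoothTorsionFree D) (hq : q ∈ dom n p)
    (a b d : Fin n) : tcurv D p q a b none (some d) =
      - (dc p (fun z => lschouten D p z b d) q a - ∑ e, chr D p q a e d * lschouten D p q b e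
        - (dc p (fun z => lschouten D p z a d) q b - ∑ e, chr D p q b e d * lschouten D p q a e)) := by
  have h1 : ∀ a b : Fin n, dc p (fun z => lgam D p z b none (some d)) q a =
      - dc p (fun z => lschouten D p z b d) q a := by
    intro a b
    simp only [lgam]
    exact dc_neg hq (smoothAt_lschouten hD hq b d) a
  have h2 : ∀ a b : Fin n, (lgam D p q a * lgam D p q b) none (some d) =
      (chr D p q a).trace / (n + 1) * lschouten D p q b d
      + (chr D p q b).trace / (n + 1) * lschouten D p q a d
      - ∑ e, chr D p q b e d * lschouten D p q a e := by
    intro a b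
    have h3 : ∑ e, - lschouten D p q a e * chr D p q b e d =
        - ∑ e, chr D p q b e d * lschouten D p q a e := by
      rw [← Finset.sum_neg_distrib]
      exact Finset.sum_congr rfl fun e _ => by ring
    simp only [Matrix.mul_apply, Fintype.sum_option, lgam, mul_sub, Finset.sum_sub_distrib, mul_ite,
      mul_zero, Finset.sum_ite_eq', Finset.mem_univ, if_true, h3]
    ring
  simp only [tcurv, curv, Matrix.add_apply, Matrix.sub_apply, h2, mdc, Matrix.of_apply, h1]
  ring

/-- The Weyl block of the tractor curvature is trace-free in its first pair of indices. -/
theorem tcurv_trace [T2Space M] (hn : 2 ≤ n) (hD : IsSmoothTorsionFree D) (hq : q ∈ dom n p)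
    (b d : Fin n) : ∑ a, tcurv D p q a b (some a) (some d) = 0 := by
  have h5 : (lriem D p q d b).trace = lric D p q b d - lric D p q d b := lriem_trace hD hq d b
  simp only [tcurv_some_some hD hq, if_true, Finset.sum_add_distrib, Finset.sum_sub_distrib]
  have h6 : (n : ℝ) + 1 ≠ 0 := by positivity
  simp only [Finset.sum_ite_eq', Finset.mem_univ, if_true, Finset.sum_const, Finset.card_univ,
    Fintype.card_fin, nsmul_eq_mul]
  rw [h5, ← lric, lric_eq hn, lric_eq hn]
  field_simp
  ring

/-- The Weyl tensor is trace-free as an endomorphism as well: the density correction removes part of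
the trace of the curvature, and the two Schouten terms remove the rest. -/
theorem tcurv_trace' [T2Space M] (hn : 2 ≤ n) (hD : IsSmoothTorsionFree D) (hq : q ∈ dom n p)
    (a b : Fin n) : ∑ c, tcurv D p q a b (some c) (some c) = 0 := by
  have h5 : (lriem D p q a b).trace = lric D p q b a - lric D p q a b := lriem_trace hD hq a b
  have h7 : ∑ c, lriem D p q a b c c = (lriem D p q a b).trace := rfl
  simp only [tcurv_some_some hD hq, if_true, Finset.sum_add_distrib, Finset.sum_sub_distrib]
  have h6 : (n : ℝ) + 1 ≠ 0 := by positivity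
  simp only [Finset.sum_ite_eq', Finset.mem_univ, if_true, Finset.sum_const, Finset.card_univ,
    Fintype.card_fin, nsmul_eq_mul]
  rw [h7, h5, lric_eq hn, lric_eq hn]
  field_simp
  ring

/-- The two expressions differ only in the multiple of `δ^c_d`, and these agree because `tr
R_{ab}/(n + 1) = P_{ba} - P_{ab}`. -/
theorem weyl_eq [T2Space M] (hn : 2 ≤ n) (hD : IsSmoothTorsionFree D) (p : M) (a b c d : Fin n) :
    weyl D p a b c d = tcurv D p p a b (some c) (some d) := by
  have h5 : (lriem D p p a b).trace = lric D p p b a - lric D p p a b :=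
    lriem_trace hD (self_mem_dom p) a b
  rw [tcurv_some_some hD (self_mem_dom p), weyl, riem_eq hD]
  simp only [schouten_eq hD]
  rw [h5, lric_eq hn, lric_eq hn]
  have h6 : (n : ℝ) + 1 ≠ 0 := by positivity
  have h8 : (n * lschouten D p p b a - lschouten D p p a b -
    (n * lschouten D p p a b - lschouten D p p b a)) / ((n : ℝ) + 1) =
    lschouten D p p b a - lschouten D p p a b := by field_simp; ring
  rw [h8]
  simp only [eq_comm (a := a) (b := c), eq_comm (a := b) (b := c)]
  split_ifs <;> ring

theorem inChart_schouten [T2Space M] (hD : IsSmoothTorsionFree D) (hq : q ∈ dom n p)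
    (b d : Fin n) :
    inChart 0 (fun (z : M) (i : Fin 2 → Fin n) (_ : Fin 0 → Fin n) => schouten D z (i 0) (i 1))
      p q ![b, d] ![] = lschouten D p q b d := by
  rw [lschouten_transform hD hq (self_mem_dom q)]
  simp only [inChart, zero_div, Real.rpow_zero, one_mul, Fintype.sum_unique, schouten_eq hD]
  rw [← (finTwoArrowEquiv (Fin n)).symm.sum_comp, Fintype.sum_prod_type]
  refine Finset.sum_congr rfl fun e _ => Finset.sum_congr rfl fun f _ => ?_
  simp [Fin.prod_univ_two]

/-- The Christoffel corrections in the two skewed indices cancel because there is no torsion; what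
remains is the block computed in `tcurv_none_some`. -/
theorem cotton_eq [T2Space M] (hD : IsSmoothTorsionFree D) (p : M) (a b d : Fin n) :
    cotton D p a b d = - tcurv D p p a b none (some d) := by
  have hp := self_mem_dom (n := n) p
  have h1 : ∀ a b d : Fin n, pd (fun q => inChart 0
      (fun (z : M) (i : Fin 2 → Fin n) (_ : Fin 0 → Fin n) => schouten D z (i 0) (i 1))
      p q ![b, d] ![]) p a = dc p (fun z => lschouten D p z b d) p a := by
    intro a b d
    have he : (fun q => inChart 0
      (fun (z : M) (i : Fin 2 → Fin n) (_ : Fin 0 → Fin n) => schouten D z (i 0) (i 1))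
      p q ![b, d] ![]) =ᶠ[nhds p] fun z => lschouten D p z b d := by
      filter_upwards [dom_mem_nhds hp] with z hz
      exact inChart_schouten hD hz b d
    rw [pd_eq_dc ((smoothAt_lschouten hD hp b d).congr_of_eventuallyEq he), dc_congr hp he]
  have h2 : ∀ c a b : Fin n, christoffel D p p c a b = chr D p p a c b := fun _ _ _ => rfl
  rw [tcurv_none_some hD hp, cotton, cov, cov, h1, h1]
  simp only [h2, Fin.sum_univ_two, schouten_eq hD, Finset.univ_eq_empty, Finset.sum_empty, zero_div,
    zero_mul, Matrix.cons_val_zero, Matrix.cons_val_one, Function.update_self]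
  simp only [ne_eq, one_ne_zero, not_false_eq_true, zero_ne_one, Function.update_of_ne,
    Matrix.cons_val_zero, Matrix.cons_val_one]
  simp only [fun e => chr_symm hD hp e a b]
  ring

end localTractor

/-! ### Antisymmetrization -/

section antisymmetrization

variable {n ℓ : ℕ} {A B : Type*} [AddCommGroup A] [Module ℝ A] [AddCommGroup B] [Module ℝ B]

/-- Skew-symmetric arrays. -/
def IsSkew (T : (Fin ℓ → Fin n) → A) : Prop :=
  ∀ (π : Equiv.Perm (Fin ℓ)) (a : Fin ℓ → Fin n), T (a ∘ π) = ((Equiv.Perm.sign π : ℤ) : ℝ) • T a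

theorem alt_add (S T : (Fin ℓ → Fin n) → A) (a : Fin ℓ → Fin n) :
    alt (fun b => S b + T b) a = alt S a + alt T a := by
  simp only [alt, smul_add, Finset.sum_add_distrib]

theorem alt_sub (S T : (Fin ℓ → Fin n) → A) (a : Fin ℓ → Fin n) :
    alt (fun b => S b - T b) a = alt S a - alt T a := by
  simp only [alt, smul_sub, Finset.sum_sub_distrib]

theorem alt_map (L : A →ₗ[ℝ] B) (T : (Fin ℓ → Fin n) → A) (a : Fin ℓ → Fin n) :
    alt (fun b => L (T b)) a = L (alt T a) := by
  simp only [alt, map_smul, map_sum]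

theorem alt_smul (r : ℝ) (T : (Fin ℓ → Fin n) → A) (a : Fin ℓ → Fin n) :
    alt (fun b => r • T b) a = r • alt T a :=
  alt_map (LinearMap.lsmul ℝ A r) T a

theorem alt_sum {ι : Type*} (s : Finset ι) (T : ι → (Fin ℓ → Fin n) → A) (a : Fin ℓ → Fin n) :
    alt (fun b => ∑ i ∈ s, T i b) a = ∑ i ∈ s, alt (T i) a := by
  classical
  induction s using Finset.induction_on with
  | empty => simp [alt]
  | insert i s hi ih => simp only [Finset.sum_insert hi, alt_add, ih]

theorem sign_mul_self (π : Equiv.Perm (Fin ℓ)) :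
    ((Equiv.Perm.sign π : ℤ) : ℝ) * ((Equiv.Perm.sign π : ℤ) : ℝ) = 1 := by
  rw [← Int.cast_mul, ← Units.val_mul, Int.units_mul_self]; simp

theorem alt_isSkew (T : (Fin ℓ → Fin n) → A) : IsSkew (alt T) := by
  intro π a
  simp only [alt]
  rw [smul_comm (((Equiv.Perm.sign π : ℤ) : ℝ)), Finset.smul_sum (r := ((Equiv.Perm.sign π : ℤ) : ℝ))]
  congr 1
  rw [← Equiv.sum_comp (Equiv.mulLeft π) (fun τ => ((Equiv.Perm.sign π : ℤ) : ℝ) •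
    ((Equiv.Perm.sign τ : ℤ) : ℝ) • T (a ∘ τ))]
  refine Finset.sum_congr rfl fun τ _ => ?_
  simp only [Equiv.coe_mulLeft, Equiv.Perm.sign_mul, Units.val_mul, Int.cast_mul,
    Equiv.Perm.coe_mul, smul_smul, ← mul_assoc, sign_mul_self, one_mul, Function.comp_assoc]

theorem alt_comp_perm (T : (Fin ℓ → Fin n) → A) (σ : Equiv.Perm (Fin ℓ)) (a : Fin ℓ → Fin n) :
    alt (fun b => T (b ∘ σ)) a = ((Equiv.Perm.sign σ : ℤ) : ℝ) • alt T a := by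
  simp only [alt]
  rw [smul_comm (((Equiv.Perm.sign σ : ℤ) : ℝ)), Finset.smul_sum (r := ((Equiv.Perm.sign σ : ℤ) : ℝ))]
  congr 1
  rw [← Equiv.sum_comp (Equiv.mulRight σ) (fun τ => ((Equiv.Perm.sign σ : ℤ) : ℝ) •
    ((Equiv.Perm.sign τ : ℤ) : ℝ) • T (a ∘ τ))]
  refine Finset.sum_congr rfl fun τ _ => ?_
  simp only [Equiv.coe_mulRight, Equiv.Perm.sign_mul, Units.val_mul, Int.cast_mul,
    Equiv.Perm.coe_mul, smul_smul, Function.comp_assoc]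
  rw [mul_comm (((Equiv.Perm.sign τ : ℤ) : ℝ)), ← mul_assoc, sign_mul_self, one_mul]

theorem alt_eq_self {T : (Fin ℓ → Fin n) → A} (hT : IsSkew T) : alt T = T := by
  funext a
  simp only [alt, hT _ a, smul_smul, sign_mul_self, one_smul]
  simp only [Finset.sum_const, Finset.card_univ, Fintype.card_perm, Fintype.card_fin]
  rw [← Nat.cast_smul_eq_nsmul ℝ, smul_smul, inv_mul_cancel₀ (by positivity), one_smul]

/-- A transposition is odd, so the antisymmetrization equals its own negative. This disposes of
Christoffel symbols and of second derivatives of coordinate changes. -/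
theorem alt_eq_zero_of_swap {T : (Fin ℓ → Fin n) → A} {i j : Fin ℓ} (hij : i ≠ j)
    (h : ∀ a, T (a ∘ Equiv.swap i j) = T a) : alt T = 0 := by
  funext a
  have h1 := alt_comp_perm T (Equiv.swap i j) a
  simp only [h, Equiv.Perm.sign_swap hij] at h1
  have h2 : (2 : ℝ) • alt T a = 0 := by
    rw [two_smul]
    nth_rewrite 1 [h1]
    simp
  exact (smul_eq_zero.1 h2).resolve_left two_ne_zero

theorem alt_skew_part (T : (Fin ℓ → Fin n) → A) {i j : Fin ℓ} (hij : i ≠ j) (a : Fin ℓ → Fin n) :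
    alt T a = (1 / 2 : ℝ) • alt (fun b => T b - T (b ∘ Equiv.swap i j)) a := by
  rw [alt_sub, alt_comp_perm, Equiv.Perm.sign_swap hij]
  simp only [Units.val_neg, Units.val_one, Int.cast_neg, Int.cast_one, neg_smul, one_smul,
    sub_neg_eq_add]
  rw [← two_smul ℝ, smul_smul]
  norm_num

/-- The permutation of `Fin (ℓ + 1)` fixing `0` and permuting the successors by `π`. -/
def consPerm (π : Equiv.Perm (Fin ℓ)) : Equiv.Perm (Fin (ℓ + 1)) :=
  Equiv.Perm.decomposeFin.symm (0, π)

theorem sign_consPerm (π : Equiv.Perm (Fin ℓ)) :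
    Equiv.Perm.sign (consPerm π) = Equiv.Perm.sign π := by
  simp [consPerm]

theorem consPerm_zero (π : Equiv.Perm (Fin ℓ)) : consPerm π 0 = 0 := by simp [consPerm]

theorem consPerm_succ (π : Equiv.Perm (Fin ℓ)) (i : Fin ℓ) : consPerm π i.succ = (π i).succ := by
  simp [consPerm]

theorem tail_comp_consPerm (a : Fin (ℓ + 1) → Fin n) (π : Equiv.Perm (Fin ℓ)) :
    Fin.tail (a ∘ consPerm π) = Fin.tail a ∘ π := by
  funext i; simp [Fin.tail, consPerm_succ]

theorem cons_comp_consPerm (r : Fin n) (a : Fin ℓ → Fin n) (π : Equiv.Perm (Fin ℓ)) :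
    (Fin.cons r a : Fin (ℓ + 1) → Fin n) ∘ consPerm π = Fin.cons r (a ∘ π) := by
  funext i
  refine Fin.cases ?_ (fun i => ?_) i
  · simp [consPerm_zero]
  · simp [consPerm_succ]

/-- Antisymmetrizing first over the tail does not matter. -/
theorem alt_alt_tail (U : Fin n → (Fin ℓ → Fin n) → A) :
    alt (fun a : Fin (ℓ + 1) → Fin n => alt (U (a 0)) (Fin.tail a)) =
      alt (fun a => U (a 0) (Fin.tail a)) := by
  funext a
  have h1 : (fun a : Fin (ℓ + 1) → Fin n => alt (U (a 0)) (Fin.tail a)) =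
      fun a => (Nat.factorial ℓ : ℝ)⁻¹ • ∑ π : Equiv.Perm (Fin ℓ), ((Equiv.Perm.sign π : ℤ) : ℝ) •
        (fun b : Fin (ℓ + 1) → Fin n => U (b 0) (Fin.tail b)) (a ∘ consPerm π) := by
    funext a
    simp [alt, tail_comp_consPerm, consPerm_zero]
  rw [h1, alt_smul, alt_sum]
  have h2 : ∀ π : Equiv.Perm (Fin ℓ), alt (fun a : Fin (ℓ + 1) → Fin n =>
      ((Equiv.Perm.sign π : ℤ) : ℝ) •
        (fun b : Fin (ℓ + 1) → Fin n => U (b 0) (Fin.tail b)) (a ∘ consPerm π)) a =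
      alt (fun b : Fin (ℓ + 1) → Fin n => U (b 0) (Fin.tail b)) a := by
    intro π
    rw [alt_smul, alt_comp_perm (fun b : Fin (ℓ + 1) → Fin n => U (b 0) (Fin.tail b)),
      sign_consPerm, smul_smul, sign_mul_self, one_smul]
  simp only [h2, Finset.sum_const, Finset.card_univ, Fintype.card_perm, Fintype.card_fin]
  rw [← Nat.cast_smul_eq_nsmul ℝ, smul_smul, inv_mul_cancel₀ (by positivity), one_smul]

/-- The antisymmetrization of an array that is skew in all but the first index. -/
theorem alt_of_tail_skew {T : (Fin (ℓ + 1) → Fin n) → A}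
    (hT : ∀ (π : Equiv.Perm (Fin ℓ)) a, T (a ∘ consPerm π) = ((Equiv.Perm.sign π : ℤ) : ℝ) • T a)
    (a : Fin (ℓ + 1) → Fin n) :
    alt T a = ((ℓ : ℝ) + 1)⁻¹ • (T a - ∑ j : Fin ℓ, T (a ∘ Equiv.swap 0 j.succ)) := by
  -- Coset representatives: each permutation sends `0` to some `i`, and is the transposition of `0`
  -- and `i` times a permutation fixing `0`. The array is skew under the latter, so each coset
  -- contributes a single term.
  have hdec : ∀ (i : Fin (ℓ + 1)) (e : Equiv.Perm (Fin ℓ)),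
      Equiv.Perm.decomposeFin.symm (i, e) = Equiv.swap 0 i * consPerm e := by
    intro i e
    refine Equiv.ext fun x => Fin.cases ?_ (fun x => ?_) x
    · simp [consPerm_zero]
    · simp [consPerm_succ]
  simp only [alt]
  rw [← Equiv.sum_comp Equiv.Perm.decomposeFin.symm, Fintype.sum_prod_type]
  have h1 : ∀ (i : Fin (ℓ + 1)) (e : Equiv.Perm (Fin ℓ)),
      ((Equiv.Perm.sign (Equiv.Perm.decomposeFin.symm (i, e)) : ℤ) : ℝ) •
        T (a ∘ Equiv.Perm.decomposeFin.symm (i, e)) =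
      ((Equiv.Perm.sign (Equiv.swap 0 i) : ℤ) : ℝ) • T (a ∘ Equiv.swap 0 i) := by
    intro i e
    rw [hdec, Equiv.Perm.coe_mul, ← Function.comp_assoc, hT, Equiv.Perm.sign_mul, sign_consPerm,
      smul_smul, Units.val_mul, Int.cast_mul, mul_assoc, sign_mul_self, mul_one]
  simp only [h1, Finset.sum_const, Finset.card_univ, Fintype.card_perm, Fintype.card_fin]
  rw [← Finset.smul_sum, ← Nat.cast_smul_eq_nsmul ℝ, smul_smul, Fin.sum_univ_succ]
  have h2 : ((Nat.factorial (ℓ + 1) : ℝ))⁻¹ * (Nat.factorial ℓ : ℝ) = ((ℓ : ℝ) + 1)⁻¹ := by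
    rw [Nat.factorial_succ]
    push_cast
    have : (Nat.factorial ℓ : ℝ) ≠ 0 := by positivity
    field_simp
  rw [h2]
  congr 1
  simp only [Equiv.swap_self, Equiv.Perm.sign_refl, Units.val_one, Int.cast_one, one_smul,
    Equiv.coe_refl, Function.comp_id, sub_eq_add_neg]
  congr 1
  rw [← Finset.sum_neg_distrib]
  refine Finset.sum_congr rfl fun j _ => ?_
  rw [Equiv.Perm.sign_swap (Fin.succ_ne_zero j).symm]
  simp

theorem cons_comp_swap (r : Fin n) (a : Fin ℓ → Fin n) (j : Fin ℓ) :
    (Fin.cons r a : Fin (ℓ + 1) → Fin n) ∘ Equiv.swap 0 j.succ =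
      Fin.cons (a j) (Function.update a j r) := by
  funext i
  refine Fin.cases ?_ (fun i => ?_) i
  · simp
  · by_cases h : i = j
    · subst h; simp
    · simp only [Function.comp_apply, Fin.cons_succ, Function.update_of_ne h]
      rw [Equiv.swap_apply_of_ne_of_ne (Fin.succ_ne_zero i) (fun e => h (Fin.succ_injective _ e))]
      simp

theorem comp_swap_eq_cons (a : Fin (ℓ + 1) → Fin n) (j : Fin ℓ) :
    a ∘ Equiv.swap 0 j.succ = Fin.cons (a j.succ) (Function.update (Fin.tail a) j (a 0)) := by
  conv_lhs => rw [← Fin.cons_self_tail a]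
  rw [cons_comp_swap]; rfl

/-- The antisymmetrization of `U_{a₀ a}`, with `U` skew in `a`, at a list beginning with `r`. -/
theorem alt_cons {U : Fin n → (Fin ℓ → Fin n) → A} (hU : ∀ c, IsSkew (U c)) (r : Fin n)
    (a : Fin ℓ → Fin n) :
    alt (fun b : Fin (ℓ + 1) → Fin n => U (b 0) (Fin.tail b)) (Fin.cons r a) =
      ((ℓ : ℝ) + 1)⁻¹ • (U r a - ∑ j, U (a j) (Function.update a j r)) := by
  rw [alt_of_tail_skew]
  · simp only [cons_comp_swap]
    simp
  · intro π b
    simp only [Function.comp_apply, consPerm_zero, tail_comp_consPerm]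
    exact hU _ π _

/-- With more slots than values an index repeats, and exchanging the two equal entries changes the
sign. -/
theorem skew_eq_zero {T : (Fin ℓ → Fin n) → A} (hT : IsSkew T) (h : n < ℓ) : T = 0 := by
  funext a
  obtain ⟨i, j, hij, he⟩ := Fintype.exists_ne_map_eq_of_card_lt a (by simpa using h)
  have h1 := hT (Equiv.swap i j) a
  have h2 : a ∘ Equiv.swap i j = a := by
    funext x
    simp only [Function.comp_apply, Equiv.swap_apply_def]
    split_ifs with h3 h4
    · rw [h3, he]
    · rw [h4, he]
    · rfl
  rw [h2, Equiv.Perm.sign_swap hij] at h1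
  have h3 : (2 : ℝ) • T a = 0 := by
    rw [two_smul]
    nth_rewrite 1 [h1]
    simp
  exact (smul_eq_zero.1 h3).resolve_left two_ne_zero

/-- The action of a matrix on lower indices. -/
def pull (J : Matrix (Fin n) (Fin n) ℝ) (S : (Fin ℓ → Fin n) → A) : (Fin ℓ → Fin n) → A :=
  fun a => ∑ b : Fin ℓ → Fin n, (∏ i, J (b i) (a i)) • S b

theorem pull_one (S : (Fin ℓ → Fin n) → A) : pull 1 S = S := by
  funext a
  rw [pull, Finset.sum_eq_single a]
  · simp
  · intro b _ hb
    obtain ⟨i, hi⟩ := Function.ne_iff.1 hb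
    have h : ∏ i, (1 : Matrix (Fin n) (Fin n) ℝ) (b i) (a i) = 0 :=
      Finset.prod_eq_zero (Finset.mem_univ i) (Matrix.one_apply_ne hi)
    rw [h, zero_smul]
  · simp

theorem pull_pull (J K : Matrix (Fin n) (Fin n) ℝ) (S : (Fin ℓ → Fin n) → A) :
    pull J (pull K S) = pull (K * J) S := by
  funext a
  simp only [pull, Finset.smul_sum, smul_smul]
  rw [Finset.sum_comm]
  refine Finset.sum_congr rfl fun c _ => ?_
  rw [← Finset.sum_smul]
  congr 1
  simp only [Matrix.mul_apply, Fintype.prod_sum]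
  refine Finset.sum_congr rfl fun b _ => ?_
  rw [← Finset.prod_mul_distrib]
  exact Finset.prod_congr rfl fun i _ => mul_comm _ _

theorem pull_add (J : Matrix (Fin n) (Fin n) ℝ) (S T : (Fin ℓ → Fin n) → A) (a : Fin ℓ → Fin n) :
    pull J (fun b => S b + T b) a = pull J S a + pull J T a := by
  simp only [pull, smul_add, Finset.sum_add_distrib]

theorem pull_map (J : Matrix (Fin n) (Fin n) ℝ) (L : A →ₗ[ℝ] B) (T : (Fin ℓ → Fin n) → A)
    (a : Fin ℓ → Fin n) : pull J (fun b => L (T b)) a = L (pull J T a) := by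
  simp only [pull, map_sum, map_smul]

theorem pull_comp_perm (J : Matrix (Fin n) (Fin n) ℝ) (S : (Fin ℓ → Fin n) → A)
    (π : Equiv.Perm (Fin ℓ)) (a : Fin ℓ → Fin n) :
    pull J S (a ∘ π) = pull J (fun b => S (b ∘ π)) a := by
  simp only [pull]
  rw [← Equiv.sum_comp (Equiv.arrowCongr π.symm (Equiv.refl (Fin n)))]
  refine Finset.sum_congr rfl fun b _ => ?_
  have h : (Equiv.arrowCongr π.symm (Equiv.refl (Fin n))) b = b ∘ π := by
    funext i; simp [Equiv.arrowCongr]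
  rw [h]
  congr 1
  exact Equiv.prod_comp π fun i => J (b i) (a i)

/-- The same matrix acts on every slot, so its action commutes with permuting the slots. -/
theorem alt_pull (J : Matrix (Fin n) (Fin n) ℝ) (S : (Fin ℓ → Fin n) → A) :
    alt (pull J S) = pull J (alt S) := by
  funext a
  have h : alt S = fun b => (Nat.factorial ℓ : ℝ)⁻¹ • ∑ π : Equiv.Perm (Fin ℓ),
    ((Equiv.Perm.sign π : ℤ) : ℝ) • S (b ∘ π) := rfl
  rw [h, alt]
  simp only [pull_comp_perm]
  simp only [pull, Finset.smul_sum]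
  rw [Finset.sum_comm]
  refine Finset.sum_congr rfl fun b _ => Finset.sum_congr rfl fun π _ => ?_
  rw [smul_comm _ (∏ i, J (b i) (a i)), smul_comm _ (∏ i, J (b i) (a i))]

theorem IsSkew.pull {S : (Fin ℓ → Fin n) → A} (hS : IsSkew S) (J : Matrix (Fin n) (Fin n) ℝ) :
    IsSkew (pull J S) := by
  rw [← alt_eq_self hS, ← alt_pull]
  exact alt_isSkew _

theorem sum_cons (f : (Fin (ℓ + 1) → Fin n) → A) :
    ∑ b, f b = ∑ e, ∑ b : Fin ℓ → Fin n, f (Fin.cons e b) := by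
  rw [← (Fin.consEquiv (fun _ => Fin n)).sum_comp, Fintype.sum_prod_type]
  rfl

theorem pull_cons (J : Matrix (Fin n) (Fin n) ℝ) (U : (Fin (ℓ + 1) → Fin n) → A)
    (c : Fin n) (a : Fin ℓ → Fin n) :
    pull J U (Fin.cons c a) = ∑ e, J e c • pull J (fun b => U (Fin.cons e b)) a := by
  simp only [pull]
  rw [sum_cons]
  refine Finset.sum_congr rfl fun e _ => ?_
  rw [Finset.smul_sum]
  refine Finset.sum_congr rfl fun b _ => ?_
  rw [Fin.prod_univ_succ, smul_smul]
  simp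

end antisymmetrization

/-! ### Tractor-valued forms in local coordinates -/

section localForms

variable {n : ℕ} {M : Type*} [TopologicalSpace M] [ChartedSpace (EuclideanSpace ℝ (Fin n)) M]
  [IsManifold (𝓡 n) ∞ M] {p p' q : M} {k : ℕ}

/-- The components at `q`, in the preferred chart of `p`, of a tractor-valued form. -/
def loc (p : M) (F : TFormField n M k) (q : M) : TForm n k := fun a =>
  tjac q p q * pull (jac p q q) (F q) a * (tjac q p q).transpose

theorem pull_conj (J : Matrix (Fin n) (Fin n) ℝ) (T : TMat n) (S : TForm n k)
    (a : Fin k → Fin n) :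
    pull J (fun b => T * S b * T.transpose) a = T * pull J S a * T.transpose := by
  simp only [pull, Matrix.mul_sum, Matrix.sum_mul, Matrix.mul_smul, Matrix.smul_mul]

theorem conj_conj (T T' S : TMat n) :
    T * (T' * S * T'.transpose) * T.transpose = T * T' * S * (T * T').transpose := by
  simp only [Matrix.transpose_mul, Matrix.mul_assoc]

theorem loc_self (F : TFormField n M k) (q : M) : loc q F q = F q := by
  funext a
  rw [loc, tjac_self (self_mem_dom q), jac_self (self_mem_dom q), pull_one]
  simp

/-- Cocycle property of `jac` and `tjac`. Each value `F q` is stored in the chart of `q`;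
differentiation uses `loc p F`, all of whose values refer to the chart of `p`. -/
theorem loc_transform (hp : q ∈ dom n p) (hp' : q ∈ dom n p') (F : TFormField n M k)
    (a : Fin k → Fin n) :
    loc p F q a = tjac p' p q * pull (jac p p' q) (loc p' F q) a * (tjac p' p q).transpose := by
  have h1 : loc p' F q = fun b =>
    tjac q p' q * pull (jac p' q q) (F q) b * (tjac q p' q).transpose := rfl
  rw [h1, pull_conj, conj_conj, tjac_mul (self_mem_dom q) hp' hp, pull_pull,
    jac_mul hp hp' (self_mem_dom q)]
  rfl

theorem emb_mul_mul (A : Matrix (Fin n) (Fin n) ℝ) (S : TMat n) (i j : Option (Fin n)) :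
    (emb A * S * (emb A).transpose) i j =
      match i, j with
      | some b, some c => ∑ b', ∑ c', A b b' * A c c' * S (some b') (some c')
      | some b, none => ∑ b', A b b' * S (some b') none
      | none, some c => ∑ c', A c c' * S none (some c')
      | none, none => S none none := by
  rcases i with _ | b <;> rcases j with _ | c <;>
    simp only [Matrix.mul_apply, Matrix.transpose_apply, Fintype.sum_option, emb, zero_mul, mul_zero,
      Finset.sum_const_zero, zero_add, add_zero, one_mul, mul_one, Finset.sum_mul, mul_assoc]
  · exact Finset.sum_congr rfl fun _ _ => mul_comm _ _
  · rw [Finset.sum_comm]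
    refine Finset.sum_congr rfl fun _ _ => Finset.sum_congr rfl fun _ _ => ?_
    ring

theorem tjac_mul_mul (p p' z : M) (S : TMat n) :
    tjac p p' z * S * (tjac p p' z : TMat n).transpose =
      (|(jac p p' z : Matrix (Fin n) (Fin n) ℝ).det| ^ ((-2 : ℝ) / (n + 1))) •
        (emb (jac p p' z) * S * (emb (jac p p' z)).transpose) := by
  simp only [tjac, Matrix.transpose_smul, Matrix.smul_mul, Matrix.mul_smul, smul_smul]
  congr 1
  have hn : (-1 / ((n : ℝ) + 1)) + (-1 / ((n : ℝ) + 1)) = -2 / (n + 1) := by ring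
  -- The determinant is not assumed non-zero here; for a base that may vanish, adding exponents
  -- requires the total exponent to be non-zero.
  rw [← Real.rpow_add' (abs_nonneg _), hn]
  rw [hn]
  exact div_ne_zero (by norm_num) (by positivity)

theorem loc_some_some (F : TFormField n M k) (p q : M) (a : Fin k → Fin n) (b c : Fin n) :
    loc p F q a (some b) (some c) = inChart (-2) (sigma F) p q a ![b, c] := by
  rw [loc, tjac_mul_mul, Matrix.smul_apply, emb_mul_mul, inChart]
  simp only [smul_eq_mul, pull, Matrix.sum_apply, Matrix.smul_apply]
  congr 1
  have h : ∀ f : (Fin 2 → Fin n) → ℝ, ∑ c', f c' = ∑ d, ∑ e, f ![d, e] := by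
    intro f
    rw [sum_cons]
    refine Finset.sum_congr rfl fun d _ => ?_
    rw [sum_cons]
    refine Finset.sum_congr rfl fun e _ => ?_
    rw [Fintype.sum_unique]
    exact congr_arg f (by funext i; fin_cases i <;> rfl)
  simp only [h, Finset.mul_sum, Fin.prod_univ_two]
  rw [Finset.sum_comm]
  simp only [Finset.sum_comm (s := (Finset.univ : Finset (Fin k → Fin n)))]
  rw [Finset.sum_comm]
  refine Finset.sum_congr rfl fun d _ => Finset.sum_congr rfl fun e _ =>
    Finset.sum_congr rfl fun b' _ => ?_
  simp [sigma]
  ring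

theorem loc_some_none (F : TFormField n M k) (p q : M) (a : Fin k → Fin n) (c : Fin n) :
    2 * loc p F q a (some c) none = inChart (-2) (rho F) p q a ![c] := by
  rw [loc, tjac_mul_mul, Matrix.smul_apply, emb_mul_mul, inChart]
  simp only [smul_eq_mul, pull, Matrix.sum_apply, Matrix.smul_apply]
  rw [mul_left_comm]
  congr 1
  have h : ∀ f : (Fin 1 → Fin n) → ℝ, ∑ c', f c' = ∑ d, f ![d] := by
    intro f
    rw [sum_cons]
    refine Finset.sum_congr rfl fun d _ => ?_
    rw [Fintype.sum_unique]
    exact congr_arg f (by funext i; fin_cases i; rfl)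
  simp only [h, Finset.mul_sum, Fin.prod_univ_one]
  rw [Finset.sum_comm]
  refine Finset.sum_congr rfl fun b' _ => Finset.sum_congr rfl fun d _ => ?_
  simp [rho]
  ring

theorem loc_none_none (F : TFormField n M k) (p q : M) (a : Fin k → Fin n) :
    loc p F q a none none = inChart (-2) (nu F) p q a ![] := by
  rw [loc, tjac_mul_mul, Matrix.smul_apply, emb_mul_mul, inChart]
  simp only [smul_eq_mul, pull, Matrix.sum_apply, Matrix.smul_apply]
  simp [nu]

theorem IsSkewSymm.loc {F : TFormField n M k} (h : IsSkewSymm (F q)) (p : M) :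
    IsSkewSymm (loc p F q) := by
  have hs : IsSkew (F q) := h.1
  constructor
  · intro π a
    simp only [ProjectiveTractor.loc]
    rw [hs.pull (jac p q q) π a, Matrix.mul_smul, Matrix.smul_mul]
  · intro a
    have h2 : (pull (jac p q q) (F q) a).IsSymm := by
      simp only [Matrix.IsSymm, pull, Matrix.transpose_sum, Matrix.transpose_smul]
      exact Finset.sum_congr rfl fun b _ => by rw [h.2 b]
    simp only [Matrix.IsSymm, ProjectiveTractor.loc, Matrix.transpose_mul, Matrix.transpose_transpose,
      Matrix.mul_assoc]
    rw [h2]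

/-- Tractor-valued forms that are smooth near `q`. -/
structure IsTractorFormAt (F : TFormField n M k) (q : M) : Prop where
  skewSymm : ∀ᶠ z in nhds q, IsSkewSymm (F z)
  smooth : ∀ a, MatSmoothAt n (fun z => loc q F z a) q

theorem smoothAt_pull_prod (hp : q ∈ dom n p) (hp' : q ∈ dom n p') (b a : Fin k → Fin n) :
    SmoothAt n (fun z => ∏ i, jac p p' z (b i) (a i)) q :=
  smoothAt_prod fun i _ => smoothAt_jac hp hp' (b i) (a i)

theorem matSmoothAt_pull (hp : q ∈ dom n p) (hp' : q ∈ dom n p') {S : M → TForm n k}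
    (hS : ∀ a, MatSmoothAt n (fun z => S z a) q) (a : Fin k → Fin n) :
    MatSmoothAt n (fun z => pull (jac p p' z) (S z) a) q :=
  MatSmoothAt.sum fun b _ => (hS b).smul (smoothAt_pull_prod hp hp' b a)

theorem eventually_loc_transform (hp : q ∈ dom n p) (hp' : q ∈ dom n p') (F : TFormField n M k)
    (a : Fin k → Fin n) :
    (fun z => loc p F z a) =ᶠ[nhds q] fun z =>
      tjac p' p z * pull (jac p p' z) (loc p' F z) a * (tjac p' p z).transpose := by
  filter_upwards [dom_mem_nhds hp, dom_mem_nhds hp'] with z hz hz'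
  exact loc_transform hz hz' F a

theorem matSmoothAt_loc_of (hp : q ∈ dom n p) (hp' : q ∈ dom n p') {F : TFormField n M k}
    (h : ∀ a, MatSmoothAt n (fun z => loc p' F z a) q) (a : Fin k → Fin n) :
    MatSmoothAt n (fun z => loc p F z a) q :=
  (((matSmoothAt_tjac hp' hp).mul (matSmoothAt_pull hp hp' h a)).mul
    (matSmoothAt_tjac hp' hp).transpose).congr (eventually_loc_transform hp hp' F a)

theorem IsTractorFormAt.matSmoothAt {F : TFormField n M k} (h : IsTractorFormAt F q)
    (hp : q ∈ dom n p) (a : Fin k → Fin n) : MatSmoothAt n (fun z => loc p F z a) q :=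
  matSmoothAt_loc_of hp (self_mem_dom q) h.smooth a

/-- The entries of `loc` are the chart components of the three slots, up to the factor two in `ρ`;
the remaining entries come from symmetry, known on a neighbourhood since `U` is open. At each point
it is enough to test in that point's own chart. -/
theorem isTractorFormOn_iff {F : TFormField n M k} {U : Set M} (hU : IsOpen U) :
    IsTractorFormOn F U ↔ ∀ q ∈ U, IsTractorFormAt F q := by
  constructor
  · intro h q hq
    have hn : ∀ p : M, q ∈ dom n p → dom n p ∩ U ∈ nhds q := fun p hp =>
      Filter.inter_mem (dom_mem_nhds hp) (hU.mem_nhds hq)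
    refine ⟨(hU.mem_nhds hq : U ∈ nhds q) |> fun h' => Filter.mem_of_superset h' h.skewSymm, ?_⟩
    have h3 : ∀ a c, SmoothAt n (fun z => loc q F z a (some c) none) q := by
      intro a c
      have h1 : (fun z => loc q F z a (some c) none) =
          fun z => 1 / 2 * inChart (-2) (rho F) q z a ![c] := by
        funext z; rw [← loc_some_none]; ring
      rw [h1]
      exact (smoothAt_const _).fun_mul
        ((h.smooth_rho q a ![c]).contMDiffAt (hn q (self_mem_dom q)))
    intro a i j
    rcases i with _ | b <;> rcases j with _ | c
    · simp only [loc_none_none]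
      exact (h.smooth_nu q a ![]).contMDiffAt (hn q (self_mem_dom q))
    · refine (h3 a c).congr_of_eventuallyEq ?_
      filter_upwards [hU.mem_nhds hq] with z hz
      exact congr_fun (congr_fun (((h.skewSymm z hz).loc q).2 a) (some c)) none
    · exact h3 a b
    · simp only [loc_some_some]
      exact (h.smooth_sigma q a ![b, c]).contMDiffAt (hn q (self_mem_dom q))
  · intro h
    refine ⟨fun q hq => (h q hq).skewSymm.self_of_nhds, fun p a c q hq => ?_, fun p a c q hq => ?_,
      fun p a c q hq => ?_⟩
    · have h1 := (h q hq.2).matSmoothAt hq.1 a (some (c 0)) (some (c 1))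
      simp only [loc_some_some] at h1
      have h2 : ![c 0, c 1] = c := by funext i; fin_cases i <;> rfl
      rw [h2] at h1
      exact h1.contMDiffWithinAt
    · have h1 := (smoothAt_const (n := n) (q := q) 2).fun_mul
        ((h q hq.2).matSmoothAt hq.1 a (some (c 0)) none)
      simp only [loc_some_none] at h1
      have h2 : ![c 0] = c := by funext i; fin_cases i; rfl
      rw [h2] at h1
      exact h1.contMDiffWithinAt
    · have h1 := (h q hq.2).matSmoothAt hq.1 a none none
      simp only [loc_none_none] at h1
      have h2 : ![] = c := Subsingleton.elim _ _
      rw [h2] at h1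
      exact h1.contMDiffWithinAt

/-! ### The exterior covariant derivative in local coordinates -/

/-- The exterior covariant derivative, in the preferred chart of `p`, with connection matrices `γ`. -/
def lextD (p : M) (γ : M → Fin n → TMat n) (S : M → TForm n k) (q : M) : TForm n (k + 1) :=
  alt fun a => mdc p (fun z => S z (Fin.tail a)) q (a 0) + act (γ q (a 0)) (S q (Fin.tail a))

theorem lextD_congr (hq : q ∈ dom n p) {γ γ' : M → Fin n → TMat n} {S S' : M → TForm n k}
    (hγ : γ q = γ' q) (hS : S =ᶠ[nhds q] S') : lextD p γ S q = lextD p γ' S' q := by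
  simp only [lextD]
  congr 1
  funext a
  rw [hγ, hS.self_of_nhds, mdc_congr hq (B := fun z => S' z (Fin.tail a))
    (hS.mono fun z hz => by simp only [hz])]

/-- Conjugation by a matrix as a linear map. -/
def conjL (g : TMat n) : TMat n →ₗ[ℝ] TMat n where
  toFun S := g * S * g.transpose
  map_add' S T := by rw [Matrix.mul_add, Matrix.add_mul]
  map_smul' r S := by simp

theorem conjL_apply (g S : TMat n) : conjL g S = g * S * g.transpose := rfl

/-- Covariance under a gauge transformation `g`: the hypothesis on `γ'` is the transformation law of
a connection form, multiplied by `g` on the right so that no inverse occurs. It serves for changes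
of chart and changes of splitting alike. -/
theorem lextD_gauge (hq : q ∈ dom n p) {γ γ' : M → Fin n → TMat n} {g : M → TMat n}
    {S : M → TForm n k} (hg : MatSmoothAt n g q) (hS : ∀ a, MatSmoothAt n (fun z => S z a) q)
    (hγ : ∀ a, γ' q a * g q = g q * γ q a - mdc p g q a) (a : Fin (k + 1) → Fin n) :
    lextD p γ' (fun z a => g z * S z a * (g z).transpose) q a =
      g q * lextD p γ S q a * (g q).transpose := by
  rw [← conjL_apply]
  simp only [lextD]
  rw [← alt_map]
  congr 1
  funext a
  rw [mdc_mul hq (hg.mul (hS _)) hg.transpose, mdc_mul hq hg (hS _), mdc_transpose, conjL_apply]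
  have h1 : mdc p g q (a 0) = g q * γ q (a 0) - γ' q (a 0) * g q := by rw [hγ]; abel
  rw [h1]
  simp only [act, Matrix.transpose_sub, Matrix.transpose_mul]
  noncomm_ring

theorem lextD_pull (hp : q ∈ dom n p) (hp' : q ∈ dom n p') {γ : M → Fin n → TMat n}
    {S : M → TForm n k} (hS : ∀ a, MatSmoothAt n (fun z => S z a) q) :
    lextD p (pullConn p p' γ) (fun z => pull (jac p p' z) (S z)) q =
      pull (jac p p' q) (lextD p' γ S q) := by
  simp only [lextD]
  rw [← alt_pull]
  -- `Z i` collects the terms in which the Jacobian factor of slot `i` is differentiated. They are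
  -- symmetric in the derivative index and that slot, so antisymmetrization kills them.
  set Z : Fin k → (Fin (k + 1) → Fin n) → TMat n := fun i a => ∑ b : Fin k → Fin n,
    ((∏ j ∈ Finset.univ.erase i, jac p p' q (b j) (a j.succ)) *
      dc p (fun z => jac p p' z (b i) (a i.succ)) q (a 0)) • S q b with hZ
  have h0 : ∀ i, alt (Z i) = 0 := by
    intro i
    refine alt_eq_zero_of_swap (Fin.succ_ne_zero i).symm fun a => ?_
    simp only [hZ]
    refine Finset.sum_congr rfl fun b _ => ?_
    congr 1
    simp only [Function.comp_apply, Equiv.swap_apply_left, Equiv.swap_apply_right]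
    rw [dc_jac_comm hp hp']
    congr 1
    refine Finset.prod_congr rfl fun j hj => ?_
    rw [Equiv.swap_apply_of_ne_of_ne (Fin.succ_ne_zero j)
      (fun e => (Finset.ne_of_mem_erase hj) (Fin.succ_injective _ e))]
  have h1 : (fun a : Fin (k + 1) → Fin n =>
      mdc p (fun z => pull (jac p p' z) (S z) (Fin.tail a)) q (a 0) +
        act (pullConn p p' γ q (a 0)) (pull (jac p p' q) (S q) (Fin.tail a))) =
      fun a => (∑ i, Z i a) + pull (jac p p' q) (fun a : Fin (k + 1) → Fin n =>
        mdc p' (fun z => S z (Fin.tail a)) q (a 0) + act (γ q (a 0)) (S q (Fin.tail a))) a := by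
    funext a
    obtain ⟨c, a, rfl⟩ : ∃ c a', a = Fin.cons c a' := ⟨a 0, Fin.tail a, (Fin.cons_self_tail a).symm⟩
    rw [pull_cons]
    simp only [Fin.tail_cons, Fin.cons_zero, hZ, Fin.cons_succ]
    have e1 : mdc p (fun z => pull (jac p p' z) (S z) a) q c =
        ∑ b : Fin k → Fin n, (dc p (fun z => ∏ i, jac p p' z (b i) (a i)) q c • S q b +
          (∏ i, jac p p' q (b i) (a i)) • mdc p (fun z => S z b) q c) := by
      rw [show (fun z => pull (jac p p' z) (S z) a) = fun z => ∑ b : Fin k → Fin n,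
        (∏ i, jac p p' z (b i) (a i)) • S z b from rfl,
        mdc_sum hp (fun b _ => (hS b).smul (smoothAt_pull_prod hp hp' b a))]
      refine Finset.sum_congr rfl fun b _ => ?_
      rw [mdc_smul hp (smoothAt_pull_prod hp hp' b a) (hS b)]
    rw [e1, Finset.sum_add_distrib, add_assoc]
    congr 1
    · rw [Finset.sum_comm]
      refine Finset.sum_congr rfl fun b _ => ?_
      rw [dc_prod hp (fun i _ => smoothAt_jac hp hp' (b i) (a i)), Finset.sum_smul]
    · simp only [pull, pullConn, act, Matrix.mul_sum, Matrix.sum_mul, Matrix.transpose_sum,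
        Matrix.transpose_smul, Matrix.smul_mul, Matrix.mul_smul, smul_add, Finset.smul_sum,
        Finset.sum_add_distrib]
      congr 1
      · rw [Finset.sum_comm]
        refine Finset.sum_congr rfl fun b _ => ?_
        rw [mdc_chain hp hp' (hS b), Finset.smul_sum]
        exact Finset.sum_congr rfl fun e _ => smul_comm _ _ _
      · congr 1
        rw [Finset.sum_comm]
        exact Finset.sum_congr rfl fun e _ => Finset.sum_congr rfl fun b _ => smul_comm _ _ _
  rw [h1]
  funext a
  rw [alt_add, alt_sum]
  simp [h0]

variable {D : AffineConnection n M}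

/-- The three slots assembled into one matrix equation. Each tractor index has weight `-1`, so the
two together account for the weight `-2` of the slots; the Christoffel symbols of the form indices
stay separate. -/
theorem covTractor_eq [T2Space M] (hD : IsSmoothTorsionFree D) {F : TFormField n M k}
    (hF : IsTractorFormAt F q) (c : Fin n) (a : Fin k → Fin n) :
    covTractor D F q c a = mdc q (fun z => loc q F z a) q c + act (lgam D q q c) (F q a)
      - ∑ i, ∑ e, chr D q q c e (a i) • F q (Function.update a i e) := by
  have hsym : ∀ a, (F q a).IsSymm := hF.skewSymm.self_of_nhds.2
  have hs : ∀ a i j, F q a i j = F q a j i := fun a i j => congr_fun (congr_fun (hsym a) j) i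
  have hσ : ∀ b d, pd (fun z => inChart (-2) (sigma F) q z a ![b, d]) q c =
      dc q (fun z => loc q F z a (some b) (some d)) q c := by
    intro b d
    have h1 := hF.smooth a (some b) (some d)
    simp only [loc_some_some] at h1 ⊢
    exact pd_eq_dc h1 c
  have hρ : ∀ b, pd (fun z => inChart (-2) (rho F) q z a ![b]) q c =
      2 * dc q (fun z => loc q F z a (some b) none) q c := by
    intro b
    have h1 := (smoothAt_const (n := n) (q := q) 2).fun_mul (hF.smooth a (some b) none)
    rw [← dc_const_mul (self_mem_dom q) (hF.smooth a (some b) none)]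
    simp only [loc_some_none] at h1 ⊢
    exact pd_eq_dc h1 c
  have hν : pd (fun z => inChart (-2) (nu F) q z a ![]) q c =
      dc q (fun z => loc q F z a none none) q c := by
    have h1 := hF.smooth a none none
    simp only [loc_none_none] at h1 ⊢
    exact pd_eq_dc h1 c
  have hsd : ∀ b, dc q (fun z => loc q F z a none (some b)) q c =
      dc q (fun z => loc q F z a (some b) none) q c := by
    intro b
    refine dc_congr (self_mem_dom q) ?_ c
    filter_upwards [hF.skewSymm] with z hz
    exact congr_fun (congr_fun ((hz.loc q).2 a) (some b)) none
  have hP : ∀ d, schouten D q c d = lschouten D q q c d := fun d => schouten_eq hD q c d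
  have hchr : ∀ e c d, christoffel D q q e c d = chr D q q c e d := fun _ _ _ => rfl
  have htr : ∑ e, chr D q q c e e = (chr D q q c).trace := rfl
  have h2 : ∀ x y : ℝ, x * (2 * y) = 2 * (x * y) := fun x y => mul_left_comm x 2 y
  ext i j
  simp only [covTractor, Matrix.add_apply, Matrix.sub_apply, Matrix.sum_apply, Matrix.smul_apply,
    smul_eq_mul]
  rcases i with _ | b <;> rcases j with _ | d
  · simp only [ofSlots, cov, hν]
    simp [act, Matrix.mul_apply, Fintype.sum_option, lgam, connMatrix, nu, mdc, hP, hchr, htr]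
    ring
  · simp only [ofSlots, cov, hρ]
    simp [act, Matrix.mul_apply, Fintype.sum_option, lgam, connMatrix, rho, mdc, hP, hsd,
      hs _ none (some _), hchr, htr, mul_sub, Finset.sum_sub_distrib, h2, ← Finset.mul_sum]
    simp only [mul_comm (F q a (some _) none)]
    ring
  · simp only [ofSlots, cov, hρ]
    simp [act, Matrix.mul_apply, Fintype.sum_option, lgam, connMatrix, rho, mdc, hP,
      hchr, htr, sub_mul, Finset.sum_sub_distrib, h2, ← Finset.mul_sum]
    ring
  · simp only [ofSlots, cov, hσ]
    simp [act, Matrix.mul_apply, Fintype.sum_option, lgam, connMatrix, sigma, mdc,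
      hchr, htr, sub_mul, mul_sub, Finset.sum_sub_distrib]
    simp only [mul_comm (F q a (some _) (some _))]
    ring

theorem loc_extD [T2Space M] (hD : IsSmoothTorsionFree D) {F : TFormField n M k}
    (hF : IsTractorFormAt F q) (hp : q ∈ dom n p) :
    loc p (extD D F) q = lextD p (lgam D p) (loc p F) q := by
  have hq := self_mem_dom (n := n) q
  have h1 : extD D F q = lextD q (lgam D q) (loc q F) q := by
    simp only [extD, lextD, loc_self]
    funext a
    simp only [covTractor_eq hD hF]
    rw [alt_sub]
    -- Without torsion the Christoffel terms of the form indices are symmetric in the derivative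
    -- index and the corrected slot, and disappear from `d^∇`.
    have h0 : alt (fun b : Fin (k + 1) → Fin n => ∑ i, ∑ e, chr D q q (b 0) e (Fin.tail b i) •
        F q (Function.update (Fin.tail b) i e)) a = 0 := by
      rw [alt_sum]
      refine Finset.sum_eq_zero fun i _ => ?_
      refine congr_fun (alt_eq_zero_of_swap (Fin.succ_ne_zero i).symm fun b => ?_) a
      refine Finset.sum_congr rfl fun e _ => ?_
      rw [comp_swap_eq_cons]
      simp only [Fin.cons_zero, Fin.tail_cons, Function.update_self, Function.update_idem]
      rw [chr_symm hD hq]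
      rfl
    rw [h0, sub_zero]
  -- The local formula in the chart of `q` is carried to that of `p` by a pullback of the form
  -- indices followed by the gauge transformation `tjac q p`.
  have h2 : lextD p (lgam D p) (loc p F) q = lextD p (lgam D p)
      (fun z a => tjac q p z * pull (jac p q z) (loc q F z) a * (tjac q p z).transpose) q := by
    refine lextD_congr hp rfl ?_
    filter_upwards [dom_mem_nhds hp, dom_mem_nhds hq] with z hz hz'
    funext a
    exact loc_transform hz hz' F a
  funext a
  rw [h2, lextD_gauge hp (matSmoothAt_tjac hq hp) (matSmoothAt_pull hp hq hF.smooth)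
    (γ := pullConn p q (lgam D q)), lextD_pull hp hq hF.smooth, ← h1]
  · rfl
  · intro a
    rw [lgam_transform hD hp hq, mdc_inverse hp (matSmoothAt_tjac hp hq) (matSmoothAt_tjac hq hp)]
    · rw [Matrix.add_mul, Matrix.mul_assoc _ (tjac p q q), tjac_mul_tjac hq hp, Matrix.mul_one,
        sub_neg_eq_add]
    · filter_upwards [dom_mem_nhds hp, dom_mem_nhds hq] with z hz hz'
      exact tjac_mul_tjac hz hz'

end localForms

/-! ### Properties of the exterior covariant derivative and the codifferential -/

section codifferential

variable {n k : ℕ}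

theorem act_iota (r : Fin n) (S : TMat n) (i j : Option (Fin n)) :
    act (iota r) S i j = (if i = none then S (some r) j else 0) +
      if j = none then S i (some r) else 0 := by
  simp only [act, iota, Matrix.add_apply, Matrix.mul_apply, Matrix.transpose_apply, Matrix.single_apply]
  rcases i with _ | i <;> rcases j with _ | j <;> simp

theorem codiff_some_some (F : TForm n (k + 1)) (a : Fin k → Fin n) (b c : Fin n) :
    codiff F a (some b) (some c) = 0 := by
  simp [codiff, Matrix.sum_apply, act_iota]

theorem codiff_some_none (F : TForm n (k + 1)) (a : Fin k → Fin n) (c : Fin n) :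
    codiff F a (some c) none = ∑ r, F (Fin.cons r a) (some c) (some r) := by
  simp [codiff, Matrix.sum_apply, act_iota]

theorem codiff_none_none (F : TForm n (k + 1)) (a : Fin k → Fin n) :
    codiff F a none none = ∑ r, (F (Fin.cons r a) (some r) none + F (Fin.cons r a) none (some r)) := by
  simp [codiff, Matrix.sum_apply, act_iota]

theorem act_add (γ S T : TMat n) : act γ (S + T) = act γ S + act γ T := by
  simp only [act, Matrix.mul_add, Matrix.add_mul]; abel

theorem act_smul (γ S : TMat n) (r : ℝ) : act γ (r • S) = r • act γ S := by
  simp [act]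

/-- `act` as a linear map in the second argument. -/
def actL (γ : TMat n) : TMat n →ₗ[ℝ] TMat n where
  toFun := act γ
  map_add' := act_add γ
  map_smul' r S := act_smul γ S r

theorem actL_apply (γ S : TMat n) : actL γ S = act γ S := rfl

theorem act_isSymm (γ : TMat n) {S : TMat n} (hS : S.IsSymm) : (act γ S).IsSymm := by
  simp only [Matrix.IsSymm, act, Matrix.transpose_add, Matrix.transpose_mul,
    Matrix.transpose_transpose]
  rw [hS, add_comm]

/-- The codifferential as a linear map. -/
def codiffL : TForm n (k + 1) →ₗ[ℝ] TForm n k where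
  toFun := codiff
  map_add' F G := by
    funext a
    simp only [codiff, Pi.add_apply, act_add, Finset.sum_add_distrib]
  map_smul' r F := by
    funext a
    simp only [codiff, Pi.smul_apply, act_smul, Finset.smul_sum, RingHom.id_apply]

theorem codiff_add (F G : TForm n (k + 1)) : codiff (F + G) = codiff F + codiff G :=
  codiffL.map_add F G

theorem codiff_sub (F G : TForm n (k + 1)) : codiff (F - G) = codiff F - codiff G :=
  codiffL.map_sub F G

theorem codiff_smul (r : ℝ) (F : TForm n (k + 1)) : codiff (r • F) = r • codiff F :=
  codiffL.map_smul r F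

theorem codiff_zero : codiff (0 : TForm n (k + 1)) = 0 := codiffL.map_zero

theorem IsSkewSymm.codiff {F : TForm n (k + 1)} (h : IsSkewSymm F) : IsSkewSymm (codiff F) := by
  constructor
  · intro π a
    simp only [ProjectiveTractor.codiff]
    rw [Finset.smul_sum]
    refine Finset.sum_congr rfl fun r _ => ?_
    rw [← cons_comp_consPerm, h.1, sign_consPerm, act_smul]
  · intro a
    simp only [ProjectiveTractor.codiff, Matrix.IsSymm, Matrix.transpose_sum]
    exact Finset.sum_congr rfl fun r _ => act_isSymm _ (h.2 _)

/-- The hypothesis says that `X^E X_F^r` is equivariant for the pair `(g, J)`. Changes of chart and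
of splitting are both of this kind. -/
theorem codiff_conj {g : TMat n} {J : Matrix (Fin n) (Fin n) ℝ}
    (h : ∀ e, ∑ r, J e r • (iota r * g) = g * iota e) (S : TForm n (k + 1)) (a : Fin k → Fin n) :
    codiff (fun b => g * pull J S b * g.transpose) a = g * pull J (codiff S) a * g.transpose := by
  have h1 : ∀ (e : Fin n) (X : TMat n), ∑ r, J e r • act (iota r) (g * X * g.transpose) =
      g * act (iota e) X * g.transpose := by
    intro e X
    have h2 : ∀ r, J e r • act (iota r) (g * X * g.transpose) =
        (J e r • (iota r * g)) * X * g.transpose + g * X * (J e r • (iota r * g)).transpose := by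
      intro r
      simp only [act, smul_add, Matrix.transpose_smul, Matrix.transpose_mul, Matrix.smul_mul,
        Matrix.mul_smul, Matrix.mul_assoc]
    simp only [h2, Finset.sum_add_distrib, ← Matrix.sum_mul, ← Matrix.mul_sum,
      ← Matrix.transpose_sum, h]
    simp only [act, Matrix.transpose_mul, Matrix.mul_add, Matrix.add_mul, Matrix.mul_assoc]
  have h3 : pull J (codiff S) a = ∑ e, act (iota e) (pull J (fun b => S (Fin.cons e b)) a) := by
    simp only [← actL_apply, ← pull_map]
    simp only [pull, codiff, Finset.smul_sum, actL_apply]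
    exact Finset.sum_comm
  have h4 : ∀ r, act (iota r) (g * pull J S (Fin.cons r a) * g.transpose) = ∑ e, J e r •
      act (iota r) (g * pull J (fun b => S (Fin.cons e b)) a * g.transpose) := by
    intro r
    rw [pull_cons, Matrix.mul_sum, Matrix.sum_mul, ← actL_apply, map_sum]
    refine Finset.sum_congr rfl fun e _ => ?_
    rw [Matrix.mul_smul, Matrix.smul_mul, map_smul, actL_apply]
  rw [h3]
  simp only [codiff, h4]
  rw [Finset.sum_comm, Matrix.mul_sum, Matrix.sum_mul]
  exact Finset.sum_congr rfl fun e _ => h1 e _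

/-- Both the elements `iota r` and the difference of `splitChange` from the identity map the
`Y`-block to the `X`-line and kill the latter, so all their products vanish. -/
theorem iota_mul_splitChange (υ : Fin n → ℝ) (r : Fin n) :
    iota r * splitChange υ = splitChange υ * iota r := by
  simp only [iota, splitChange, Matrix.mul_sub, Matrix.sub_mul, Matrix.mul_sum, Matrix.sum_mul,
    Matrix.mul_one, Matrix.one_mul]
  congr 1
  refine Finset.sum_congr rfl fun a _ => ?_
  rw [Matrix.mul_smul, Matrix.smul_mul, Matrix.single_mul_single_of_ne _ _ _ _ (by simp),
    Matrix.single_mul_single_of_ne _ _ _ _ (by simp)]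

theorem codiff_splitChange (υ : Fin n → ℝ) (S : TForm n (k + 1)) (a : Fin k → Fin n) :
    codiff (fun b => splitChange υ * S b * (splitChange υ).transpose) a =
      splitChange υ * codiff S a * (splitChange υ).transpose := by
  have h := codiff_conj (g := splitChange υ) (J := 1) (fun e => ?_) S a
  · simpa only [pull_one] using h
  · rw [Finset.sum_eq_single e]
    · rw [Matrix.one_apply_eq, one_smul, iota_mul_splitChange]
    · intro r _ hr
      rw [Matrix.one_apply_ne hr.symm, zero_smul]
    · simp

end codifferential

/-! ### Regularity of the two operators and the square of the exterior covariant derivative. -/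

section derivatives

variable {n : ℕ} {M : Type*} [TopologicalSpace M] [ChartedSpace (EuclideanSpace ℝ (Fin n)) M]
  [IsManifold (𝓡 n) ∞ M] {p p' q : M} {k : ℕ}

/-- The contraction pairs a form index with a tangent index, so the Jacobians cancel, and the
density factors are the same on both sides. -/
theorem loc_codiff (hp : q ∈ dom n p) (F : TFormField n M (k + 1)) :
    loc p (fun z => codiff (F z)) q = codiff (loc p F q) := by
  have hq := self_mem_dom (n := n) q
  funext a
  refine (codiff_conj (g := tjac q p q) (J := jac p q q) (fun e => ?_) (F q) a).symm
  have h1 : ∀ c d : Fin n, ∑ r, jac p q q c r * jac q p q r d = if c = d then 1 else 0 := by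
    intro c d
    have := congr_fun (congr_fun (jac_mul_jac hq hp) c) d
    rw [Matrix.mul_apply, Matrix.one_apply] at this
    exact this
  ext i j
  simp only [tjac, Matrix.sum_apply, Matrix.smul_apply, Matrix.mul_smul, Matrix.smul_mul, smul_eq_mul]
  simp only [mul_left_comm _ (|(jac q p q : Matrix (Fin n) (Fin n) ℝ).det| ^ (-1 / ((n : ℝ) + 1))),
    ← Finset.mul_sum]
  congr 1
  simp only [Matrix.mul_apply, iota, Matrix.single_apply, Fintype.sum_option]
  rcases i with _ | i <;> rcases j with _ | j <;> simp [emb, h1]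

theorem loc_add (F G : TFormField n M k) (p q : M) : loc p (F + G) q = loc p F q + loc p G q := by
  funext a
  simp only [loc, Pi.add_apply]
  rw [show F q + G q = fun b => F q b + G q b from rfl, pull_add, Matrix.mul_add, Matrix.add_mul]

theorem loc_smul (r : ℝ) (F : TFormField n M k) (p q : M) : loc p (r • F) q = r • loc p F q := by
  funext a
  simp only [loc, Pi.smul_apply]
  rw [show r • F q = fun b => LinearMap.lsmul ℝ _ r (F q b) from rfl, pull_map]
  simp

theorem IsSkewSymm.add {F G : TForm n k} (hF : IsSkewSymm F) (hG : IsSkewSymm G) :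
    IsSkewSymm (F + G) :=
  ⟨fun π a => by simp only [Pi.add_apply, hF.1 π a, hG.1 π a, smul_add],
    fun a => (hF.2 a).add (hG.2 a)⟩

theorem IsSkewSymm.smul {F : TForm n k} (hF : IsSkewSymm F) (r : ℝ) : IsSkewSymm (r • F) :=
  ⟨fun π a => by simp only [Pi.smul_apply, hF.1 π a, smul_comm r], fun a => (hF.2 a).smul r⟩

theorem IsTractorFormAt.add {F G : TFormField n M k} (hF : IsTractorFormAt F q)
    (hG : IsTractorFormAt G q) : IsTractorFormAt (F + G) q := by
  refine ⟨?_, fun a => ?_⟩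
  · filter_upwards [hF.skewSymm, hG.skewSymm] with z h1 h2 using h1.add h2
  · simp only [loc_add]
    exact (hF.smooth a).add (hG.smooth a)

theorem IsTractorFormAt.smul {F : TFormField n M k} (hF : IsTractorFormAt F q) (r : ℝ) :
    IsTractorFormAt (r • F) q := by
  refine ⟨?_, fun a => ?_⟩
  · filter_upwards [hF.skewSymm] with z h1 using h1.smul r
  · simp only [loc_smul]
    exact (hF.smooth a).smul (smoothAt_const r)

theorem IsTractorFormAt.codiff {F : TFormField n M (k + 1)} (hF : IsTractorFormAt F q) :
    IsTractorFormAt (fun z => codiff (F z)) q := by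
  have hq := self_mem_dom (n := n) q
  refine ⟨?_, fun a => ?_⟩
  · filter_upwards [hF.skewSymm] with z h1 using h1.codiff
  · have h1 : MatSmoothAt n (fun z => ProjectiveTractor.codiff (loc q F z) a) q :=
      MatSmoothAt.sum fun r _ => ((MatSmoothAt.const _).mul (hF.smooth _)).add
        ((hF.smooth _).mul (MatSmoothAt.const _))
    refine h1.congr ?_
    filter_upwards [dom_mem_nhds hq] with z hz
    rw [loc_codiff hz]

theorem matSmoothAt_alt {S : M → TForm n k} (hS : ∀ a, MatSmoothAt n (fun z => S z a) q)
    (a : Fin k → Fin n) : MatSmoothAt n (fun z => alt (S z) a) q :=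
  (MatSmoothAt.sum fun _ _ => (hS _).smul (smoothAt_const _)).smul (smoothAt_const _)

theorem mdc_alt (hq : q ∈ dom n p) {S : M → TForm n k}
    (hS : ∀ a, MatSmoothAt n (fun z => S z a) q) (a : Fin k → Fin n) (c : Fin n) :
    mdc p (fun z => alt (S z) a) q c = alt (fun b => mdc p (fun z => S z b) q c) a := by
  simp only [alt]
  rw [mdc_smul hq (smoothAt_const _) (MatSmoothAt.sum fun _ _ => (hS _).smul (smoothAt_const _)),
    dc_const, zero_smul, zero_add, mdc_sum hq fun _ _ => (hS _).smul (smoothAt_const _)]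
  congr 1
  refine Finset.sum_congr rfl fun π _ => ?_
  rw [mdc_smul hq (smoothAt_const _) (hS _), dc_const, zero_smul, zero_add]

theorem MatSmoothAt.act {γ S : M → TMat n} (hγ : MatSmoothAt n γ q) (hS : MatSmoothAt n S q) :
    MatSmoothAt n (fun z => act (γ z) (S z)) q :=
  (hγ.mul hS).add (hS.mul hγ.transpose)

theorem mdc_act (hq : q ∈ dom n p) {γ S : M → TMat n} (hγ : MatSmoothAt n γ q)
    (hS : MatSmoothAt n S q) (a : Fin n) :
    mdc p (fun z => act (γ z) (S z)) q a = act (mdc p γ q a) (S q) + act (γ q) (mdc p S q a) := by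
  simp only [act]
  rw [mdc_add hq (hγ.mul hS) (hS.mul hγ.transpose), mdc_mul hq hγ hS, mdc_mul hq hS hγ.transpose,
    mdc_transpose]
  abel

theorem matSmoothAt_lextD (hq : q ∈ dom n p) {γ : M → Fin n → TMat n} {S : M → TForm n k}
    (hγ : ∀ a, MatSmoothAt n (fun z => γ z a) q) (hS : ∀ a, MatSmoothAt n (fun z => S z a) q)
    (a : Fin (k + 1) → Fin n) : MatSmoothAt n (fun z => lextD p γ S z a) q :=
  matSmoothAt_alt (fun b => ((hS _).mdc hq (b 0)).add ((hγ _).act (hS _))) a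

theorem lextD_lextD (hq : q ∈ dom n p) {γ : M → Fin n → TMat n} {S : M → TForm n k}
    (hγ : ∀ a, MatSmoothAt n (fun z => γ z a) q) (hS : ∀ a, MatSmoothAt n (fun z => S z a) q) :
    lextD p γ (lextD p γ S) q = alt fun a =>
      (1 / 2 : ℝ) • act (curv p γ q (a 0) (a 1)) (S q (Fin.tail (Fin.tail a))) := by
  set T : M → TForm n (k + 1) := fun z b =>
    mdc p (fun y => S y (Fin.tail b)) z (b 0) + act (γ z (b 0)) (S z (Fin.tail b)) with hT
  have hTs : ∀ b, MatSmoothAt n (fun z => T z b) q := fun b =>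
    ((hS _).mdc hq (b 0)).add ((hγ _).act (hS _))
  have h1 : lextD p γ (lextD p γ S) q =
      alt fun a => mdc p (fun z => T z (Fin.tail a)) q (a 0) + act (γ q (a 0)) (T q (Fin.tail a)) := by
    rw [← alt_alt_tail (fun c b => mdc p (fun z => T z b) q c + act (γ q c) (T q b))]
    have hin : lextD p γ S = fun z => alt (T z) := rfl
    rw [hin, lextD]
    congr 1
    funext a
    rw [alt_add (fun b => mdc p (fun z => T z b) q (a 0)), mdc_alt hq hTs]
    congr 1
    exact (alt_map (actL (γ q (a 0))) (T q) _).symm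
  rw [h1]
  funext a
  have h01 : (0 : Fin (k + 2)) ≠ 1 := by simp
  -- Only the part skew in the first two indices matters. There the second derivatives and the mixed
  -- terms cancel, leaving half the curvature.
  rw [alt_skew_part _ h01, alt_smul]
  congr 2
  funext b
  have ht : Fin.tail (Fin.tail (b ∘ Equiv.swap 0 1)) = Fin.tail (Fin.tail b) := by
    funext i
    simp only [Fin.tail, Function.comp_apply]
    rw [Equiv.swap_apply_of_ne_of_ne]
    · exact Fin.succ_ne_zero _
    · intro h
      exact Fin.succ_ne_zero i (Fin.succ_injective _ h)
  have h2 : ∀ b : Fin (k + 2) → Fin n, mdc p (fun z => T z (Fin.tail b)) q (b 0) +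
      act (γ q (b 0)) (T q (Fin.tail b)) =
      mdc p (fun z => mdc p (fun y => S y (Fin.tail (Fin.tail b))) z (b 1)) q (b 0) +
      (act (mdc p (fun z => γ z (b 1)) q (b 0)) (S q (Fin.tail (Fin.tail b))) +
        act (γ q (b 1)) (mdc p (fun z => S z (Fin.tail (Fin.tail b))) q (b 0))) +
      (act (γ q (b 0)) (mdc p (fun y => S y (Fin.tail (Fin.tail b))) q (b 1)) +
        act (γ q (b 0)) (act (γ q (b 1)) (S q (Fin.tail (Fin.tail b))))) := by
    intro b
    have e : (Fin.tail b 0 : Fin n) = b 1 := rfl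
    simp only [hT, e]
    rw [mdc_add hq ((hS _).mdc hq _) ((hγ _).act (hS _)), mdc_act hq (hγ _) (hS _), act_add]
  simp only [h2, ht]
  simp only [Function.comp_apply, Equiv.swap_apply_left, Equiv.swap_apply_right]
  rw [mdc_comm hq (hS _) (b 1) (b 0)]
  simp only [curv, act, Matrix.transpose_add, Matrix.transpose_sub, Matrix.transpose_mul]
  noncomm_ring

variable {D : AffineConnection n M} [T2Space M]

theorem extD_eq_lextD (hD : IsSmoothTorsionFree D) {F : TFormField n M k}
    (hF : IsTractorFormAt F q) : extD D F q = lextD q (lgam D q) (loc q F) q := by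
  rw [← loc_extD hD hF (self_mem_dom q), loc_self]

theorem IsTractorFormAt.isSkewSymm_extD (hD : IsSmoothTorsionFree D) {F : TFormField n M k}
    (hF : IsTractorFormAt F q) : IsSkewSymm (extD D F q) := by
  refine ⟨alt_isSkew _, fun a => ?_⟩
  rw [extD_eq_lextD hD hF]
  simp only [lextD, Matrix.IsSymm]
  have h0 : ∀ T : TForm n (k + 1), (∀ b, (T b).transpose = T b) →
      (alt T a).transpose = alt T a := by
    intro T hT
    simp only [alt, Matrix.transpose_smul, Matrix.transpose_sum, hT]
  refine h0 _ fun b => ?_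
  rw [Matrix.transpose_add, ← mdc_transpose]
  congr 1
  · refine mdc_congr (self_mem_dom q) ?_ _
    filter_upwards [hF.skewSymm] with z hz
    exact (hz.loc q).2 _
  · exact act_isSymm _ ((hF.skewSymm.self_of_nhds.loc q).2 _)

/-- Regularity is needed at all nearby points: at each of them `extD` is defined through that
point's own chart and has to be matched with the formula in the chart of `q`. -/
theorem IsTractorFormAt.extD (hD : IsSmoothTorsionFree D) {F : TFormField n M k}
    (hF : ∀ᶠ z in nhds q, IsTractorFormAt F z) : IsTractorFormAt (extD D F) q := by
  have hq := self_mem_dom (n := n) q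
  refine ⟨?_, fun a => ?_⟩
  · filter_upwards [hF] with z hz using hz.isSkewSymm_extD hD
  · refine (matSmoothAt_lextD hq (fun a => matSmoothAt_lgam hD hq a) hF.self_of_nhds.smooth a).congr ?_
    filter_upwards [hF, dom_mem_nhds hq] with z hz hz'
    rw [loc_extD hD hz hz']

theorem extD_add (hD : IsSmoothTorsionFree D) {F G : TFormField n M k}
    (hF : IsTractorFormAt F q) (hG : IsTractorFormAt G q) :
    extD D (F + G) q = extD D F q + extD D G q := by
  rw [extD_eq_lextD hD (hF.add hG), extD_eq_lextD hD hF, extD_eq_lextD hD hG]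
  funext a
  simp only [lextD, Pi.add_apply]
  rw [← alt_add]
  congr 1
  funext b
  simp only [loc_add, Pi.add_apply]
  rw [mdc_add (self_mem_dom q) (hF.smooth _) (hG.smooth _), act_add]
  abel

theorem extD_smul (hD : IsSmoothTorsionFree D) {F : TFormField n M k}
    (hF : IsTractorFormAt F q) (r : ℝ) : extD D (r • F) q = r • extD D F q := by
  rw [extD_eq_lextD hD (hF.smul r), extD_eq_lextD hD hF]
  funext a
  simp only [lextD, Pi.smul_apply]
  rw [← alt_smul]
  congr 1
  funext b
  simp only [loc_smul, Pi.smul_apply]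
  rw [mdc_smul (self_mem_dom q) (smoothAt_const r) (hF.smooth _), act_smul, dc_const]
  simp

/-- Thus `d^∇ d^∇` is algebraic: no derivatives of `F` survive. -/
theorem extD_extD (hD : IsSmoothTorsionFree D) {F : TFormField n M k}
    (hF : ∀ᶠ z in nhds q, IsTractorFormAt F z) :
    extD D (extD D F) q = alt fun a =>
      (1 / 2 : ℝ) • act (tcurv D q q (a 0) (a 1)) (F q (Fin.tail (Fin.tail a))) := by
  have hq := self_mem_dom (n := n) q
  rw [extD_eq_lextD hD (IsTractorFormAt.extD hD hF)]
  have h1 : loc q (ProjectiveTractor.extD D F) =ᶠ[nhds q] lextD q (lgam D q) (loc q F) := by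
    filter_upwards [hF, dom_mem_nhds hq] with z hz hz'
    exact loc_extD hD hz hz'
  rw [lextD_congr hq rfl h1, lextD_lextD hq (fun a => matSmoothAt_lgam hD hq a)
    hF.self_of_nhds.smooth, loc_self]
  rfl

end derivatives

/-! ### Projective changes of connection -/

section splitChangeAlgebra

variable {n : ℕ}

theorem splitChange_apply (υ : Fin n → ℝ) (i j : Option (Fin n)) :
    splitChange υ i j = match i, j with
      | none, some d => - υ d
      | some c, some d => if c = d then 1 else 0
      | some _, none => 0
      | none, none => 1 := by
  simp only [splitChange, Matrix.sub_apply, Matrix.sum_apply, Matrix.smul_apply, Matrix.single_apply,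
    Matrix.one_apply]
  rcases i with _ | i <;> rcases j with _ | j <;> simp

theorem splitChange_mul_neg (υ : Fin n → ℝ) : splitChange υ * splitChange (fun i => - υ i) = 1 := by
  ext i j
  simp only [Matrix.mul_apply, Fintype.sum_option, splitChange_apply, Matrix.one_apply]
  rcases i with _ | i <;> rcases j with _ | j <;> simp

theorem splitChange_neg_mul (υ : Fin n → ℝ) : splitChange (fun i => - υ i) * splitChange υ = 1 := by
  simpa using splitChange_mul_neg (fun i => - υ i)

end splitChangeAlgebra

/-! ### Independence of the tractor connection from the connection in the class. -/

section projectiveChange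

variable {n : ℕ} {M : Type*} [TopologicalSpace M] [ChartedSpace (EuclideanSpace ℝ (Fin n)) M]
  [IsManifold (𝓡 n) ∞ M] {p p' q : M} {k : ℕ} {D D' : AffineConnection n M}
  {Υ : TensorField n M 1 0}

/-- The components of a one-form in the preferred chart of `p`. -/
def lform (Υ : TensorField n M 1 0) (p q : M) (a : Fin n) : ℝ := ∑ e, jac p q q e a * Υ q ![e] ![]

theorem inChart_lform (Υ : TensorField n M 1 0) (p q : M) (a : Fin n) :
    inChart 0 Υ p q ![a] ![] = lform Υ p q a := by
  have h : ∀ f : (Fin 1 → Fin n) → ℝ, ∑ c', f c' = ∑ d, f ![d] := by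
    intro f
    rw [sum_cons]
    refine Finset.sum_congr rfl fun d _ => ?_
    rw [Fintype.sum_unique]
    exact congr_arg f (by funext i; fin_cases i; rfl)
  rw [inChart, h, lform]
  simp only [Fintype.sum_unique]
  simp
  refine Finset.sum_congr rfl fun d _ => ?_
  congr 2

theorem smoothAt_lform (h : TensorSmoothOn 0 Υ Set.univ) (hq : q ∈ dom n p) (a : Fin n) :
    SmoothAt n (fun z => lform Υ p z a) q := by
  simp only [← inChart_lform]
  refine (h p ![a] ![]).contMDiffAt ?_
  rw [Set.inter_univ]
  exact dom_mem_nhds hq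

theorem chr_projectiveChange (h : IsProjectiveChange Υ D D') (hq : q ∈ dom n p) (a c b : Fin n) :
    chr D' p q a c b = chr D p q a c b + (if c = b then lform Υ p q a else 0) +
      (if c = a then lform Υ p q b else 0) := by
  have h1 := h.2 (coordField p b) q (fieldSmoothAt_coordField hq b).mdifferentiableAt (coordField p a q)
  have h2 : ∀ a : Fin n, tangentCoordChange (𝓡 n) q p q (coordField p a q) c =
      if c = a then 1 else 0 := by
    intro a
    rw [coordField_comp hq hq, jac_self hq, Matrix.one_apply]
  have h3 : ∀ a : Fin n, ∑ e, Υ q ![e] ![] * vecComp (coordField p a q) e = lform Υ p q a := by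
    intro a
    exact Finset.sum_congr rfl fun e _ => by rw [coordField_apply, mul_comm]
  rw [h3, h3] at h1
  have h4 : chr D' p q a c b = tangentCoordChange (𝓡 n) q p q
    (D' (coordField p b) q (coordField p a q)) c := rfl
  have h5 : chr D p q a c b = tangentCoordChange (𝓡 n) q p q
    (D (coordField p b) q (coordField p a q)) c := rfl
  have h6 : tangentCoordChange (𝓡 n) q p q ((D (coordField p b) q (coordField p a q)) +
      lform Υ p q a • coordField p b q + lform Υ p q b • coordField p a q) c =
      tangentCoordChange (𝓡 n) q p q (D (coordField p b) q (coordField p a q)) c +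
        lform Υ p q a * tangentCoordChange (𝓡 n) q p q (coordField p b q) c +
        lform Υ p q b * tangentCoordChange (𝓡 n) q p q (coordField p a q) c := by
    have e := (tangentCoordChange (𝓡 n) q p q).map_add
      ((D (coordField p b) q (coordField p a q)) + lform Υ p q a • coordField p b q)
      (lform Υ p q b • coordField p a q)
    have e' := (tangentCoordChange (𝓡 n) q p q).map_add
      (D (coordField p b) q (coordField p a q)) (lform Υ p q a • coordField p b q)
    have e1 := (tangentCoordChange (𝓡 n) q p q).map_smul (lform Υ p q a) (coordField p b q)
    have e2 := (tangentCoordChange (𝓡 n) q p q).map_smul (lform Υ p q b) (coordField p a q)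
    refine (congr_fun (congr_arg WithLp.ofLp (e.trans
      (congr_arg₂ (· + ·) (e'.trans (congr_arg₂ (· + ·) rfl e1)) e2))) c).trans ?_
    rfl
  rw [h4, h5, h1]
  refine h6.trans ?_
  rw [h2, h2]
  simp

theorem trace_chr_projectiveChange (h : IsProjectiveChange Υ D D') (hq : q ∈ dom n p) (a : Fin n) :
    (chr D' p q a).trace = (chr D p q a).trace + (n + 1) * lform Υ p q a := by
  simp only [Matrix.trace, Matrix.diag, chr_projectiveChange h hq, Finset.sum_add_distrib]
  simp
  ring

/-- The tractor connection matrix of `D`, transformed by the change of splitting. -/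
def changedGam (D : AffineConnection n M) (Υ : TensorField n M 1 0) (p z : M) (a : Fin n) : TMat n :=
  splitChange (lform Υ p z) * lgam D p z a * splitChange (fun i => - lform Υ p z i) +
    splitChange (lform Υ p z) * mdc p (fun y => splitChange (fun i => - lform Υ p y i)) z a

theorem matSmoothAt_splitChange {υ : M → Fin n → ℝ} (hυ : ∀ a, SmoothAt n (fun z => υ z a) q) :
    MatSmoothAt n (fun z => splitChange (υ z)) q := by
  intro i j
  simp only [splitChange_apply]
  rcases i with _ | i <;> rcases j with _ | j
  · exact smoothAt_const _
  · exact (hυ j).fun_neg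
  · exact smoothAt_const _
  · exact smoothAt_const _

theorem mdc_splitChange (hq : q ∈ dom n p) {υ : M → Fin n → ℝ}
    (hυ : ∀ a, SmoothAt n (fun z => υ z a) q) (a : Fin n) (i j : Option (Fin n)) :
    mdc p (fun z => splitChange (υ z)) q a i j = match i, j with
      | none, some d => - dc p (fun z => υ z d) q a
      | _, _ => 0 := by
  simp only [mdc, splitChange_apply, Matrix.of_apply]
  rcases i with _ | i <;> rcases j with _ | j <;> simp only [dc_const]
  exact dc_neg hq (hυ j) a

/-- In the rows indexed by tangent directions neither the derivative of `Υ` nor the Schouten tensor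
occurs, so the comparison needs only the change of the Christoffel symbols and their trace. -/
theorem changedGam_apply (h : IsProjectiveChange Υ D D') (hq : q ∈ dom n p) (a : Fin n)
    (i : Fin n) (j : Option (Fin n)) : changedGam D Υ p q a (some i) j = lgam D' p q a (some i) j := by
  have hυ := fun a => smoothAt_lform h.1 hq a
  have htr := trace_chr_projectiveChange h hq a
  simp only [changedGam, Matrix.add_apply, Matrix.mul_apply, Fintype.sum_option,
    mdc_splitChange hq (fun a => (hυ a).fun_neg), splitChange_apply]
  rcases j with _ | j
  · simp [lgam]
  · simp [lgam, chr_projectiveChange h hq, htr]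
    have hn : (n : ℝ) + 1 ≠ 0 := by positivity
    rw [add_div, mul_div_cancel_left₀ _ hn]
    split_ifs <;> ring

theorem changedGam_none_none (h : IsProjectiveChange Υ D D') (hq : q ∈ dom n p) (a : Fin n) :
    changedGam D Υ p q a none none = lgam D' p q a none none := by
  have hυ := fun a => smoothAt_lform h.1 hq a
  simp only [changedGam, Matrix.add_apply, Matrix.mul_apply, Fintype.sum_option,
    mdc_splitChange hq (fun a => (hυ a).fun_neg), splitChange_apply]
  simp [lgam, trace_chr_projectiveChange h hq]
  have hn : (n : ℝ) + 1 ≠ 0 := by positivity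
  rw [add_div, mul_div_cancel_left₀ _ hn]
  ring

/-- The change of the Schouten tensor is never computed. Both matrices agree outside the entries
`(none, some d)`, and both curvatures have trace-free Weyl block; a discrepancy `x_c` in those
entries would add `(n - 1) x_c` to the trace. -/
theorem changedGam_eq [T2Space M] (hn : 2 ≤ n) (hD : IsSmoothTorsionFree D)
    (hD' : IsSmoothTorsionFree D') (h : IsProjectiveChange Υ D D') (hq : q ∈ dom n p) (a : Fin n) :
    lgam D' p q a = changedGam D Υ p q a := by
  have hυ := fun a => smoothAt_lform h.1 hq a
  -- The gauge transformation is unipotent and the torsion block vanishes, so the Weyl block of the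
  -- curvature is unchanged.
  have hK : ∀ b c d : Fin n, curv p (changedGam D Υ p) q b c (some b) (some d) =
      tcurv D p q b c (some b) (some d) := by
    intro b c d
    have e := curv_gauge hq (γ := lgam D p) (γ' := changedGam D Υ p) (g := fun z => splitChange (fun i => - lform Υ p z i))
      (h := fun z => splitChange (lform Υ p z)) (fun a => matSmoothAt_lgam hD hq a)
      (matSmoothAt_splitChange fun a => (hυ a).fun_neg) (matSmoothAt_splitChange hυ)
      (Filter.Eventually.of_forall fun z => splitChange_mul_neg _)
      (Filter.Eventually.of_forall fun z => rfl) b c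
    refine (congr_fun (congr_fun e (some b)) (some d)).trans ?_
    rw [← tcurv]
    simp only [Matrix.mul_apply, Fintype.sum_option, splitChange_apply, tcurv_some_none hD hq]
    simp
  -- In these rows the derivative terms agree. The unknown bottom row enters only through products
  -- with the Kronecker column of the connection matrix.
  have hdiff : ∀ b c i d : Fin n, curv p (changedGam D Υ p) q b c (some i) (some d) =
      tcurv D' p q b c (some i) (some d) +
        (if i = b then changedGam D Υ p q c none (some d) - lgam D' p q c none (some d) else 0) -
        (if i = c then changedGam D Υ p q b none (some d) - lgam D' p q b none (some d) else 0) := by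
    intro b c i d
    have e1 : ∀ b c i d : Fin n, mdc p (fun z => changedGam D Υ p z c) q b (some i) (some d) =
        mdc p (fun z => lgam D' p z c) q b (some i) (some d) := by
      intro b c i d
      refine dc_congr hq ?_ b
      filter_upwards [dom_mem_nhds hq] with z hz
      exact changedGam_apply h hz c i (some d)
    have e2 : ∀ b i : Fin n, changedGam D Υ p q b (some i) none = if i = b then 1 else 0 := by
      intro b i
      rw [changedGam_apply h hq]; rfl
    have e3 : ∀ b i : Fin n, lgam D' p q b (some i) none = if i = b then 1 else 0 := fun b i => rfl
    simp only [tcurv, curv, Matrix.add_apply, Matrix.sub_apply, Matrix.mul_apply, Fintype.sum_option, e1,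
      changedGam_apply h hq _ _ (some _), e2, e3]
    split_ifs <;> ring
  have hE : ∀ c d : Fin n, changedGam D Υ p q c none (some d) = lgam D' p q c none (some d) := by
    intro c d
    have h1 : ∑ b, curv p (changedGam D Υ p) q b c (some b) (some d) = 0 := by
      simp only [hK]
      exact tcurv_trace hn hD hq c d
    simp only [hdiff, Finset.sum_add_distrib, Finset.sum_sub_distrib, tcurv_trace hn hD' hq] at h1
    simp at h1
    have hn' : (2 : ℝ) ≤ n := by exact_mod_cast hn
    have h2 : ((n : ℝ) - 1) * (changedGam D Υ p q c none (some d) - lgam D' p q c none (some d)) = 0 := by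
      linarith
    rcases mul_eq_zero.1 h2 with h3 | h3
    · linarith
    · linarith
  ext i j
  rcases i with _ | i
  · rcases j with _ | j
    · exact (changedGam_none_none h hq a).symm
    · exact (hE a j).symm
  · exact (changedGam_apply h hq a i j).symm

/-- `changedGam_eq` rewritten in the inverse-free form required by `lextD_gauge`. -/
theorem lgam_mul_splitChange [T2Space M] (hn : 2 ≤ n) (hD : IsSmoothTorsionFree D)
    (hD' : IsSmoothTorsionFree D') (h : IsProjectiveChange Υ D D') (hq : q ∈ dom n p) (a : Fin n) :
    lgam D' p q a * splitChange (lform Υ p q) =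
      splitChange (lform Υ p q) * lgam D p q a - mdc p (fun z => splitChange (lform Υ p z)) q a := by
  have hυ := fun a => smoothAt_lform h.1 hq a
  rw [changedGam_eq hn hD hD' h hq, mdc_inverse hq (matSmoothAt_splitChange fun a => (hυ a).fun_neg)
    (matSmoothAt_splitChange hυ) (Filter.Eventually.of_forall fun z => splitChange_mul_neg _)]
  rw [changedGam, Matrix.add_mul, Matrix.mul_assoc _ _ (splitChange (lform Υ p q)),
    splitChange_neg_mul, Matrix.mul_one, sub_neg_eq_add]

theorem tjac_mul_splitChange (hq : q ∈ dom n p) (Υ : TensorField n M 1 0) :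
    tjac q p q * splitChange (fun i => Υ q ![i] ![]) = splitChange (lform Υ p q) * tjac q p q := by
  have h1 : ∀ d : Fin n, ∑ r, lform Υ p q r * jac q p q r d = Υ q ![d] ![] := by
    intro d
    simp only [lform, Finset.sum_mul]
    rw [Finset.sum_comm]
    have h2 : ∀ c : Fin n, ∑ r, jac p q q c r * Υ q ![c] ![] * jac q p q r d =
        if c = d then Υ q ![c] ![] else 0 := by
      intro c
      have := congr_fun (congr_fun (jac_mul_jac (self_mem_dom q) hq) c) d
      rw [Matrix.mul_apply, Matrix.one_apply] at this
      have e : ∀ r, jac p q q c r * Υ q ![c] ![] * jac q p q r d =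
        Υ q ![c] ![] * (jac p q q c r * jac q p q r d) := fun r => by ring
      simp only [e, ← Finset.mul_sum]
      rw [this]; simp
    simp [h2]
  simp only [tjac, Matrix.smul_mul, Matrix.mul_smul]
  congr 1
  ext i j
  simp only [Matrix.mul_apply, Fintype.sum_option, splitChange_apply]
  rcases i with _ | i <;> rcases j with _ | j <;> simp [emb, h1]

/-- The change of splitting of a tractor-valued form. -/
def changeSplit (Υ : TensorField n M 1 0) (F : TFormField n M k) : TFormField n M k := fun z a =>
  splitChange (fun i => Υ z ![i] ![]) * F z a * (splitChange (fun i => Υ z ![i] ![])).transpose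

theorem loc_changeSplit (hq : q ∈ dom n p) (Υ : TensorField n M 1 0) (F : TFormField n M k)
    (a : Fin k → Fin n) :
    loc p (changeSplit Υ F) q a =
      splitChange (lform Υ p q) * loc p F q a * (splitChange (lform Υ p q)).transpose := by
  simp only [loc]
  rw [show changeSplit Υ F q = fun a => splitChange (fun i => Υ q ![i] ![]) * F q a *
    (splitChange (fun i => Υ q ![i] ![])).transpose from rfl, pull_conj, conj_conj, conj_conj,
    tjac_mul_splitChange hq]

theorem IsTractorFormAt.changeSplit (h : TensorSmoothOn 0 Υ Set.univ) {F : TFormField n M k}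
    (hF : IsTractorFormAt F q) : IsTractorFormAt (changeSplit Υ F) q := by
  have hq := self_mem_dom (n := n) q
  have hs := matSmoothAt_splitChange (fun a => smoothAt_lform h hq a)
  refine ⟨?_, fun a => ?_⟩
  · filter_upwards [hF.skewSymm] with z hz
    refine ⟨fun π a => ?_, fun a => ?_⟩
    · simp only [ProjectiveTractor.changeSplit, hz.1 π a, Matrix.mul_smul, Matrix.smul_mul]
    · simp only [ProjectiveTractor.changeSplit, Matrix.IsSymm, Matrix.transpose_mul,
        Matrix.transpose_transpose, (hz.2 a).eq, Matrix.mul_assoc]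
  · refine ((hs.mul (hF.smooth a)).mul hs.transpose).congr ?_
    filter_upwards [dom_mem_nhds hq] with z hz
    exact loc_changeSplit hz Υ F a

theorem extD_changeSplit [T2Space M] (hn : 2 ≤ n) (hD : IsSmoothTorsionFree D)
    (hD' : IsSmoothTorsionFree D') (h : IsProjectiveChange Υ D D') {F : TFormField n M k}
    (hF : IsTractorFormAt F q) : extD D' (changeSplit Υ F) q = changeSplit Υ (extD D F) q := by
  have hq := self_mem_dom (n := n) q
  have hs := matSmoothAt_splitChange (fun a => smoothAt_lform h.1 hq a)
  rw [extD_eq_lextD hD' (hF.changeSplit h.1)]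
  have h1 : loc q (changeSplit Υ F) =ᶠ[nhds q] fun z a =>
      splitChange (lform Υ q z) * loc q F z a * (splitChange (lform Υ q z)).transpose := by
    filter_upwards [dom_mem_nhds hq] with z hz
    funext a
    exact loc_changeSplit hz Υ F a
  rw [lextD_congr hq rfl h1]
  funext a
  rw [lextD_gauge hq hs hF.smooth (γ := lgam D q)
    (fun a => lgam_mul_splitChange hn hD hD' h hq a), ← extD_eq_lextD hD hF]
  have h2 : lform Υ q q = fun i => Υ q ![i] ![] := by
    funext i
    rw [lform, jac_self hq]
    simp [Matrix.one_apply]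
  rw [h2]
  rfl

end projectiveChange

/-! ### The codifferential of the exterior covariant derivative -/

section traces

variable {n k : ℕ}

theorem alt_apply (T : TForm n k) (a : Fin k → Fin n) (i j : Option (Fin n)) :
    alt T a i j = alt (fun b => T b i j) a :=
  (alt_map (Matrix.entryLinearMap ℝ ℝ i j) T a).symm

theorem IsSkewSymm.cons_cons {h : TForm n (k + 2)} (hh : IsSkewSymm h) (r s : Fin n)
    (a : Fin k → Fin n) : h (Fin.cons s (Fin.cons r a)) = - h (Fin.cons r (Fin.cons s a)) := by
  have h1 := cons_comp_swap r (Fin.cons s a) (0 : Fin (k + 1))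
  rw [Fin.update_cons_zero, Fin.cons_zero] at h1
  rw [← h1, hh.1, Equiv.Perm.sign_swap (Fin.succ_ne_zero _).symm]
  simp

/-- The `ρ`-slot of an element of the image of the codifferential is trace-free. -/
theorem sum_codiff_some_none {h : TForm n (k + 2)} (hh : IsSkewSymm h) (a : Fin k → Fin n) :
    ∑ r, codiff h (Fin.cons r a) (some r) none = 0 := by
  simp only [codiff_some_none]
  have h1 : ∑ r, ∑ s, h (Fin.cons s (Fin.cons r a)) (some r) (some s) =
      - ∑ r, ∑ s, h (Fin.cons s (Fin.cons r a)) (some r) (some s) := by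
    conv_rhs => rw [Finset.sum_comm]
    rw [← Finset.sum_neg_distrib]
    refine Finset.sum_congr rfl fun r _ => ?_
    rw [← Finset.sum_neg_distrib]
    refine Finset.sum_congr rfl fun s _ => ?_
    rw [hh.cons_cons r s]
    have h2 := congr_fun (congr_fun (hh.2 (Fin.cons r (Fin.cons s a))) (some s)) (some r)
    rw [Matrix.transpose_apply] at h2
    rw [Matrix.neg_apply, h2]
  linarith

theorem update_comp_swap (a : Fin (k + 1) → Fin n) (j : Fin (k + 1)) (r : Fin n) :
    Function.update a j r ∘ Equiv.swap 0 j = Fin.cons r (Fin.tail (a ∘ Equiv.swap 0 j)) := by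
  funext i
  refine Fin.cases ?_ (fun i => ?_) i
  · simp
  · simp only [Function.comp_apply, Fin.cons_succ, Fin.tail]
    rw [Function.update_of_ne]
    intro h
    have h1 := (Equiv.swap 0 j).injective (h.trans (Equiv.swap_apply_left 0 j).symm)
    exact Fin.succ_ne_zero i h1

/-- The vanishing trace may be taken in any form slot: a transposition moves that slot to the front
at the cost of a sign. -/
theorem sum_codiff_update {h : TForm n (k + 2)} (hh : IsSkewSymm h) (a : Fin (k + 1) → Fin n)
    (j : Fin (k + 1)) : ∑ r, codiff h (Function.update a j r) (some r) none = 0 := by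
  have h1 : ∀ r, codiff h (Function.update a j r) (some r) none =
      ((Equiv.Perm.sign (Equiv.swap 0 j) : ℤ) : ℝ) *
        codiff h (Fin.cons r (Fin.tail (a ∘ Equiv.swap 0 j))) (some r) none := by
    intro r
    rw [← update_comp_swap, hh.codiff.1, Matrix.smul_apply, smul_eq_mul, ← mul_assoc, sign_mul_self,
      one_mul]
  simp only [h1, ← Finset.mul_sum, sum_codiff_some_none hh, mul_zero]

end traces

/-! ### `∂^* d^∇` on the image of `∂^*`, and `∂^* d^∇ d^∇` in terms of the Weyl and Cotton tensors.
-/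

section codiffExtD

variable {n : ℕ} {M : Type*} [TopologicalSpace M] [ChartedSpace (EuclideanSpace ℝ (Fin n)) M]
  [IsManifold (𝓡 n) ∞ M] {p p' q : M} {k : ℕ} {D : AffineConnection n M}

theorem loc_congr {F G : TFormField n M k} (h : F q = G q) (p : M) : loc p F q = loc p G q := by
  funext a
  simp only [loc, h]

theorem loc_mem_im_codiff (hp : q ∈ dom n p) {E : TFormField n M k}
    (h : ∃ h : TForm n (k + 1), IsSkewSymm h ∧ E q = codiff h) :
    ∃ h : TForm n (k + 1), IsSkewSymm h ∧ loc p E q = codiff h := by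
  obtain ⟨h, hh, he⟩ := h
  refine ⟨loc p (fun _ => h) q, IsSkewSymm.loc (F := fun _ => h) hh p, ?_⟩
  rw [← loc_codiff hp]
  exact loc_congr he p

variable [T2Space M]

theorem cov_rho_eq {F : TFormField n M k} (hF : IsTractorFormAt F q) (c d : Fin n)
    (a : Fin k → Fin n) :
    cov D (-2) (rho F) q c a ![d] = 2 * (dc q (fun z => loc q F z a (some d) none) q c
      - ∑ i, ∑ e, chr D q q c e (a i) * F q (Function.update a i e) (some d) none
      + ∑ e, chr D q q c d e * F q a (some e) none
      - 2 * ((chr D q q c).trace / (n + 1)) * F q a (some d) none) := by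
  have hρ : pd (fun z => inChart (-2) (rho F) q z a ![d]) q c =
      2 * dc q (fun z => loc q F z a (some d) none) q c := by
    have h1 := (smoothAt_const (n := n) (q := q) 2).fun_mul (hF.smooth a (some d) none)
    rw [← dc_const_mul (self_mem_dom q) (hF.smooth a (some d) none)]
    simp only [loc_some_none] at h1 ⊢
    exact pd_eq_dc h1 c
  have hchr : ∀ e c d, christoffel D q q e c d = chr D q q c e d := fun _ _ _ => rfl
  have htr : ∑ e, chr D q q c e e = (chr D q q c).trace := rfl
  have h2 : ∀ x y : ℝ, x * (2 * y) = 2 * (x * y) := fun x y => mul_left_comm x 2 y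
  simp only [cov, hρ]
  simp [rho, hchr, htr, h2, ← Finset.mul_sum]
  ring

theorem extD_cons (hD : IsSmoothTorsionFree D) {E : TFormField n M (k + 1)}
    (hE : IsTractorFormAt E q) (r : Fin n) (a : Fin (k + 1) → Fin n) :
    extD D E q (Fin.cons r a) = ((k : ℝ) + 2)⁻¹ •
      (mdc q (fun z => loc q E z a) q r + act (lgam D q q r) (E q a) -
        ∑ j, (mdc q (fun z => loc q E z (Function.update a j r)) q (a j) +
          act (lgam D q q (a j)) (E q (Function.update a j r)))) := by
  rw [extD_eq_lextD hD hE, lextD]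
  rw [alt_cons (U := fun c a => mdc q (fun z => loc q E z a) q c + act (lgam D q q c) (loc q E q a)),
    loc_self]
  · congr 2
    push_cast
    ring
  · intro c π a
    beta_reduce
    rw [loc_self, hE.skewSymm.self_of_nhds.1, act_smul, smul_add]
    congr 1
    rw [mdc_congr (self_mem_dom q) (B := fun z => ((Equiv.Perm.sign π : ℤ) : ℝ) • loc q E z a),
      mdc_smul (self_mem_dom q) (smoothAt_const _) (hE.smooth a), dc_const, zero_smul, zero_add]
    filter_upwards [hE.skewSymm] with z hz
    exact (hz.loc q).1 π a

/-- Since `σ = 0` near `q`, no derivatives enter. Contracting the Kronecker column of the connection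
gives `n + 1` from the leading index and `-1` from each of the `k + 1` slots of `E`; all other terms
are traces of `ρ`, which vanish. This leaves `n - k`. -/
theorem codiff_extD_some_none {E : TFormField n M (k + 1)}
    (hE : IsTractorFormAt E q)
    (hc : ∀ᶠ z in nhds q, ∃ h : TForm n (k + 2), IsSkewSymm h ∧ E z = codiff h)
    (hD : IsSmoothTorsionFree D) (a : Fin (k + 1) → Fin n) (c : Fin n) :
    codiff (extD D E q) a (some c) none = ((n : ℝ) - k) / (k + 2) * E q a (some c) none := by
  obtain ⟨h, hh, he⟩ := hc.self_of_nhds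
  have hs : ∀ a i j, E q a i j = E q a j i := fun a i j =>
    congr_fun (congr_fun (hE.skewSymm.self_of_nhds.2 a) j) i
  have hz : ∀ a (b c : Fin n), E q a (some b) (some c) = 0 := fun a b c => by
    rw [he, codiff_some_some]
  have hd : ∀ a (b c r : Fin n), mdc q (fun z => loc q E z a) q r (some b) (some c) = 0 := by
    intro a b c r
    rw [← dc_const q q 0 r]
    refine dc_congr (self_mem_dom q) ?_ r
    filter_upwards [hc, dom_mem_nhds (n := n) (self_mem_dom q)] with z hz hz'
    obtain ⟨h', -, he'⟩ := loc_mem_im_codiff hz' hz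
    rw [he', codiff_some_some]
  have ht : ∀ j, ∑ r, E q (Function.update a j r) (some r) none = 0 := by
    intro j
    rw [he]
    exact sum_codiff_update hh a j
  have hact : ∀ (a : Fin (k + 1) → Fin n) (s b d : Fin n),
      act (lgam D q q s) (E q a) (some b) (some d) =
      (if b = s then E q a (some d) none else 0) + if d = s then E q a (some b) none else 0 := by
    intro a s b d
    simp only [act, Matrix.add_apply, Matrix.mul_apply, Matrix.transpose_apply, Fintype.sum_option,
      hz, lgam, hs _ none (some _)]
    simp
  rw [codiff_some_none]
  simp only [extD_cons hD hE, Matrix.smul_apply, Matrix.sub_apply, Matrix.add_apply, Matrix.sum_apply,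
    hd, hact, zero_add, smul_eq_mul, ← Finset.mul_sum, Finset.sum_sub_distrib, Finset.sum_add_distrib]
  rw [Finset.sum_comm]
  have h1 : ∀ j, ∑ r, (if c = a j then E q (Function.update a j r) (some r) none else 0) = 0 := by
    intro j
    split_ifs
    · exact ht j
    · simp
  simp only [h1, Finset.sum_comm (s := (Finset.univ : Finset (Fin n))) (t := (Finset.univ : Finset (Fin (k+1))))]
  simp [Function.update_eq_self]
  have : (k : ℝ) + 2 ≠ 0 := by positivity
  field_simp
  ring

theorem codiff_extD_none_none {E : TFormField n M (k + 1)}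
    (hE : IsTractorFormAt E q)
    (hc : ∀ᶠ z in nhds q, ∃ h : TForm n (k + 2), IsSkewSymm h ∧ E z = codiff h)
    (hD : IsSmoothTorsionFree D) (a : Fin (k + 1) → Fin n) :
    codiff (extD D E q) a none none = 1 / ((k : ℝ) + 2) *
      (∑ s, cov D (-2) (rho E) q s a ![s] + 2 * ((n : ℝ) - k - 1) * E q a none none) := by
  have hq := self_mem_dom (n := n) q
  obtain ⟨h, hh, he⟩ := hc.self_of_nhds
  have hs : ∀ a i j, E q a i j = E q a j i := fun a i j =>
    congr_fun (congr_fun (hE.skewSymm.self_of_nhds.2 a) j) i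
  have hz : ∀ a (b c : Fin n), E q a (some b) (some c) = 0 := fun a b c => by
    rw [he, codiff_some_some]
  have ht : ∀ j, ∑ r, E q (Function.update a j r) (some r) none = 0 := by
    intro j
    rw [he]
    exact sum_codiff_update hh a j
  -- Only the sum over `r` vanishes, not its terms. The derivative is therefore taken outside: the
  -- trace is zero throughout a neighbourhood.
  have hd : ∀ j, ∑ r, mdc q (fun z => loc q E z (Function.update a j r)) q (a j) (some r) none = 0 := by
    intro j
    have e : ∑ r, mdc q (fun z => loc q E z (Function.update a j r)) q (a j) (some r) none =
        dc q (fun z => ∑ r, loc q E z (Function.update a j r) (some r) none) q (a j) :=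
      (dc_sum hq (fun r _ => hE.smooth _ _ _) _).symm
    rw [e, ← dc_const q q 0 (a j)]
    refine dc_congr hq ?_ _
    filter_upwards [hc, dom_mem_nhds hq] with z hz hz'
    obtain ⟨h', hh', he'⟩ := loc_mem_im_codiff hz' hz
    rw [he']
    exact sum_codiff_update hh' a j
  have hact : ∀ (a : Fin (k + 1) → Fin n) (s b : Fin n),
      act (lgam D q q s) (E q a) (some b) none =
      (if b = s then E q a none none else 0) + ∑ e, chr D q q s b e * E q a (some e) none
        - 2 * ((chr D q q s).trace / (n + 1)) * E q a (some b) none := by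
    intro a s b
    simp only [act, Matrix.add_apply, Matrix.mul_apply, Matrix.transpose_apply, Fintype.sum_option,
      hz, lgam]
    simp [sub_mul, Finset.sum_sub_distrib]
    ring
  have hsym : IsSkewSymm (extD D E q) := hE.isSkewSymm_extD hD
  have hs' : ∀ b r, extD D E q b none (some r) = extD D E q b (some r) none := fun b r =>
    congr_fun (congr_fun (hsym.2 b) (some r)) none
  rw [codiff_none_none]
  simp only [hs', ← two_mul, ← Finset.mul_sum]
  simp only [extD_cons hD hE, Matrix.smul_apply, Matrix.sub_apply, Matrix.add_apply, Matrix.sum_apply,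
    hact, smul_eq_mul, ← Finset.mul_sum, Finset.sum_sub_distrib, Finset.sum_add_distrib,
    cov_rho_eq hE]
  have hcomm : ∀ f : Fin n → Fin (k + 1) → ℝ, ∑ r, ∑ j, f r j = ∑ j, ∑ r, f r j :=
    fun f => Finset.sum_comm
  simp only [hcomm, hd, ht, ← Finset.mul_sum, mul_zero]
  -- The Christoffel terms from the tractor index, taken in direction `a j`, match the form-index
  -- corrections in the divergence, because there is no torsion.
  have h3 : ∀ j, ∑ r, ∑ e, chr D q q (a j) r e * E q (Function.update a j r) (some e) none =
      ∑ s, ∑ e, chr D q q s e (a j) * E q (Function.update a j e) (some s) none := by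
    intro j
    rw [Finset.sum_comm]
    refine Finset.sum_congr rfl fun s _ => Finset.sum_congr rfl fun e _ => ?_
    rw [chr_symm hD hq]
  simp only [h3]
  have h4 : ∀ r, (mdc q (fun z => loc q E z a) q r (some r) none : ℝ) =
    dc q (fun z => loc q E z a (some r) none) q r := fun r => rfl
  simp only [h4]
  simp [Function.update_eq_self]
  ring

/-- Only the Weyl block reaches the `σ`-entries, since the torsion block is zero. The two tractor
indices give the two terms of the symmetrization in `weylSigma`. -/
theorem codiff_extD_extD_some_none {F : TFormField n M k}
    (hF : ∀ᶠ z in nhds q, IsTractorFormAt F z) (hn : 2 ≤ n) (hD : IsSmoothTorsionFree D)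
    (a : Fin (k + 1) → Fin n) (c : Fin n) :
    codiff (extD D (extD D F) q) a (some c) none = weylSigma D F q a ![c] := by
  have hs : ∀ a i j, F q a i j = F q a j i := fun a i j =>
    congr_fun (congr_fun (hF.self_of_nhds.skewSymm.self_of_nhds.2 a) j) i
  rw [codiff_some_none, extD_extD hD hF, weylSigma]
  refine Finset.sum_congr rfl fun r _ => ?_
  rw [alt_apply, ← alt_add]
  have h2 : ∀ (T : (Fin (k + 2) → Fin n) → ℝ) b, alt T b / 2 = alt (fun b => (1 / 2 : ℝ) • T b) b :=
    fun T b => by rw [alt_smul, smul_eq_mul]; ring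
  rw [h2]
  congr 1
  funext b
  simp only [weyl_eq hn hD, sigma, Matrix.smul_apply, act, Matrix.add_apply, Matrix.mul_apply,
    Fintype.sum_option, tcurv_some_none hD (self_mem_dom q), Matrix.transpose_apply]
  simp only [Matrix.cons_val_zero, Matrix.cons_val_one, zero_mul, mul_zero, zero_add, one_div]
  rw [add_comm]
  congr 2
  · exact Finset.sum_congr rfl fun e _ => mul_comm _ _
  · exact Finset.sum_congr rfl fun e _ => by rw [hs _ (some r)]

/-- One tractor index meets the Weyl block with `ρ`, the other the lower-left block, which is minus
the Cotton tensor, with `σ`. The codifferential doubles the entry, cancelling the `1/2` in the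
square of `d^∇`. -/
theorem codiff_extD_extD_none_none {F : TFormField n M k}
    (hF : ∀ᶠ z in nhds q, IsTractorFormAt F z) (hn : 2 ≤ n) (hD : IsSmoothTorsionFree D)
    (a : Fin (k + 1) → Fin n) :
    codiff (extD D (extD D F) q) a none none = weylRhoCottonSigma D F q a := by
  have hs : ∀ a i j, F q a i j = F q a j i := fun a i j =>
    congr_fun (congr_fun (hF.self_of_nhds.skewSymm.self_of_nhds.2 a) j) i
  have hsym : IsSkewSymm (extD D (extD D F) q) :=
    (IsTractorFormAt.extD hD hF).isSkewSymm_extD hD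
  have hs' : ∀ b r, extD D (extD D F) q b none (some r) = extD D (extD D F) q b (some r) none :=
    fun b r => congr_fun (congr_fun (hsym.2 b) (some r)) none
  rw [codiff_none_none]
  simp only [hs', ← two_mul, weylRhoCottonSigma]
  refine Finset.sum_congr rfl fun r _ => ?_
  rw [extD_extD hD hF, alt_apply, ← smul_eq_mul, ← alt_smul, ← smul_eq_mul (1 / 2 : ℝ), ← alt_smul,
    ← alt_sub]
  congr 1
  funext b
  simp only [weyl_eq hn hD, cotton_eq hD, sigma, rho, Matrix.smul_apply, act, Matrix.add_apply,
    Matrix.mul_apply, Fintype.sum_option, tcurv_some_none hD (self_mem_dom q),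
    tcurv_none_none hn hD (self_mem_dom q), Matrix.transpose_apply]
  simp only [Matrix.cons_val_zero, Matrix.cons_val_one, zero_mul, mul_zero, zero_add, smul_eq_mul,
    neg_mul, Finset.sum_neg_distrib, sub_neg_eq_add, ← mul_assoc]
  simp only [mul_right_comm _ (2 : ℝ), ← Finset.sum_mul]
  have h5 : ∑ x, F q (Fin.tail (Fin.tail b)) (some r) (some x) * tcurv D q q (b 0) (b 1) none (some x) =
      ∑ x, tcurv D q q (b 0) (b 1) none (some x) * F q (Fin.tail (Fin.tail b)) (some x) (some r) :=
    Finset.sum_congr rfl fun e _ => by rw [hs _ (some r), mul_comm]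
  rw [h5]
  ring

end codiffExtD

/-! ### The normalized exterior covariant derivative -/

section normalization

variable {n : ℕ} {M : Type*} [TopologicalSpace M] [ChartedSpace (EuclideanSpace ℝ (Fin n)) M]
  [IsManifold (𝓡 n) ∞ M] [T2Space M] {q : M} {k : ℕ} {D : AffineConnection n M}

theorem cov_rho_eq_zero {E : TFormField n M k} (hE : IsTractorFormAt E q)
    (h : ∀ᶠ z in nhds q, ∀ a (c : Fin n), E z a (some c) none = 0) (c d : Fin n)
    (a : Fin k → Fin n) : cov D (-2) (rho E) q c a ![d] = 0 := by
  have h1 : dc q (fun z => loc q E z a (some d) none) q c = 0 := by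
    rw [← dc_const q q 0 c]
    refine dc_congr (self_mem_dom q) ?_ c
    filter_upwards [h] with z hz
    have h2 := loc_some_none E q z a d
    have h3 : inChart (-2) (rho E) q z a ![d] = 0 := by
      simp [inChart, rho, hz]
    linarith
  rw [cov_rho_eq hE, h1]
  simp [h.self_of_nhds]

theorem ext_of_im_codiff {v : TMat n} (hv : v.IsSymm) (h0 : ∀ b c, v (some b) (some c) = 0)
    (h1 : ∀ c, v (some c) none = 0) (h2 : v none none = 0) : v = 0 := by
  ext i j
  rcases i with _ | i <;> rcases j with _ | j
  · exact h2
  · exact (congr_fun (congr_fun hv (some j)) none).trans (h1 j)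
  · exact h1 i
  · exact h0 i j

/-- A form in the image of the codifferential whose exterior covariant derivative is coclosed
vanishes. -/
theorem eq_zero_of_codiff_extD_eq_zero (hD : IsSmoothTorsionFree D) (hk : k + 2 ≤ n)
    {E : TFormField n M (k + 1)} (hE : ∀ q, IsTractorFormAt E q)
    (hc : ∀ q, ∃ h : TForm n (k + 2), IsSkewSymm h ∧ E q = codiff h)
    (h0 : ∀ q, codiff (extD D E q) = 0) (q : M) : E q = 0 := by
  have hk' : (k : ℝ) + 2 ≤ n := by exact_mod_cast hk
  have hk2 : (k : ℝ) + 2 ≠ 0 := by positivity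
  -- The slots vanish in order: first `ρ`, then its divergence, and therefore `ν`.
  have h1 : ∀ q a (c : Fin n), E q a (some c) none = 0 := by
    intro q a c
    have h2 := codiff_extD_some_none (hE q) (Filter.Eventually.of_forall hc) hD a c
    rw [h0 q] at h2
    have h3 : ((n : ℝ) - k) / (k + 2) ≠ 0 := div_ne_zero (by linarith) hk2
    exact (mul_eq_zero.1 h2.symm).resolve_left h3
  funext a
  refine ext_of_im_codiff ((hE q).skewSymm.self_of_nhds.2 a) (fun b c => ?_) (h1 q a) ?_
  · obtain ⟨h, -, he⟩ := hc q
    rw [he, codiff_some_some]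
  · have h2 := codiff_extD_none_none (hE q) (Filter.Eventually.of_forall hc) hD a
    simp only [h0 q, cov_rho_eq_zero (hE q) (Filter.Eventually.of_forall h1), Finset.sum_const_zero,
      zero_add] at h2
    have h3 : 1 / ((k : ℝ) + 2) ≠ 0 := one_div_ne_zero hk2
    have h4 : 2 * ((n : ℝ) - k - 1) ≠ 0 := by
      have : 0 < 2 * ((n : ℝ) - k - 1) := by linarith
      exact this.ne'
    exact (mul_eq_zero.1 ((mul_eq_zero.1 h2.symm).resolve_left h3)).resolve_left h4

theorem cov_const_mul (w r : ℝ) {ℓ m : ℕ} (T : TensorField n M ℓ m) (c : Fin n)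
    (b : Fin ℓ → Fin n) (d : Fin m → Fin n) (hT : SmoothAt n (fun z => inChart w T q z b d) q) :
    cov D w (fun z b d => r * T z b d) q c b d = r * cov D w T q c b d := by
  have h1 : (fun z => inChart w (fun z b d => r * T z b d) q z b d) =
      fun z => r * inChart w T q z b d := by
    funext z
    simp only [inChart, Finset.mul_sum]
    refine Finset.sum_congr rfl fun _ _ => Finset.sum_congr rfl fun _ _ => ?_
    ring
  simp only [cov, h1]
  rw [pd_eq_dc ((smoothAt_const r).fun_mul hT), pd_eq_dc hT, dc_const_mul (self_mem_dom q) hT]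
  simp only [mul_left_comm _ r, ← Finset.mul_sum]
  ring

end normalization

/-! ### Invariant operators of the projective structure: uniqueness, existence and formula for `d̃`.
-/

namespace ProjectiveStructure

variable {n : ℕ} {M : Type*} [TopologicalSpace M] [ChartedSpace (EuclideanSpace ℝ (Fin n)) M]
  [IsManifold (𝓡 n) ∞ M] {Pr : ProjectiveStructure n M} {k : ℕ}

theorem isSmoothTorsionFree (D : Pr.conns) : IsSmoothTorsionFree D.1 :=
  ⟨Pr.smooth D.1 D.2, Pr.torsionFree D.1 D.2⟩

theorem isTractorFormAt (F : Pr.TractorForm k) (D : Pr.conns) (q : M) : IsTractorFormAt (F.1 D) q :=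
  (isTractorFormOn_iff isOpen_univ).1 (F.2.1 D) q trivial

theorem eventually_isTractorFormAt (F : Pr.TractorForm k) (D : Pr.conns) (q : M) :
    ∀ᶠ z in nhds q, IsTractorFormAt (F.1 D) z := Filter.Eventually.of_forall (isTractorFormAt F D)

theorem eq_changeSplit (F : Pr.TractorForm k) {D D' : Pr.conns} {Υ : TensorField n M 1 0}
    (h : IsProjectiveChange Υ D.1 D'.1) : F.1 D' = changeSplit Υ (F.1 D) := by
  funext p a
  exact F.2.2 D D' Υ h p a

/-- Forms from locally checked data. -/
def mkForm (F : Pr.conns → TFormField n M k) (h : ∀ D q, IsTractorFormAt (F D) q)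
    (hc : ∀ (D D' : Pr.conns) (Υ : TensorField n M 1 0), IsProjectiveChange Υ D.1 D'.1 →
      ∀ p, F D' p = changeSplit Υ (F D) p) : Pr.TractorForm k :=
  ⟨F, fun D => (isTractorFormOn_iff isOpen_univ).2 fun q _ => h D q,
    fun D D' Υ hΥ p a => congr_fun (hc D D' Υ hΥ p) a⟩

variable (Pr k) in
/-- The codifferential on tractor-valued forms. -/
def codiffT : Pr.TractorForm (k + 1) →ₗ[ℝ] Pr.TractorForm k where
  toFun F := mkForm (fun D p => codiff (F.1 D p)) (fun D q => (isTractorFormAt F D q).codiff)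
    (fun D D' Υ h p => by
      rw [eq_changeSplit F h]
      funext a
      exact codiff_splitChange _ _ a)
  map_add' F G := Subtype.ext (by funext D p; exact codiff_add _ _)
  map_smul' r F := Subtype.ext (by funext D p; exact codiff_smul _ _)

variable [T2Space M]

variable (Pr k) in
/-- The exterior covariant derivative on tractor-valued forms. -/
def extDT (hn : 2 ≤ n) : Pr.TractorForm k →ₗ[ℝ] Pr.TractorForm (k + 1) where
  toFun F := mkForm (fun D => extD D.1 (F.1 D))
    (fun D q => IsTractorFormAt.extD (isSmoothTorsionFree D) (eventually_isTractorFormAt F D q))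
    (fun D D' Υ h p => by
      rw [eq_changeSplit F h]
      exact extD_changeSplit hn (isSmoothTorsionFree D) (isSmoothTorsionFree D') h (isTractorFormAt F D p))
  map_add' F G := Subtype.ext (by
    funext D p; exact extD_add (isSmoothTorsionFree D) (isTractorFormAt F D p) (isTractorFormAt G D p))
  map_smul' r F := Subtype.ext (by
    funext D p; exact extD_smul (isSmoothTorsionFree D) (isTractorFormAt F D p) r)

theorem codiffT_apply (F : Pr.TractorForm (k + 1)) (D : Pr.conns) (p : M) :
    (codiffT Pr k F).1 D p = codiff (F.1 D p) := rfl

theorem extDT_apply (hn : 2 ≤ n) (F : Pr.TractorForm k) (D : Pr.conns) :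
    (extDT Pr k hn F).1 D = extD D.1 (F.1 D) := rfl

theorem isSkewSymm (F : Pr.TractorForm k) (D : Pr.conns) (p : M) : IsSkewSymm (F.1 D p) :=
  (isTractorFormAt F D p).skewSymm.self_of_nhds

theorem eq_zero_of_lt (F : Pr.TractorForm k) (h : n < k) : F = 0 := by
  refine Subtype.ext ?_
  funext D p
  exact skew_eq_zero (isSkewSymm F D p).1 h

theorem sub_apply (F G : Pr.TractorForm k) (D : Pr.conns) (p : M) :
    (F - G).1 D p = F.1 D p - G.1 D p := rfl

theorem smul_apply (r : ℝ) (F : Pr.TractorForm k) (D : Pr.conns) (p : M) :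
    (r • F).1 D p = r • F.1 D p := rfl

theorem codiffT_extDT_some_none (hn : 2 ≤ n) (H : Pr.TractorForm (k + 2)) (D : Pr.conns) (p : M)
    (a : Fin (k + 1) → Fin n) (c : Fin n) :
    (codiffT Pr (k + 1) (extDT Pr (k + 1) hn (codiffT Pr (k + 1) H))).1 D p a (some c) none =
      ((n : ℝ) - k) / (k + 2) * (codiffT Pr (k + 1) H).1 D p a (some c) none :=
  codiff_extD_some_none (isTractorFormAt (codiffT Pr (k + 1) H) D p)
    (Filter.Eventually.of_forall fun z => ⟨H.1 D z, isSkewSymm H D z, rfl⟩)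
    (isSmoothTorsionFree D) a c

theorem codiffT_extDT_none_none (hn : 2 ≤ n) (H : Pr.TractorForm (k + 2)) (D : Pr.conns) (p : M)
    (a : Fin (k + 1) → Fin n) :
    (codiffT Pr (k + 1) (extDT Pr (k + 1) hn (codiffT Pr (k + 1) H))).1 D p a none none =
      1 / ((k : ℝ) + 2) * (∑ s, cov D.1 (-2) (rho ((codiffT Pr (k + 1) H).1 D)) p s a ![s] +
        2 * ((n : ℝ) - k - 1) * (codiffT Pr (k + 1) H).1 D p a none none) :=
  codiff_extD_none_none (isTractorFormAt (codiffT Pr (k + 1) H) D p)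
    (Filter.Eventually.of_forall fun z => ⟨H.1 D z, isSkewSymm H D z, rfl⟩)
    (isSmoothTorsionFree D) a

/-- The difference of two solutions lies in `im ∂^*` and is annihilated by `∂^* d^∇`, which is
injective on that image when `k + 2 ≤ n`. -/
theorem IsNormalizedExtD.unique (hn : 2 ≤ n)
    {dt dt' : Pr.TractorForm k →ₗ[ℝ] Pr.TractorForm (k + 1)}
    (h : IsNormalizedExtD dt) (h' : IsNormalizedExtD dt') : dt = dt' := by
  refine LinearMap.ext fun F => ?_
  obtain ⟨H, hH⟩ := h.im_codiff F
  obtain ⟨H', hH'⟩ := h'.im_codiff F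
  have h1 : dt F - dt' F = codiffT Pr (k + 1) (H - H') := by
    refine Subtype.ext ?_
    funext D p
    rw [codiffT_apply, sub_apply, sub_apply, codiff_sub, ← hH, ← hH']
    simp only [modification, Pi.sub_apply]
    abel
  rw [← sub_eq_zero]
  by_cases hk : k + 2 ≤ n
  · refine Subtype.ext ?_
    funext D p
    refine eq_zero_of_codiff_extD_eq_zero (isSmoothTorsionFree D) hk (E := (dt F - dt' F).1 D)
      (fun q => isTractorFormAt (dt F - dt' F) D q) (fun q => ⟨_, isSkewSymm (H - H') D q, ?_⟩)
      (fun q => ?_) p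
    · rw [h1]; rfl
    · have h2 : codiffT Pr (k + 1) (extDT Pr (k + 1) hn (dt F - dt' F)) = 0 := by
        rw [map_sub, map_sub, sub_eq_zero]
        refine Subtype.ext ?_
        funext D p
        exact (h.normalized F D p).trans (h'.normalized F D p).symm
      exact congr_fun (congr_fun (congr_arg Subtype.val h2) D) q
  -- Above the top degree the preimage under `∂^*` is already zero, so the difference vanishes.
  · rw [h1, eq_zero_of_lt (H - H') (by omega), map_zero]

theorem isNormalizedExtD_extDT (hn : 2 ≤ n) (hk : n ≤ k + 1) :
    IsNormalizedExtD (extDT Pr k hn) := by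
  have h0 : ∀ F D, modification (extDT Pr k hn) F D = 0 := by
    intro F D
    rw [modification, extDT_apply, sub_self]
  refine ⟨fun F _ D p a => ?_, fun F _ D p a => ?_, fun F => ⟨0, fun D p => ?_⟩, fun F D p => ?_⟩
  · rw [h0]; intro b c; rfl
  · rw [h0]; exact ⟨fun b c => rfl, fun b => ⟨rfl, rfl⟩⟩
  · rw [h0]
    exact codiff_zero.symm
  · have h1 := eq_zero_of_lt (extDT Pr (k + 1) hn (extDT Pr k hn F)) (by omega)
    have h2 : extD D.1 ((extDT Pr k hn F).1 D) p = 0 :=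
      congr_fun (congr_fun (congr_arg Subtype.val h1) D) p
    rw [h2, codiff_zero]

variable (Pr k) in
/-- `∂^* d^∇ d^∇`. -/
def curvT (hn : 2 ≤ n) : Pr.TractorForm k →ₗ[ℝ] Pr.TractorForm (k + 1) :=
  codiffT Pr (k + 1) ∘ₗ extDT Pr (k + 1) hn ∘ₗ extDT Pr k hn

variable (Pr k) in
/-- The exterior covariant derivative, normalized in the `ρ`-slot. -/
def preT (hn : 2 ≤ n) : Pr.TractorForm k →ₗ[ℝ] Pr.TractorForm (k + 1) :=
  -- The coefficient inverts the factor `(n - k)/(k + 2)` of `∂^* d^∇` on the `ρ`-slot of `im ∂^*`.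
  extDT Pr k hn - (((k : ℝ) + 2) / (n - k)) • curvT Pr k hn

variable (Pr k) in
/-- The normalized exterior covariant derivative. -/
def normT (hn : 2 ≤ n) : Pr.TractorForm k →ₗ[ℝ] Pr.TractorForm (k + 1) :=
  -- The remaining error has only a `ν`-slot, where `∂^* d^∇` is multiplication by `2(n - k - 1)/(k
  -- + 2)`.
  preT Pr k hn - (((k : ℝ) + 2) / (2 * ((n : ℝ) - k - 1))) •
    (codiffT Pr (k + 1) ∘ₗ extDT Pr (k + 1) hn ∘ₗ preT Pr k hn)

theorem curvT_some_none (hn : 2 ≤ n) (F : Pr.TractorForm k) (D : Pr.conns) (x : M)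
    (a : Fin (k + 1) → Fin n) (c : Fin n) :
    (curvT Pr k hn F).1 D x a (some c) none = weylSigma D.1 (F.1 D) x a ![c] :=
  codiff_extD_extD_some_none (eventually_isTractorFormAt F D x) hn (isSmoothTorsionFree D) a c

theorem curvT_none_none (hn : 2 ≤ n) (F : Pr.TractorForm k) (D : Pr.conns) (x : M)
    (a : Fin (k + 1) → Fin n) :
    (curvT Pr k hn F).1 D x a none none = weylRhoCottonSigma D.1 (F.1 D) x a :=
  codiff_extD_extD_none_none (eventually_isTractorFormAt F D x) hn (isSmoothTorsionFree D) a

theorem codiff_preT_some_none (hn : 2 ≤ n) (hk : k + 2 ≤ n) (F : Pr.TractorForm k) (D : Pr.conns)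
    (x : M) (a : Fin (k + 1) → Fin n) (c : Fin n) :
    (codiffT Pr (k + 1) (extDT Pr (k + 1) hn (preT Pr k hn F))).1 D x a (some c) none = 0 := by
  have hk' : (k : ℝ) + 2 ≤ n := by exact_mod_cast hk
  have hk2 : (k : ℝ) + 2 ≠ 0 := by positivity
  have hk3 : (n : ℝ) - k ≠ 0 := by
    have : 0 < (n : ℝ) - k := by linarith
    exact this.ne'
  have h1 := codiffT_extDT_some_none hn (extDT Pr (k + 1) hn (extDT Pr k hn F)) D x a c
  have h2 : codiffT Pr (k + 1) (extDT Pr (k + 1) hn (preT Pr k hn F)) =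
      curvT Pr k hn F - (((k : ℝ) + 2) / (n - k)) •
        codiffT Pr (k + 1) (extDT Pr (k + 1) hn (curvT Pr k hn F)) := by
    simp only [preT, curvT, LinearMap.sub_apply, LinearMap.smul_apply, map_sub, map_smul,
      LinearMap.comp_apply]
  rw [h2, sub_apply, smul_apply, Pi.sub_apply, Matrix.sub_apply, Pi.smul_apply, Matrix.smul_apply]
  simp only [curvT, LinearMap.comp_apply, smul_eq_mul]
  rw [h1]
  field_simp
  ring

/-- The entry `(some c, none)` is half of `ρ`, hence the factor two. Smoothness of `weylSigma`,
needed to pull the constant out, is inherited from the smooth form `curvT`. -/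
theorem sum_cov_rho_curvT (hn : 2 ≤ n) (F : Pr.TractorForm k) (D : Pr.conns) (x : M)
    (a : Fin (k + 1) → Fin n) :
    ∑ s, cov D.1 (-2) (rho ((curvT Pr k hn F).1 D)) x s a ![s] = 2 * divWeylSigma D.1 (F.1 D) x a := by
  have h1 : rho ((curvT Pr k hn F).1 D) = fun z b d => 2 * weylSigma D.1 (F.1 D) z b d := by
    funext z b d
    rw [rho, curvT_some_none]
    congr 2
    funext i; fin_cases i; rfl
  have h2 : weylSigma D.1 (F.1 D) = (1 / 2 : ℝ) • rho ((curvT Pr k hn F).1 D) := by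
    rw [h1]
    funext z b d
    simp
  rw [divWeylSigma, Finset.mul_sum]
  refine Finset.sum_congr rfl fun s _ => ?_
  rw [h1, cov_const_mul]
  have h3 := ((curvT Pr k hn F).2.1 D).smooth_rho.smul (1 / 2)
  rw [← h2] at h3
  refine (h3 x a ![s]).contMDiffAt ?_
  rw [Set.inter_univ]
  exact dom_mem_nhds (self_mem_dom x)

/-- With `μ` for `weylRhoCottonSigma` and `div` for `divWeylSigma`, this is `μ - (2 div + 2(n - k -
1) μ)/(n - k)`, the `ν`-slot of the curvature minus the effect of the first correction. -/
theorem codiff_preT_none_none (hn : 2 ≤ n) (hk : k + 2 ≤ n) (F : Pr.TractorForm k) (D : Pr.conns)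
    (x : M) (a : Fin (k + 1) → Fin n) :
    (codiffT Pr (k + 1) (extDT Pr (k + 1) hn (preT Pr k hn F))).1 D x a none none =
      - (1 / ((n : ℝ) - k)) * (2 * divWeylSigma D.1 (F.1 D) x a +
        ((n : ℝ) - k - 2) * weylRhoCottonSigma D.1 (F.1 D) x a) := by
  have hk' : (k : ℝ) + 2 ≤ n := by exact_mod_cast hk
  have hk2 : (k : ℝ) + 2 ≠ 0 := by positivity
  have hk3 : (n : ℝ) - k ≠ 0 := by
    have : 0 < (n : ℝ) - k := by linarith
    exact this.ne'
  have h1 := codiffT_extDT_none_none hn (extDT Pr (k + 1) hn (extDT Pr k hn F)) D x a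
  have h2 : codiffT Pr (k + 1) (extDT Pr (k + 1) hn (preT Pr k hn F)) =
      curvT Pr k hn F - (((k : ℝ) + 2) / (n - k)) •
        codiffT Pr (k + 1) (extDT Pr (k + 1) hn (curvT Pr k hn F)) := by
    simp only [preT, curvT, LinearMap.sub_apply, LinearMap.smul_apply, map_sub, map_smul,
      LinearMap.comp_apply]
  rw [h2, sub_apply, smul_apply, Pi.sub_apply, Matrix.sub_apply, Pi.smul_apply, Matrix.smul_apply]
  have h3 := sum_cov_rho_curvT hn F D x a
  have h4 := curvT_none_none hn F D x a
  simp only [curvT, LinearMap.comp_apply] at h3 h4 ⊢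
  rw [h1, h3, h4, smul_eq_mul]
  field_simp
  ring

theorem modification_normT (hn : 2 ≤ n) (F : Pr.TractorForm k) (D : Pr.conns) (p : M) :
    modification (normT Pr k hn) F D p =
      - ((((k : ℝ) + 2) / (n - k)) • (curvT Pr k hn F).1 D p +
        (((k : ℝ) + 2) / (2 * ((n : ℝ) - k - 1))) •
          (codiffT Pr (k + 1) (extDT Pr (k + 1) hn (preT Pr k hn F))).1 D p) := by
  have h : normT Pr k hn F = extDT Pr k hn F - (((k : ℝ) + 2) / (n - k)) • curvT Pr k hn F -
      (((k : ℝ) + 2) / (2 * ((n : ℝ) - k - 1))) •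
        codiffT Pr (k + 1) (extDT Pr (k + 1) hn (preT Pr k hn F)) := rfl
  rw [modification, Pi.sub_apply, h, sub_apply, sub_apply, smul_apply, smul_apply, extDT_apply]
  abel

theorem isNormalizedExtD_normT (hn : 2 ≤ n) (hk : k + 2 ≤ n) :
    IsNormalizedExtD (normT Pr k hn) := by
  have hk' : (k : ℝ) + 2 ≤ n := by exact_mod_cast hk
  have hk2 : (k : ℝ) + 2 ≠ 0 := by positivity
  have hk3 : (n : ℝ) - k - 1 ≠ 0 := by
    have : 0 < (n : ℝ) - k - 1 := by linarith
    exact this.ne'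
  have him : ∀ F D p, modification (normT Pr k hn) F D p =
      codiff ((-((((k : ℝ) + 2) / (n - k)) • extDT Pr (k + 1) hn (extDT Pr k hn F) +
        (((k : ℝ) + 2) / (2 * ((n : ℝ) - k - 1))) •
          extDT Pr (k + 1) hn (preT Pr k hn F))).1 D p) := by
    intro F D p
    rw [modification_normT, ← codiffT_apply, map_neg, map_add, map_smul, map_smul]
    rfl
  have hs : ∀ F D p a, (modification (normT Pr k hn) F D p a).IsSymm := by
    intro F D p a
    rw [him]
    exact (IsSkewSymm.codiff (isSkewSymm _ D p)).2 a
  refine ⟨fun F _ D p a => ?_, fun F hF D p a => ?_, fun F => ⟨_, him F⟩, fun F D p => ?_⟩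
  · rw [him]
    exact codiff_some_some _ _
  · have h1 : ∀ b, modification (normT Pr k hn) F D p a (some b) none = 0 := by
      intro b
      have h2 : (curvT Pr k hn F).1 D p a (some b) none = 0 := by
        rw [curvT_some_none]
        have h3 : sigma (F.1 D) = 0 := by
          funext z b c
          exact (hF D z b).1 _ _
        simp [weylSigma, h3, alt]
      rw [modification_normT]
      simp [h2, codiff_preT_some_none hn hk]
    refine ⟨?_, fun b => ⟨h1 b, ?_⟩⟩
    · rw [him]
      exact codiff_some_some _ _
    · exact (congr_fun (congr_fun (hs F D p a) (some b)) none).trans (h1 b)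
  · set E := codiffT Pr (k + 1) (extDT Pr (k + 1) hn (preT Pr k hn F)) with hE
    -- `E` is the error left by `preT`; because its `ρ`-slot vanishes identically, its divergence
    -- term does too and the second correction removes `E` exactly.
    have h1 : codiffT Pr (k + 1) (extDT Pr (k + 1) hn (normT Pr k hn F)) =
        E - (((k : ℝ) + 2) / (2 * ((n : ℝ) - k - 1))) •
          codiffT Pr (k + 1) (extDT Pr (k + 1) hn E) := by
      simp only [normT, LinearMap.sub_apply, LinearMap.smul_apply, map_sub, map_smul,
        LinearMap.comp_apply, hE]
    have h2 : codiff (extD D.1 ((normT Pr k hn F).1 D) p) =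
      (codiffT Pr (k + 1) (extDT Pr (k + 1) hn (normT Pr k hn F))).1 D p := rfl
    have h3 : ∀ z a (c : Fin n), E.1 D z a (some c) none = 0 := fun z a c =>
      codiff_preT_some_none hn hk F D z a c
    funext a
    refine ext_of_im_codiff ?_ (fun b c => codiff_some_some _ _ _ _) (fun c => ?_) ?_
    · rw [h2]
      exact (isSkewSymm _ D p).2 a
    · rw [h2, h1, sub_apply, smul_apply, Pi.sub_apply, Matrix.sub_apply, Pi.smul_apply,
        Matrix.smul_apply, codiffT_extDT_some_none, ← hE, h3]
      simp
    · rw [h2, h1, sub_apply, smul_apply, Pi.sub_apply, Matrix.sub_apply, Pi.smul_apply,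
        Matrix.smul_apply, codiffT_extDT_none_none, ← hE]
      simp only [cov_rho_eq_zero (isTractorFormAt E D p) (Filter.Eventually.of_forall h3), Finset.sum_const_zero,
        smul_eq_mul]
      field_simp
      ring

/-- The two contributions to the `ν`-slot combine through `(n - k - 2) - 2(n - k - 1) = -(n - k)`.
-/
theorem normT_apply (hn : 2 ≤ n) (hk : k + 2 ≤ n) (F : Pr.TractorForm k) (D : Pr.conns) (x : M)
    (a : Fin (k + 1) → Fin n) :
    (normT Pr k hn F).1 D x a = extD D.1 (F.1 D) x a - (((k : ℝ) + 2) / (n - k)) •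
      (injXY (fun c => 2 * weylSigma D.1 (F.1 D) x a ![c]) - (1 / (2 * ((n : ℝ) - k - 1))) •
        injXX (2 * divWeylSigma D.1 (F.1 D) x a -
          (n - k) * weylRhoCottonSigma D.1 (F.1 D) x a)) := by
  have hk' : (k : ℝ) + 2 ≤ n := by exact_mod_cast hk
  have hk2 : (k : ℝ) + 2 ≠ 0 := by positivity
  have hk3 : (n : ℝ) - k - 1 ≠ 0 := by
    have : 0 < (n : ℝ) - k - 1 := by linarith
    exact this.ne'
  have hk4 : (n : ℝ) - k ≠ 0 := by
    have : 0 < (n : ℝ) - k := by linarith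
    exact this.ne'
  have h0 : (normT Pr k hn F).1 D x a = extD D.1 (F.1 D) x a +
      modification (normT Pr k hn) F D x a := by
    rw [modification]; simp
  rw [h0, sub_eq_add_neg]
  congr 1
  rw [modification_normT]
  set B := curvT Pr k hn F
  set E := codiffT Pr (k + 1) (extDT Pr (k + 1) hn (preT Pr k hn F))
  have hBs := (isSkewSymm B D x).2 a
  have hEs := (isSkewSymm E D x).2 a
  have hB : B.1 D x a = injXY (fun c => 2 * weylSigma D.1 (F.1 D) x a ![c]) +
      injXX (weylRhoCottonSigma D.1 (F.1 D) x a) := by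
    have h1 : ∀ c, B.1 D x a (some c) none = weylSigma D.1 (F.1 D) x a ![c] :=
      curvT_some_none hn F D x a
    ext i j
    rcases i with _ | i <;> rcases j with _ | j
    · simpa [injXY, injXX] using curvT_none_none hn F D x a
    · have h2 := (congr_fun (congr_fun hBs (some j)) none).trans (h1 j)
      simpa [injXY, injXX] using h2
    · simpa [injXY, injXX] using h1 i
    · have h2 : B.1 D x a (some i) (some j) = 0 := codiff_some_some _ _ _ _
      simpa [injXY, injXX] using h2
  have hE : E.1 D x a = injXX (- (1 / ((n : ℝ) - k)) * (2 * divWeylSigma D.1 (F.1 D) x a +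
        ((n : ℝ) - k - 2) * weylRhoCottonSigma D.1 (F.1 D) x a)) := by
    have h1 : ∀ c, E.1 D x a (some c) none = 0 := codiff_preT_some_none hn hk F D x a
    ext i j
    rcases i with _ | i <;> rcases j with _ | j
    · exact codiff_preT_none_none hn hk F D x a
    · exact (congr_fun (congr_fun hEs (some j)) none).trans (h1 j)
    · exact h1 i
    · exact codiff_some_some _ _ _ _
  simp only [Pi.neg_apply, Pi.add_apply, Pi.smul_apply, hB, hE]
  ext i j
  rcases i with _ | i <;> rcases j with _ | j
  · simp [injXX, injXY]
    field_simp
    ring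
  all_goals simp [injXX, injXY]

end ProjectiveStructure

/-! ### The Bianchi identity and the case of sections -/

section bianchi

variable {n : ℕ} {M : Type*} [TopologicalSpace M] [ChartedSpace (EuclideanSpace ℝ (Fin n)) M]
  [IsManifold (𝓡 n) ∞ M] {p q : M}

/-- The differential Bianchi identity. -/
theorem curv_bianchi {ι : Type*} [Fintype ι] (hq : q ∈ dom n p) {γ : M → Fin n → Matrix ι ι ℝ}
    (hγ : ∀ a, MatSmoothAt n (fun z => γ z a) q) (a b c : Fin n) :
    (mdc p (fun z => curv p γ z a b) q c + γ q c * curv p γ q a b - curv p γ q a b * γ q c) +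
    (mdc p (fun z => curv p γ z b c) q a + γ q a * curv p γ q b c - curv p γ q b c * γ q a) +
    (mdc p (fun z => curv p γ z c a) q b + γ q b * curv p γ q c a - curv p γ q c a * γ q b) = 0 := by
  have h : ∀ a b c : Fin n, mdc p (fun z => curv p γ z a b) q c =
      mdc p (fun z => mdc p (fun y => γ y b) z a) q c - mdc p (fun z => mdc p (fun y => γ y a) z b) q c +
      ((mdc p (fun z => γ z a) q c * γ q b + γ q a * mdc p (fun z => γ z b) q c) -
        (mdc p (fun z => γ z b) q c * γ q a + γ q b * mdc p (fun z => γ z a) q c)) := by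
    intro a b c
    rw [← mdc_mul hq (hγ a) (hγ b), ← mdc_mul hq (hγ b) (hγ a),
      ← mdc_sub hq ((hγ b).mdc hq a) ((hγ a).mdc hq b),
      ← mdc_sub hq ((hγ a).mul (hγ b)) ((hγ b).mul (hγ a)),
      ← mdc_add hq (((hγ b).mdc hq a).sub ((hγ a).mdc hq b))
        (((hγ a).mul (hγ b)).sub ((hγ b).mul (hγ a)))]
    rfl
  rw [h, h, h, mdc_comm hq (hγ b) c a, mdc_comm hq (hγ c) a b, mdc_comm hq (hγ a) b c]
  simp only [curv]
  noncomm_ring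

variable [T2Space M] {D : AffineConnection n M}

theorem tcurv_swap (D : AffineConnection n M) (p q : M) (a b : Fin n) (i j : Option (Fin n)) :
    tcurv D p q b a i j = - tcurv D p q a b i j :=
  congr_fun (congr_fun (curv_swap p (lgam D p) q a b) i) j

theorem tcurv_trace_right (hn : 2 ≤ n) (hD : IsSmoothTorsionFree D) (hq : q ∈ dom n p)
    (b d : Fin n) : ∑ a, tcurv D p q b a (some a) (some d) = 0 := by
  simp only [tcurv_swap D p q _ b, Finset.sum_neg_distrib, tcurv_trace hn hD hq, neg_zero]

/-- The divergence of the Weyl tensor. -/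
theorem sum_dc_tcurv (hn : 2 ≤ n) (hD : IsSmoothTorsionFree D) (hq : q ∈ dom n p) (r a t : Fin n) :
    ∑ s, dc p (fun z => tcurv D p z r a (some s) (some t)) q s =
      - ((n : ℝ) - 2) * tcurv D p q r a none (some t)
      - ∑ s, ∑ e, chr D p q s s e * tcurv D p q r a (some e) (some t)
      + ∑ s, ∑ e, tcurv D p q r a (some s) (some e) * chr D p q s e t
      - ∑ s, ∑ e, chr D p q r s e * tcurv D p q a s (some e) (some t)
      - ∑ s, ∑ e, chr D p q a s e * tcurv D p q s r (some e) (some t) := by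
  have hγ := fun a => matSmoothAt_lgam hD hq a
  have hK : ∀ a b, MatSmoothAt n (fun z => tcurv D p z a b) q := fun a b => MatSmoothAt.curv hq hγ a b
  -- The Bianchi identity with the free upper index set equal to the derivative index, then summed.
  have h1 : ∀ s, _ := fun s => congr_fun (congr_fun (curv_bianchi hq hγ r a s) (some s)) (some t)
  have h2 := Finset.sum_congr (rfl : (Finset.univ : Finset (Fin n)) = Finset.univ) fun s _ => h1 s
  simp only [Matrix.add_apply, Matrix.sub_apply, Finset.sum_add_distrib, Finset.sum_sub_distrib,
    Matrix.zero_apply, Finset.sum_const_zero] at h2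
  have e0 : ∀ b c : Fin n, ∑ s, tcurv D p q b s (some s) (some c) = 0 := fun b c =>
    tcurv_trace_right hn hD hq b c
  -- In the other two cyclic terms the sum is the derivative of a trace of the Weyl block, which
  -- vanishes throughout the chart.
  have e1 : ∑ s, mdc p (fun z => curv p (lgam D p) z a s) q r (some s) (some t) = 0 := by
    have : ∑ s, mdc p (fun z => curv p (lgam D p) z a s) q r (some s) (some t) =
        dc p (fun z => ∑ s, tcurv D p z a s (some s) (some t)) q r :=
      (dc_sum hq (fun s _ => hK a s _ _) r).symm
    rw [this, ← dc_const p q 0 r]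
    refine dc_congr hq ?_ r
    filter_upwards [dom_mem_nhds hq] with z hz
    exact tcurv_trace_right hn hD hz a t
  have e2 : ∑ s, mdc p (fun z => curv p (lgam D p) z s r) q a (some s) (some t) = 0 := by
    have : ∑ s, mdc p (fun z => curv p (lgam D p) z s r) q a (some s) (some t) =
        dc p (fun z => ∑ s, tcurv D p z s r (some s) (some t)) q a :=
      (dc_sum hq (fun s _ => hK s r _ _) a).symm
    rw [this, ← dc_const p q 0 a]
    refine dc_congr hq ?_ a
    filter_upwards [dom_mem_nhds hq] with z hz
    exact tcurv_trace hn hD hz r t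
  -- The density part of the connection matrix commutes with the curvature and drops out; the
  -- Kronecker column brings in the lower-left block. After contraction that block has coefficient
  -- `n` from one cyclic term and `-1` from each of the others, in all `n - 2`.
  have e3 : ∀ c a b s : Fin n, (lgam D p q c * curv p (lgam D p) q a b) (some s) (some t) -
      (curv p (lgam D p) q a b * lgam D p q c) (some s) (some t) =
      (if s = c then tcurv D p q a b none (some t) else 0) +
      ∑ e, chr D p q c s e * tcurv D p q a b (some e) (some t) -
      ∑ e, tcurv D p q a b (some s) (some e) * chr D p q c e t := by
    intro c a b s
    rw [← tcurv]
    simp only [Matrix.mul_apply, Fintype.sum_option, tcurv_some_none hD hq, lgam]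
    simp [sub_mul, mul_sub, Finset.sum_sub_distrib]
    ring
  have E1 := Finset.sum_congr (rfl : (Finset.univ : Finset (Fin n)) = Finset.univ) fun s _ =>
    e3 s r a s
  have E2 := Finset.sum_congr (rfl : (Finset.univ : Finset (Fin n)) = Finset.univ) fun s _ =>
    e3 r a s s
  have E3 := Finset.sum_congr (rfl : (Finset.univ : Finset (Fin n)) = Finset.univ) fun s _ =>
    e3 a s r s
  simp only [Finset.sum_add_distrib, Finset.sum_sub_distrib] at E1 E2 E3
  rw [Finset.sum_comm (f := fun s e => tcurv D p q a s (some s) (some e) * chr D p q r e t)] at E2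
  rw [Finset.sum_comm (f := fun s e => tcurv D p q s r (some s) (some e) * chr D p q a e t)] at E3
  simp only [← Finset.sum_mul, e0, tcurv_trace hn hD hq, zero_mul, Finset.sum_const_zero] at E2 E3
  simp at E1 E2 E3
  have e5 : tcurv D p q a r none (some t) = - tcurv D p q r a none (some t) := tcurv_swap D p q r a _ _
  have e6 : ∑ s, mdc p (fun z => curv p (lgam D p) z r a) q s (some s) (some t) =
    ∑ s, dc p (fun z => tcurv D p z r a (some s) (some t)) q s := rfl
  rw [e6, e1, e2] at h2
  rw [e5] at E2 E3
  linarith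

/-! #### Sections -/

theorem alt_cons_two (T : Fin n → Fin n → ℝ) (hT : ∀ a b, T b a = - T a b) (r : Fin n)
    (a : Fin 1 → Fin n) :
    alt (fun b : Fin 2 → Fin n => T (b 0) (b 1)) (Fin.cons r a) = T r (a 0) := by
  have h := alt_cons (U := fun c (b : Fin 1 → Fin n) => T c (b 0)) (fun c π b => by
    have : π = 1 := Subsingleton.elim _ _
    subst this
    simp) r a
  refine Eq.trans ?_ (h.trans ?_)
  · rfl
  · simp [hT r (a 0)]
    ring

theorem weyl_swap (hn : 2 ≤ n) (hD : IsSmoothTorsionFree D) (x : M) (a b c d : Fin n) :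
    weyl D x b a c d = - weyl D x a b c d := by
  rw [weyl_eq hn hD, weyl_eq hn hD, tcurv_swap]

theorem cotton_swap (hD : IsSmoothTorsionFree D) (x : M) (a b c : Fin n) :
    cotton D x b a c = - cotton D x a b c := by
  rw [cotton_eq hD, cotton_eq hD, tcurv_swap]

/-- One half of the symmetrization contains the trace `W_{sr}^s_p` and vanishes. -/
theorem weylSigma_section (hn : 2 ≤ n) (hD : IsSmoothTorsionFree D) (F : TFormField n M 0) (x : M)
    (a : Fin 1 → Fin n) (c : Fin 1 → Fin n) :
    weylSigma D F x a c = 1 / 2 * ∑ r, ∑ p, weyl D x r (a 0) (c 0) p * sigma F x ![] ![r, p] := by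
  have h0 : ∀ b : Fin 0 → Fin n, b = ![] := fun b => Subsingleton.elim _ _
  have h1 : ∀ r, ∑ s, ∑ p, weyl D x s r s p * sigma F x ![] ![c 0, p] = 0 := by
    intro r
    rw [Finset.sum_comm]
    simp only [← Finset.sum_mul, weyl_eq hn hD, tcurv_trace hn hD (self_mem_dom x), zero_mul,
      Finset.sum_const_zero]
  simp only [weylSigma, h0]
  have h2 : ∀ r (i j : Fin n), alt (fun b : Fin 2 → Fin n =>
      ∑ p, weyl D x (b 0) (b 1) i p * sigma F x ![] ![j, p]) (Fin.cons r a) =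
      ∑ p, weyl D x r (a 0) i p * sigma F x ![] ![j, p] := by
    intro r i j
    refine alt_cons_two (fun s t => ∑ p, weyl D x s t i p * sigma F x ![] ![j, p]) (fun s t => ?_) r a
    rw [← Finset.sum_neg_distrib]
    exact Finset.sum_congr rfl fun p _ => by rw [weyl_swap hn hD]; ring
  refine (Finset.sum_congr rfl fun r _ => congr_arg₂ (fun u v => (u + v) / 2) (h2 r r (c 0))
    (h2 r (c 0) r)).trans ?_
  simp only [← Finset.sum_div, Finset.sum_add_distrib, h1]
  ring

theorem weylRhoCottonSigma_section (hn : 2 ≤ n) (hD : IsSmoothTorsionFree D) (F : TFormField n M 0)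
    (x : M) (a : Fin 1 → Fin n) :
    weylRhoCottonSigma D F x a = - ∑ r, ∑ p, cotton D x r (a 0) p * sigma F x ![] ![p, r] := by
  have h0 : ∀ b : Fin 0 → Fin n, b = ![] := fun b => Subsingleton.elim _ _
  have h1 : ∀ r, ∑ s, ∑ p, weyl D x s r s p * rho F x ![] ![p] = 0 := by
    intro r
    rw [Finset.sum_comm]
    simp only [← Finset.sum_mul, weyl_eq hn hD, tcurv_trace hn hD (self_mem_dom x), zero_mul,
      Finset.sum_const_zero]
  simp only [weylRhoCottonSigma, h0]
  have h2 : ∀ r (i : Fin n), alt (fun b : Fin 2 → Fin n =>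
      ∑ p, weyl D x (b 0) (b 1) i p * rho F x ![] ![p]) (Fin.cons r a) =
      ∑ p, weyl D x r (a 0) i p * rho F x ![] ![p] := by
    intro r i
    refine alt_cons_two (fun s t => ∑ p, weyl D x s t i p * rho F x ![] ![p]) (fun s t => ?_) r a
    rw [← Finset.sum_neg_distrib]
    exact Finset.sum_congr rfl fun p _ => by rw [weyl_swap hn hD]; ring
  have h3 : ∀ r (i : Fin n), alt (fun b : Fin 2 → Fin n =>
      ∑ p, cotton D x (b 0) (b 1) p * sigma F x ![] ![p, i]) (Fin.cons r a) =
      ∑ p, cotton D x r (a 0) p * sigma F x ![] ![p, i] := by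
    intro r i
    refine alt_cons_two (fun s t => ∑ p, cotton D x s t p * sigma F x ![] ![p, i]) (fun s t => ?_) r a
    rw [← Finset.sum_neg_distrib]
    exact Finset.sum_congr rfl fun p _ => by rw [cotton_swap hD]; ring
  refine (Finset.sum_congr rfl fun r _ => congr_arg₂ (fun u v => 1 / 2 * u - v) (h2 r r)
    (h3 r r)).trans ?_
  simp only [Finset.sum_sub_distrib, ← Finset.mul_sum, h1]
  ring

/-- `∂^* d^∇ d^∇` of a section, in local coordinates. -/
theorem loc_codiff_extD_extD (hn : 2 ≤ n) (hD : IsSmoothTorsionFree D) {F : TFormField n M 0}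
    (hF : ∀ᶠ z in nhds q, IsTractorFormAt F z) (hq : q ∈ dom n p) (a c : Fin n) :
    loc p (fun z => codiff (extD D (extD D F) z)) q ![a] (some c) none =
      1 / 2 * ∑ r, ∑ t, tcurv D p q r a (some c) (some t) * loc p F q ![] (some r) (some t) := by
  have h0 : ∀ b : Fin 0 → Fin n, b = ![] := fun b => Subsingleton.elim _ _
  have h1 : loc p (extD D F) =ᶠ[nhds q] lextD p (lgam D p) (loc p F) := by
    filter_upwards [hF, dom_mem_nhds hq] with z hz hz'
    exact loc_extD hD hz hz'
  have hs : ∀ i j, loc p F q ![] i j = loc p F q ![] j i := fun i j =>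
    congr_fun (congr_fun ((hF.self_of_nhds.skewSymm.self_of_nhds.loc p).2 ![]) j) i
  rw [loc_codiff hq, loc_extD hD (IsTractorFormAt.extD hD hF) hq, lextD_congr hq rfl h1,
    lextD_lextD hq (fun a => matSmoothAt_lgam hD hq a) (hF.self_of_nhds.matSmoothAt hq),
    codiff_some_none]
  have h2 : ∀ r, alt (fun b : Fin 2 → Fin n => (1 / 2 : ℝ) • act (curv p (lgam D p) q (b 0) (b 1))
      (loc p F q (Fin.tail (Fin.tail b)))) (Fin.cons r ![a]) (some c) (some r) =
      1 / 2 * (∑ t, tcurv D p q r a (some c) (some t) * loc p F q ![] (some r) (some t) +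
        ∑ t, tcurv D p q r a (some r) (some t) * loc p F q ![] (some c) (some t)) := by
    intro r
    rw [alt_apply]
    have e : ∀ b : Fin 2 → Fin n, loc p F q (Fin.tail (Fin.tail b)) = loc p F q ![] :=
      fun b => congr_arg _ (h0 _)
    simp only [e]
    rw [alt_cons_two (fun s t => ((1 / 2 : ℝ) • act (curv p (lgam D p) q s t) (loc p F q ![]))
      (some c) (some r))]
    · simp only [Matrix.smul_apply, act, Matrix.add_apply, Matrix.mul_apply, Fintype.sum_option,
        Matrix.transpose_apply, smul_eq_mul]
      rw [← tcurv]
      simp only [tcurv_some_none hD hq, zero_mul, mul_zero, zero_add, Matrix.cons_val_zero]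
      congr 2
      · exact Finset.sum_congr rfl fun t _ => by rw [hs (some t)]
      · exact Finset.sum_congr rfl fun t _ => mul_comm _ _
    · intro s t
      rw [curv_swap]
      simp [act]
      ring
  refine (Finset.sum_congr rfl fun r _ => h2 r).trans ?_
  rw [← Finset.mul_sum, Finset.sum_add_distrib]
  have h3 : ∑ r, ∑ t, tcurv D p q r a (some r) (some t) * loc p F q ![] (some c) (some t) = 0 := by
    rw [Finset.sum_comm]
    simp only [← Finset.sum_mul, tcurv_trace hn hD hq, zero_mul, Finset.sum_const_zero]
  rw [h3, add_zero]

theorem cov_sigma_eq {F : TFormField n M 0} (hF : IsTractorFormAt F q) (c r t : Fin n) :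
    cov D (-2) (sigma F) q c ![] ![r, t] = dc q (fun z => loc q F z ![] (some r) (some t)) q c
      + ∑ e, chr D q q c r e * F q ![] (some e) (some t)
      + ∑ e, chr D q q c t e * F q ![] (some r) (some e)
      - 2 * ((chr D q q c).trace / (n + 1)) * F q ![] (some r) (some t) := by
  have hσ : pd (fun z => inChart (-2) (sigma F) q z ![] ![r, t]) q c =
      dc q (fun z => loc q F z ![] (some r) (some t)) q c := by
    have h1 := hF.smooth ![] (some r) (some t)
    simp only [loc_some_some] at h1 ⊢
    exact pd_eq_dc h1 c
  have hchr : ∀ e c d, christoffel D q q e c d = chr D q q c e d := fun _ _ _ => rfl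
  have htr : ∑ e, chr D q q c e e = (chr D q q c).trace := rfl
  simp only [cov, hσ]
  simp [sigma, hchr, htr]
  ring

theorem cov_congr {w : ℝ} {ℓ m : ℕ} {S T : TensorField n M ℓ m} (h : S =ᶠ[nhds q] T) (c : Fin n)
    (b : Fin ℓ → Fin n) (d : Fin m → Fin n) (hT : SmoothAt n (fun z => inChart w T q z b d) q) :
    cov D w S q c b d = cov D w T q c b d := by
  have h1 : (fun z => inChart w S q z b d) =ᶠ[nhds q] fun z => inChart w T q z b d := by
    filter_upwards [h] with z hz
    simp only [inChart, hz]
  simp only [cov, h.self_of_nhds]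
  rw [pd_eq_dc hT, pd_eq_dc (hT.congr_of_eventuallyEq h1), dc_congr (self_mem_dom q) h1]

/-- `weylSigma` is half of the `ρ`-slot of the smooth form `∂^* d^∇ d^∇ F` near `q`. Differentiating
that form lets the general formula for `ρ`-slots be applied. -/
theorem cov_weylSigma {k : ℕ} (hn : 2 ≤ n) (hD : IsSmoothTorsionFree D) {F : TFormField n M k}
    (hF : ∀ᶠ z in nhds q, IsTractorFormAt F z) (c d : Fin n) (a : Fin (k + 1) → Fin n) :
    cov D (-2) (rho fun z => codiff (extD D (extD D F) z)) q c a ![d] =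
      2 * cov D (-2) (weylSigma D F) q c a ![d] := by
  set B : TFormField n M (k + 1) := fun z => codiff (extD D (extD D F) z) with hB
  have hBt : IsTractorFormAt B q := IsTractorFormAt.codiff
    (IsTractorFormAt.extD hD (hF.eventually_nhds.mono fun z hz => IsTractorFormAt.extD hD hz))
  have h1 : weylSigma D F =ᶠ[nhds q] fun z b d => (1 / 2 : ℝ) * rho B z b d := by
    filter_upwards [hF.eventually_nhds] with z hz
    funext b d
    have e : B z b (some (d 0)) none = weylSigma D F z b ![d 0] :=
      codiff_extD_extD_some_none hz hn hD b (d 0)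
    rw [rho, e]
    have : ![d 0] = d := by funext i; fin_cases i; rfl
    rw [this]
    ring
  have h2 : SmoothAt n (fun z => inChart (-2) (rho B) q z a ![d]) q := by
    simp only [← loc_some_none]
    exact (smoothAt_const 2).fun_mul (hBt.smooth a (some d) none)
  have h3 : SmoothAt n (fun z => inChart (-2) (fun z b d => (1 / 2 : ℝ) * rho B z b d) q z a ![d]) q := by
    have e : (fun z => inChart (-2) (fun z b d => (1 / 2 : ℝ) * rho B z b d) q z a ![d]) =
        fun z => 1 / 2 * inChart (-2) (rho B) q z a ![d] := by
      funext z
      simp only [inChart, Finset.mul_sum]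
      refine Finset.sum_congr rfl fun _ _ => Finset.sum_congr rfl fun _ _ => ?_
      ring
    rw [e]
    exact (smoothAt_const _).fun_mul h2
  rw [cov_congr h1 c a _ h3, cov_const_mul _ _ _ _ _ _ h2]
  ring

theorem sum_swap_pairs (f : Fin n → Fin n → Fin n → Fin n → ℝ) :
    ∑ s, ∑ e, ∑ r, ∑ t, f s e r t = ∑ r, ∑ t, ∑ s, ∑ e, f s e r t := by
  have h : ∀ g : Fin n → Fin n → ℝ, ∑ s, ∑ e, g s e = ∑ x : Fin n × Fin n, g x.1 x.2 :=
    fun g => (Fintype.sum_prod_type' _).symm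
  simp only [h]
  exact Finset.sum_comm

/-- The index bookkeeping of the Leibniz rule for a divergence, isolated from the geometry: `K`
stands for the Weyl block, `N` for the lower-left block, `G` for the Christoffel symbols, `S` for
`σ`, and `τ` for the density part. The hypothesis `hd` is the contracted Bianchi identity. Two
groups of Christoffel terms cancel, and the other two complete the covariant derivative of `σ`. -/
theorem divergence_contraction (a : Fin n) (K : Fin n → Fin n → Fin n → Fin n → ℝ)
    (N G : Fin n → Fin n → Fin n → ℝ) (S : Fin n → Fin n → ℝ) (τ : Fin n → ℝ)
    (dS dK : Fin n → Fin n → Fin n → ℝ) (m : ℝ)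
    (hG : ∀ c s e, G c s e = G e s c) (hK : ∀ r a s t, K a r s t = - K r a s t)
    (hS : ∀ r t, S r t = S t r)
    (hd : ∀ r t, ∑ s, dK r s t = - m * N r a t - ∑ s, ∑ e, G s s e * K r a e t
      + ∑ s, ∑ e, K r a s e * G s e t - ∑ s, ∑ e, G r s e * K a s e t
      - ∑ s, ∑ e, G a s e * K s r e t) :
    ∑ s, 2 * (1 / 2 * ∑ r, ∑ t, (dK r s t * S r t + K r a s t * dS s r t)
      - ∑ e, G s e a * (1 / 2 * ∑ r, ∑ t, K r e s t * S r t)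
      + ∑ e, G s s e * (1 / 2 * ∑ r, ∑ t, K r a e t * S r t)
      - 2 * τ s * (1 / 2 * ∑ r, ∑ t, K r a s t * S r t)) =
    m * ∑ r, ∑ t, (- N r a t) * S t r + ∑ r, ∑ s, ∑ t, K r a s t * (dS s r t
      + ∑ e, G s r e * S e t + ∑ e, G s t e * S r e - 2 * τ s * S r t) := by
  have hL : ∀ s, 2 * (1 / 2 * ∑ r, ∑ t, (dK r s t * S r t + K r a s t * dS s r t)
      - ∑ e, G s e a * (1 / 2 * ∑ r, ∑ t, K r e s t * S r t)
      + ∑ e, G s s e * (1 / 2 * ∑ r, ∑ t, K r a e t * S r t)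
      - 2 * τ s * (1 / 2 * ∑ r, ∑ t, K r a s t * S r t)) =
      ∑ r, ∑ t, dK r s t * S r t + ∑ r, ∑ t, K r a s t * (dS s r t - 2 * τ s * S r t)
      - ∑ e, ∑ r, ∑ t, G s e a * K r e s t * S r t + ∑ e, ∑ r, ∑ t, G s s e * K r a e t * S r t := by
    intro s
    have e1 : ∑ r, ∑ t, K r a s t * (dS s r t - 2 * τ s * S r t) =
        ∑ r, ∑ t, K r a s t * dS s r t - 2 * τ s * ∑ r, ∑ t, K r a s t * S r t := by
      simp only [Finset.mul_sum, ← Finset.sum_sub_distrib]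
      exact Finset.sum_congr rfl fun r _ => Finset.sum_congr rfl fun t _ => by ring
    have e2 : ∀ (g : Fin n → ℝ) (f : Fin n → Fin n → Fin n → ℝ),
        ∑ e, g e * (1 / 2 * ∑ r, ∑ t, f e r t * S r t) =
        1 / 2 * ∑ e, ∑ r, ∑ t, g e * f e r t * S r t := by
      intro g f
      simp only [Finset.mul_sum]
      exact Finset.sum_congr rfl fun e _ => Finset.sum_congr rfl fun r _ =>
        Finset.sum_congr rfl fun t _ => by ring
    rw [e1, e2 (fun e => G s e a) (fun e r t => K r e s t), e2 (fun e => G s s e) (fun e r t => K r a e t)]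
    simp only [Finset.sum_add_distrib]
    ring
  rw [Finset.sum_congr rfl fun s _ => hL s]
  simp only [Finset.sum_add_distrib, Finset.sum_sub_distrib]
  have t1 : ∑ s, ∑ r, ∑ t, dK r s t * S r t = ∑ r, ∑ t, (∑ s, dK r s t) * S r t := by
    rw [Finset.sum_comm]
    refine Finset.sum_congr rfl fun r _ => ?_
    rw [Finset.sum_comm]
    exact Finset.sum_congr rfl fun t _ => (Finset.sum_mul _ _ _).symm
  have t2 : ∑ r, ∑ t, (∑ s, dK r s t) * S r t = - m * ∑ r, ∑ t, N r a t * S r t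
      - ∑ r, ∑ t, ∑ s, ∑ e, G s s e * K r a e t * S r t
      + ∑ r, ∑ t, ∑ s, ∑ e, K r a s e * G s e t * S r t
      - ∑ r, ∑ t, ∑ s, ∑ e, G r s e * K a s e t * S r t
      - ∑ r, ∑ t, ∑ s, ∑ e, G a s e * K s r e t * S r t := by
    simp only [hd, Finset.mul_sum, ← Finset.sum_sub_distrib, ← Finset.sum_add_distrib,
      Finset.sum_mul, sub_mul, add_mul]
    exact Finset.sum_congr rfl fun r _ => Finset.sum_congr rfl fun t _ => by
      simp only [← mul_assoc]
  have t3 : ∑ s, ∑ e, ∑ r, ∑ t, G s s e * K r a e t * S r t =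
      ∑ r, ∑ t, ∑ s, ∑ e, G s s e * K r a e t * S r t := sum_swap_pairs _
  have t4 : ∑ s, ∑ e, ∑ r, ∑ t, G s e a * K r e s t * S r t =
      - ∑ r, ∑ t, ∑ s, ∑ e, G a s e * K s r e t * S r t := by
    rw [sum_swap_pairs, ← Finset.sum_neg_distrib]
    refine Finset.sum_congr rfl fun r _ => ?_
    rw [← Finset.sum_neg_distrib]
    refine Finset.sum_congr rfl fun t _ => ?_
    rw [Finset.sum_comm, ← Finset.sum_neg_distrib]
    refine Finset.sum_congr rfl fun s _ => ?_
    rw [← Finset.sum_neg_distrib]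
    refine Finset.sum_congr rfl fun e _ => ?_
    rw [hG e s a, hK s r]
    ring
  have t5 : ∑ s, ∑ r, ∑ t, K r a s t * (dS s r t - 2 * τ s * S r t) =
      ∑ r, ∑ s, ∑ t, K r a s t * (dS s r t - 2 * τ s * S r t) := Finset.sum_comm
  have t6 : ∑ r, ∑ s, ∑ t, K r a s t * (dS s r t + ∑ e, G s r e * S e t + ∑ e, G s t e * S r e
      - 2 * τ s * S r t) = ∑ r, ∑ s, ∑ t, K r a s t * (dS s r t - 2 * τ s * S r t)
      + ∑ r, ∑ s, ∑ t, ∑ e, K r a s t * G s r e * S e t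
      + ∑ r, ∑ s, ∑ t, ∑ e, K r a s t * G s t e * S r e := by
    simp only [← Finset.sum_add_distrib]
    refine Finset.sum_congr rfl fun r _ => Finset.sum_congr rfl fun s _ =>
      Finset.sum_congr rfl fun t _ => ?_
    have e : ∀ x y z : Fin n → ℝ, K r a s t * (dS s r t + ∑ e, x e * y e + ∑ e, z e * S r e
        - 2 * τ s * S r t) = K r a s t * (dS s r t - 2 * τ s * S r t) +
        ∑ e, K r a s t * x e * y e + ∑ e, K r a s t * z e * S r e := by
      intro x y z
      simp only [mul_assoc (K r a s t), ← Finset.mul_sum]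
      ring
    exact e (fun e => G s r e) (fun e => S e t) (fun e => G s t e)
  have t7 : ∑ r, ∑ s, ∑ t, ∑ e, K r a s t * G s t e * S r e =
      ∑ r, ∑ t, ∑ s, ∑ e, K r a s e * G s e t * S r t := by
    refine Finset.sum_congr rfl fun r _ => ?_
    conv_rhs => rw [Finset.sum_comm]
    exact Finset.sum_congr rfl fun s _ => Finset.sum_comm
  have t8 : ∑ r, ∑ s, ∑ t, ∑ e, K r a s t * G s r e * S e t =
      - ∑ r, ∑ t, ∑ s, ∑ e, G r s e * K a s e t * S r t := by
    have e1 : ∑ r, ∑ s, ∑ t, ∑ e, K r a s t * G s r e * S e t =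
        ∑ r, ∑ s, ∑ e, ∑ t, K r a s t * G s r e * S e t :=
      Finset.sum_congr rfl fun r _ => Finset.sum_congr rfl fun s _ => Finset.sum_comm
    rw [e1, sum_swap_pairs, ← Finset.sum_neg_distrib]
    refine Finset.sum_congr rfl fun r _ => ?_
    rw [← Finset.sum_neg_distrib]
    refine Finset.sum_congr rfl fun t _ => ?_
    rw [← Finset.sum_neg_distrib]
    refine Finset.sum_congr rfl fun s _ => ?_
    rw [← Finset.sum_neg_distrib]
    refine Finset.sum_congr rfl fun e _ => ?_
    rw [hG e s r, hK s a]
    ring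
  have t9 : ∑ r, ∑ t, (- N r a t) * S t r = - ∑ r, ∑ t, N r a t * S r t := by
    simp only [← Finset.sum_neg_distrib]
    exact Finset.sum_congr rfl fun r _ => Finset.sum_congr rfl fun t _ => by rw [hS t r]; ring
  rw [t1, t2, t3, t4, t5, t6, t7, t8, t9]
  ring

/-- The divergence of `W_{ra}^s_p σ^{rp}`. -/
theorem divWeylSigma_section (hn : 2 ≤ n) (hD : IsSmoothTorsionFree D) {F : TFormField n M 0}
    (hF : ∀ᶠ z in nhds q, IsTractorFormAt F z) (a : Fin n) :
    2 * divWeylSigma D F q ![a] =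
      ((n : ℝ) - 2) * ∑ r, ∑ t, cotton D q r a t * sigma F q ![] ![t, r] +
      ∑ r, ∑ s, ∑ t, weyl D q r a s t * cov D (-2) (sigma F) q s ![] ![r, t] := by
  have hq := self_mem_dom (n := n) q
  set B : TFormField n M 1 := fun z => codiff (extD D (extD D F) z) with hB
  have hBt : IsTractorFormAt B q := IsTractorFormAt.codiff
    (IsTractorFormAt.extD hD (hF.eventually_nhds.mono fun z hz => IsTractorFormAt.extD hD hz))
  have hFs := hF.self_of_nhds.smooth ![]
  have hs : ∀ i j, F q ![] i j = F q ![] j i := fun i j =>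
    congr_fun (congr_fun (hF.self_of_nhds.skewSymm.self_of_nhds.2 ![]) j) i
  have hK : ∀ a b, MatSmoothAt n (fun z => tcurv D q z a b) q := fun a b =>
    MatSmoothAt.curv hq (fun a => matSmoothAt_lgam hD hq a) a b
  have hB0 : ∀ a c : Fin n, B q ![a] (some c) none =
      1 / 2 * ∑ r, ∑ t, tcurv D q q r a (some c) (some t) * F q ![] (some r) (some t) := by
    intro a c
    have := loc_codiff_extD_extD hn hD hF hq a c
    rwa [loc_self, loc_self] at this
  have hB1 : ∀ c s : Fin n, dc q (fun z => loc q B z ![a] (some c) none) q s = 1 / 2 * ∑ r, ∑ t,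
      (dc q (fun z => tcurv D q z r a (some c) (some t)) q s * F q ![] (some r) (some t) +
        tcurv D q q r a (some c) (some t) *
          dc q (fun z => loc q F z ![] (some r) (some t)) q s) := by
    intro c s
    have e : (fun z => loc q B z ![a] (some c) none) =ᶠ[nhds q] fun z => 1 / 2 * ∑ r, ∑ t,
        tcurv D q z r a (some c) (some t) * loc q F z ![] (some r) (some t) := by
      filter_upwards [hF.eventually_nhds, dom_mem_nhds hq] with z hz hz'
      exact loc_codiff_extD_extD hn hD hz hz' a c
    have hm : ∀ r t : Fin n, SmoothAt n (fun z => tcurv D q z r a (some c) (some t) *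
        loc q F z ![] (some r) (some t)) q := fun r t => (hK r a _ _).fun_mul (hFs _ _)
    rw [dc_congr hq e, dc_const_mul hq (smoothAt_sum fun r _ => smoothAt_sum fun t _ => hm r t),
      dc_sum hq (fun r _ => smoothAt_sum fun t _ => hm r t)]
    congr 1
    refine Finset.sum_congr rfl fun r _ => ?_
    rw [dc_sum hq (fun t _ => hm r t)]
    refine Finset.sum_congr rfl fun t _ => ?_
    refine (dc_mul hq (hK r a (some c) (some t)) (hFs (some r) (some t)) s).trans ?_
    simp only [loc_self]
  -- A one-form has a single slot, so updating it replaces the whole index list.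
  have hup : ∀ e : Fin n, Function.update ![a] 0 e = ![e] := by
    intro e; funext i; fin_cases i; rfl
  have h1 : 2 * divWeylSigma D F q ![a] = ∑ s, cov D (-2) (rho B) q s ![a] ![s] := by
    rw [divWeylSigma, Finset.mul_sum]
    exact Finset.sum_congr rfl fun s _ => (cov_weylSigma hn hD hF s s ![a]).symm
  rw [h1]
  simp only [cov_rho_eq hBt, hB1, hB0, Fin.sum_univ_one, hup, cov_sigma_eq hF.self_of_nhds,
    Matrix.cons_val_zero, weyl_eq hn hD, cotton_eq hD, sigma, Matrix.cons_val_one]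
  exact divergence_contraction a (fun r a s t => tcurv D q q r a (some s) (some t))
    (fun r a t => tcurv D q q r a none (some t)) (fun c s e => chr D q q c s e)
    (fun r t => F q ![] (some r) (some t)) (fun s => (chr D q q s).trace / (n + 1))
    (fun s r t => dc q (fun z => loc q F z ![] (some r) (some t)) q s)
    (fun r s t => dc q (fun z => tcurv D q z r a (some s) (some t)) q s) ((n : ℝ) - 2)
    (fun c s e => chr_symm hD hq s c e) (fun r a s t => tcurv_swap D q q r a _ _)
    (fun r t => hs _ _) (fun r t => sum_dc_tcurv hn hD hq r a t)

end bianchi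

/-! ### The prolongation connection -/

section constantSections

variable {n : ℕ} {M : Type*} [TopologicalSpace M] [ChartedSpace (EuclideanSpace ℝ (Fin n)) M]
  [IsManifold (𝓡 n) ∞ M] {p q : M} {k : ℕ} {D : AffineConnection n M}

theorem IsTractorFormAt.congr {F G : TFormField n M k} (hF : IsTractorFormAt F q)
    (h : G =ᶠ[nhds q] F) : IsTractorFormAt G q := by
  refine ⟨?_, fun a => (hF.smooth a).congr ?_⟩
  · filter_upwards [hF.skewSymm, h] with z hz hz'
    rwa [hz']
  · filter_upwards [h] with z hz
    rw [loc_congr hz]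

theorem extD_congr [T2Space M] (hD : IsSmoothTorsionFree D) {F G : TFormField n M k}
    (hF : IsTractorFormAt F q) (h : G =ᶠ[nhds q] F) : extD D G q = extD D F q := by
  rw [extD_eq_lextD hD hF, extD_eq_lextD hD (hF.congr h)]
  refine lextD_congr (self_mem_dom q) rfl ?_
  filter_upwards [h] with z hz
  exact loc_congr hz q

/-- The section with constant components in the preferred chart of `p`. -/
def constSection (p : M) (v : TMat n) : TFormField n M 0 := fun z _ =>
  tjac p z z * v * (tjac p z z).transpose

theorem constSection_self (p : M) (v : TMat n) (a : Fin 0 → Fin n) : constSection p v p a = v := by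
  simp [constSection, tjac_self (self_mem_dom p)]

theorem loc_constSection (hq : q ∈ dom n p) (v : TMat n) (a : Fin 0 → Fin n) :
    loc p (constSection p v) q a = v := by
  have h : pull (jac p q q) (constSection p v q) a = tjac p q q * v * (tjac p q q).transpose := by
    simp [pull, constSection]
  rw [loc, h, conj_conj, tjac_mul_tjac hq (self_mem_dom q)]
  simp

theorem isSkewSymm_section {F : TForm n 0} (h : ∀ a, (F a).IsSymm) : IsSkewSymm F := by
  refine ⟨fun π a => ?_, h⟩
  have h1 : π = 1 := Subsingleton.elim _ _
  have h2 : a ∘ π = a := Subsingleton.elim _ _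
  rw [h2, h1]
  simp

theorem isTractorFormAt_constSection (hq : q ∈ dom n p) {v : TMat n} (hv : v.IsSymm) :
    IsTractorFormAt (constSection p v) q := by
  refine ⟨Filter.Eventually.of_forall fun z => isSkewSymm_section fun a => ?_,
    matSmoothAt_loc_of (self_mem_dom q) hq fun a => ?_⟩
  · simp only [Matrix.IsSymm, constSection, Matrix.transpose_mul, Matrix.transpose_transpose, hv.eq,
      Matrix.mul_assoc]
  · refine (MatSmoothAt.const v).congr ?_
    filter_upwards [dom_mem_nhds hq] with z hz
    exact loc_constSection hz v a

theorem isTractorFormOn_constSection (p : M) {v : TMat n} (hv : v.IsSymm) :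
    IsTractorFormOn (constSection p v) (dom n p) :=
  (isTractorFormOn_iff (chartAt (EuclideanSpace ℝ (Fin n)) p).open_source).2 fun _ hq =>
    isTractorFormAt_constSection hq hv

theorem eventually_constSection (p : M) {v : TMat n} (hv : v.IsSymm) :
    ∀ᶠ z in nhds p, IsTractorFormAt (constSection p v) z := by
  filter_upwards [dom_mem_nhds (n := n) (self_mem_dom p)] with z hz
  exact isTractorFormAt_constSection hz hv

end constantSections

/-! ### The algebraic correction `-(2/n) ∂^* Ω` and the normalization of the modified curvature. -/

section prolongation

variable {n : ℕ} {M : Type*} [TopologicalSpace M] [ChartedSpace (EuclideanSpace ℝ (Fin n)) M]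
  [IsManifold (𝓡 n) ∞ M] [T2Space M] {p q : M} {D D' : AffineConnection n M}

/-- The prolongation connection, relative to the tractor connection. -/
def prolong (D : AffineConnection n M) (x : M) (a : Fin n) : TMat n →ₗ[ℝ] TMat n where
  toFun v := -((2 / (n : ℝ)) •
    (injXY (fun c => ∑ r, ∑ p, weyl D x r a c p * v (some p) (some r)) -
      injXX (∑ r, ∑ p, cotton D x r a p * v (some p) (some r))))
  map_add' v w := by
    ext i j
    rcases i with _ | i <;> rcases j with _ | j <;>
      simp [injXX, injXY, mul_add, Finset.sum_add_distrib] <;> ring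
  map_smul' c v := by
    ext i j
    rcases i with _ | i <;> rcases j with _ | j <;>
      simp [injXX, injXY, mul_left_comm _ c, ← Finset.mul_sum] <;> ring

theorem prolong_apply (D : AffineConnection n M) (x : M) (a : Fin n) (v : TMat n) :
    prolong D x a v = -((2 / (n : ℝ)) •
      (injXY (fun c => ∑ r, ∑ p, weyl D x r a c p * v (some p) (some r)) -
        injXX (∑ r, ∑ p, cotton D x r a p * v (some p) (some r)))) := rfl

/-- The explicit endomorphism is a multiple of `∂^* d^∇ d^∇`. Smoothness, invariance and membership
in `im ∂^*` then follow from the corresponding properties of `∂^*` and `d^∇`. -/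
theorem prolong_eq (hn : 2 ≤ n) (hD : IsSmoothTorsionFree D) {s : TFormField n M 0}
    (hs : ∀ᶠ z in nhds q, IsTractorFormAt s z) (a : Fin 1 → Fin n) :
    prolong D q (a 0) (s q ![]) = (-(2 / (n : ℝ))) • codiff (extD D (extD D s) q) a := by
  have hsym : ∀ i j, s q ![] i j = s q ![] j i := fun i j =>
    congr_fun (congr_fun (hs.self_of_nhds.skewSymm.self_of_nhds.2 ![]) j) i
  have hB : IsSkewSymm (codiff (extD D (extD D s) q)) :=
    ((IsTractorFormAt.extD hD hs).isSkewSymm_extD hD).codiff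
  have h1 : ∀ c, codiff (extD D (extD D s) q) a (some c) none =
      (∑ r, ∑ p, weyl D q r (a 0) c p * s q ![] (some p) (some r)) / 2 := by
    intro c
    rw [codiff_extD_extD_some_none hs hn hD, weylSigma_section hn hD]
    rw [one_div_mul_eq_div]
    congr 1
    exact Finset.sum_congr rfl fun r _ => Finset.sum_congr rfl fun p _ => by
      rw [hsym (some p)]; rfl
  have h2 : codiff (extD D (extD D s) q) a none none =
      - ∑ r, ∑ p, cotton D q r (a 0) p * s q ![] (some p) (some r) := by
    rw [codiff_extD_extD_none_none hs hn hD, weylRhoCottonSigma_section hn hD]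
    rfl
  rw [prolong_apply, neg_smul]
  congr 2
  ext i j
  rcases i with _ | i <;> rcases j with _ | j
  · simp [injXX, injXY, h2]
  · have h3 : codiff (extD D (extD D s) q) a none (some j) =
        (∑ r, ∑ p, weyl D q r (a 0) j p * s q ![] (some p) (some r)) / 2 :=
      (congr_fun (congr_fun (hB.2 a) (some j)) none).trans (h1 j)
    rw [h3]
    simp [injXX, injXY]
  · simp [injXX, injXY, h1]
  · simp [injXX, injXY, codiff_some_some]

theorem prolong_const (hn : 2 ≤ n) (hD : IsSmoothTorsionFree D) (p : M) {v : TMat n} (hv : v.IsSymm)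
    (a : Fin 1 → Fin n) : prolong D p (a 0) v =
      (-(2 / (n : ℝ))) • codiff (extD D (extD D (constSection p v)) p) a := by
  rw [← prolong_eq hn hD (eventually_constSection p hv), constSection_self]

theorem isSymm_prolong (D : AffineConnection n M) (x : M) (a : Fin n) (v : TMat n) :
    (prolong D x a v).IsSymm := by
  ext i j
  rcases i with _ | i <;> rcases j with _ | j <;> simp [prolong_apply, injXX, injXY]

/-- Extend `v` to a local section with constant components and use the invariance of `∂^* d^∇ d^∇`.
-/
theorem prolong_splitChange (hn : 2 ≤ n) (hD : IsSmoothTorsionFree D) (hD' : IsSmoothTorsionFree D')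
    {Υ : TensorField n M 1 0} (h : IsProjectiveChange Υ D D') (p : M) (a : Fin n) {v : TMat n}
    (hv : v.IsSymm) :
    prolong D' p a (splitChange (fun i => Υ p ![i] ![]) * v *
        (splitChange (fun i => Υ p ![i] ![])).transpose) =
      splitChange (fun i => Υ p ![i] ![]) * prolong D p a v *
        (splitChange (fun i => Υ p ![i] ![])).transpose := by
  set s : TFormField n M 0 := constSection p v
  have hs0 : s p ![] = v := constSection_self p v ![]
  have hs : ∀ᶠ z in nhds p, IsTractorFormAt s z := eventually_constSection p hv
  have h1 : changeSplit Υ s p ![] = splitChange (fun i => Υ p ![i] ![]) * v *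
      (splitChange (fun i => Υ p ![i] ![])).transpose := by
    rw [changeSplit, hs0]
  have h2 := prolong_eq hn hD' (hs.mono fun z hz => hz.changeSplit h.1) ![a]
  rw [h1] at h2
  have h3 : extD D' (changeSplit Υ s) =ᶠ[nhds p] changeSplit Υ (extD D s) :=
    hs.mono fun z hz => extD_changeSplit hn hD hD' h hz
  have hds : IsTractorFormAt (extD D s) p := IsTractorFormAt.extD hD hs
  rw [extD_congr hD' (hds.changeSplit h.1) h3, extD_changeSplit hn hD hD' h hds] at h2
  have h4 : codiff (changeSplit Υ (extD D (extD D s)) p) ![a] =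
      splitChange (fun i => Υ p ![i] ![]) * codiff (extD D (extD D s) p) ![a] *
        (splitChange (fun i => Υ p ![i] ![])).transpose := codiff_splitChange _ _ _
  rw [h4] at h2
  have h5 := prolong_const hn hD p hv ![a]
  simp only [Matrix.cons_val_zero] at h2 h5
  rw [h2, h5, Matrix.mul_smul, Matrix.smul_mul]

/-- Endomorphism-valued one-forms with the regularity and symmetry of a prolongation. -/
structure IsEndForm (Φ : M → Fin n → TMat n →ₗ[ℝ] TMat n) : Prop where
  symm : ∀ p a (v : TMat n), v.IsSymm → (Φ p a v).IsSymm
  smooth : ∀ (U : Set M), IsOpen U → ∀ s : TFormField n M 0, IsTractorFormOn s U →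
    IsTractorFormOn (fun p (a : Fin 1 → Fin n) => Φ p (a 0) (s p ![])) U
  im_codiff : ∀ p (v : TMat n), v.IsSymm → ∃ h : TForm n 2, IsSkewSymm h ∧
    (fun a : Fin 1 → Fin n => Φ p (a 0) v) = codiff h

theorem isEndForm_prolong (hn : 2 ≤ n) (hD : IsSmoothTorsionFree D) : IsEndForm (prolong D) := by
  refine ⟨fun p a v _ => isSymm_prolong D p a v, fun U hU s hs => ?_, fun p v hv => ?_⟩
  · rw [isTractorFormOn_iff hU] at hs ⊢
    intro q hq
    have hU' : ∀ᶠ z in nhds q, ∀ᶠ y in nhds z, IsTractorFormAt s y := by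
      filter_upwards [hU.mem_nhds hq] with z hz
      filter_upwards [hU.mem_nhds hz] with y hy using hs y hy
    have h1 : IsTractorFormAt ((-(2 / (n : ℝ))) • fun z => codiff (extD D (extD D s) z)) q :=
      (IsTractorFormAt.codiff (IsTractorFormAt.extD hD
        (hU'.mono fun z hz => IsTractorFormAt.extD hD hz))).smul _
    refine h1.congr ?_
    filter_upwards [hU'] with z hz
    funext a
    exact prolong_eq hn hD hz a
  · refine ⟨(-(2 / (n : ℝ))) • extD D (extD D (constSection p v)) p, ?_, ?_⟩
    · exact ((IsTractorFormAt.extD hD (eventually_constSection p hv)).isSkewSymm_extD hD).smul _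
    · rw [codiff_smul]
      funext a
      exact prolong_const hn hD p hv a

variable {Φ : M → Fin n → TMat n →ₗ[ℝ] TMat n}

theorem IsEndForm.some_some (hΦ : IsEndForm Φ) {v : TMat n} (hv : v.IsSymm) (p : M) (a b c : Fin n) :
    Φ p a v (some b) (some c) = 0 := by
  obtain ⟨h, -, he⟩ := hΦ.im_codiff p v hv
  have h1 := congr_fun he ![a]
  simp only [Matrix.cons_val_zero] at h1
  rw [h1, codiff_some_some]

theorem alt_one {A : Type*} [AddCommGroup A] [Module ℝ A] (T : (Fin 1 → Fin n) → A) : alt T = T := by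
  refine alt_eq_self fun π a => ?_
  have h1 : π = 1 := Subsingleton.elim _ _
  subst h1
  simp

theorem extDMod_eq {k : ℕ} (D : AffineConnection n M) (Φ : M → Fin n → TMat n →ₗ[ℝ] TMat n)
    (F : TFormField n M k) (q : M) : extDMod D Φ F q = extD D F q +
      alt fun a : Fin (k + 1) → Fin n => Φ q (a 0) (F q (Fin.tail a)) := by
  funext a
  exact alt_add _ _ a

theorem extDMod_section (D : AffineConnection n M) (Φ : M → Fin n → TMat n →ₗ[ℝ] TMat n)
    (s : TFormField n M 0) : extDMod D Φ s = extD D s +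
      fun p (a : Fin 1 → Fin n) => Φ p (a 0) (s p ![]) := by
  funext q
  rw [extDMod_eq, alt_one]
  congr 1
  funext a
  rw [show Fin.tail a = ![] from Subsingleton.elim _ _]

theorem isSkewSymm_alt_end (hΦ : IsEndForm Φ) (q : M) {k : ℕ} {G : TForm n k}
    (hG : ∀ a, (G a).IsSymm) :
    IsSkewSymm (alt fun a : Fin (k + 1) → Fin n => Φ q (a 0) (G (Fin.tail a))) := by
  refine ⟨alt_isSkew _, fun a => ?_⟩
  simp only [Matrix.IsSymm, alt, Matrix.transpose_smul, Matrix.transpose_sum]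
  congr 1
  refine Finset.sum_congr rfl fun π _ => ?_
  rw [(hΦ.symm q _ _ (hG _)).eq]

/-! ### The codifferential of the curvature of `∇ + Φ`, slot by slot. -/

section curvature

variable {s : TFormField n M 0} {U : Set M}

/-- The curvature of the modified connection. -/
theorem extDMod_extDMod (hD : IsSmoothTorsionFree D) (hΦ : IsEndForm Φ) (hU : IsOpen U)
    (hs : IsTractorFormOn s U) (hq : q ∈ U) :
    extDMod D Φ (extDMod D Φ s) q = extD D (extD D s) q +
      extD D (fun p (a : Fin 1 → Fin n) => Φ p (a 0) (s p ![])) q +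
      alt fun a : Fin 2 → Fin n => Φ q (a 0) (extDMod D Φ s q (Fin.tail a)) := by
  have hs' := (isTractorFormOn_iff hU).1 hs
  have hE := (isTractorFormOn_iff hU).1 (hΦ.smooth U hU s hs)
  rw [extDMod_eq]
  congr 1
  rw [extDMod_section]
  exact extD_add hD (IsTractorFormAt.extD hD (Filter.mem_of_superset (hU.mem_nhds hq) hs')) (hE q hq)

theorem isSymm_extDMod (hD : IsSmoothTorsionFree D) (hΦ : IsEndForm Φ) (hU : IsOpen U)
    (hs : IsTractorFormOn s U) (hq : q ∈ U) (a : Fin 1 → Fin n) : (extDMod D Φ s q a).IsSymm := by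
  have hs' := (isTractorFormOn_iff hU).1 hs q hq
  rw [extDMod_section]
  exact ((hs'.isSkewSymm_extD hD).2 a).add (hΦ.symm q _ _ (hs'.skewSymm.self_of_nhds.2 _))

theorem isSkewSymm_extDMod_extDMod (hD : IsSmoothTorsionFree D) (hΦ : IsEndForm Φ) (hU : IsOpen U)
    (hs : IsTractorFormOn s U) (hq : q ∈ U) : IsSkewSymm (extDMod D Φ (extDMod D Φ s) q) := by
  have hs' := (isTractorFormOn_iff hU).1 hs
  have hE := (isTractorFormOn_iff hU).1 (hΦ.smooth U hU s hs)
  rw [extDMod_extDMod hD hΦ hU hs hq]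
  refine ((IsTractorFormAt.isSkewSymm_extD hD (IsTractorFormAt.extD hD
    (Filter.mem_of_superset (hU.mem_nhds hq) hs'))).add ((hE q hq).isSkewSymm_extD hD)).add ?_
  exact isSkewSymm_alt_end hΦ q (isSymm_extDMod hD hΦ hU hs hq)

theorem eventually_im_codiff (hΦ : IsEndForm Φ) (hU : IsOpen U) (hs : IsTractorFormOn s U)
    (hq : q ∈ U) : ∀ᶠ z in nhds q, ∃ h : TForm n 2, IsSkewSymm h ∧
      (fun a : Fin 1 → Fin n => Φ z (a 0) (s z ![])) = codiff h := by
  filter_upwards [hU.mem_nhds hq] with z hz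
  exact hΦ.im_codiff z _ ((hs.skewSymm z hz).2 _)

/-- The quadratic-looking term `Φ ∧ (∇ + Φ)` takes values in `σ = 0`, so it does not reach this
slot. What remains is the Weyl term and `n/2` times `Φ`, from the degree-one case of
`codiff_extD_some_none`. -/
theorem codiff_curvature_some_none (hn : 2 ≤ n) (hD : IsSmoothTorsionFree D) (hΦ : IsEndForm Φ)
    (hU : IsOpen U) (hs : IsTractorFormOn s U) (hq : q ∈ U) (a c : Fin n) :
    codiff (extDMod D Φ (extDMod D Φ s) q) ![a] (some c) none =
      1 / 2 * ∑ r, ∑ t, weyl D q r a c t * s q ![] (some r) (some t) +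
        n / 2 * Φ q a (s q ![]) (some c) none := by
  have hs' := (isTractorFormOn_iff hU).1 hs
  have hE := (isTractorFormOn_iff hU).1 (hΦ.smooth U hU s hs)
  have h1 := codiff_extD_some_none (hE q hq) (eventually_im_codiff hΦ hU hs hq) hD ![a] c
  have h2 : codiff (alt fun a : Fin 2 → Fin n => Φ q (a 0) (extDMod D Φ s q (Fin.tail a))) ![a]
      (some c) none = 0 := by
    rw [codiff_some_none]
    refine Finset.sum_eq_zero fun r _ => ?_
    rw [alt_apply]
    simp only [hΦ.some_some (isSymm_extDMod hD hΦ hU hs hq _)]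
    simp [alt]
  rw [extDMod_extDMod hD hΦ hU hs hq, codiff_add, codiff_add]
  simp only [Pi.add_apply, Matrix.add_apply]
  rw [h1, h2, codiff_extD_extD_some_none (Filter.mem_of_superset (hU.mem_nhds hq) hs') hn hD,
    weylSigma_section hn hD]
  simp [sigma]

theorem covTractor_some_some (D : AffineConnection n M) (F : TFormField n M 0) (x : M) (r b c : Fin n) :
    covTractor D F x r ![] (some b) (some c) = cov D (-2) (sigma F) x r ![] ![b, c] +
      ((if b = r then F x ![] none (some c) else 0) + if c = r then F x ![] (some b) none else 0) := by
  simp [covTractor, ofSlots, act, Matrix.mul_apply, connMatrix]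

theorem extDMod_section_apply (D : AffineConnection n M) (Φ : M → Fin n → TMat n →ₗ[ℝ] TMat n)
    (s : TFormField n M 0) (q : M) (r : Fin n) : extDMod D Φ s q ![r] =
      covTractor D s q r ![] + Φ q r (s q ![]) := by
  rw [extDMod, alt_one, show Fin.tail ![r] = ![] from Subsingleton.elim _ _]
  rfl

theorem codiff_alt_end (hΦ : IsEndForm Φ) (q : M) {G : TForm n 1} (hG : ∀ a, (G a).IsSymm) (a : Fin n) :
    codiff (alt fun b : Fin 2 → Fin n => Φ q (b 0) (G (Fin.tail b))) ![a] none none =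
      ∑ r, (Φ q r (G ![a]) (some r) none - Φ q a (G ![r]) (some r) none) := by
  have h0 := isSkewSymm_alt_end hΦ q hG
  rw [codiff_none_none]
  refine Finset.sum_congr rfl fun r _ => ?_
  have h1 : alt (fun b : Fin 2 → Fin n => Φ q (b 0) (G (Fin.tail b))) (Fin.cons r ![a]) none (some r) =
      alt (fun b : Fin 2 → Fin n => Φ q (b 0) (G (Fin.tail b))) (Fin.cons r ![a]) (some r) none :=
    congr_fun (congr_fun (h0.2 _) (some r)) none
  rw [h1, alt_cons (U := fun c (b : Fin 1 → Fin n) => Φ q c (G b)) (fun c π b => by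
    have : π = 1 := Subsingleton.elim _ _
    subst this
    simp) r ![a]]
  have hup : Function.update ![a] 0 r = ![r] := by
    funext i; fin_cases i; rfl
  simp [hup]
  ring

/-- Once the `ρ`-slot is normalized, `d^∇ Φ` contributes `-(2/n)` times the divergence of `W σ`,
that is Cotton terms and `-(1/n) W ∇σ`; the last piece is cancelled by `Φ ∧ (∇ + Φ)`. The identity
left is algebraic in the section. -/
theorem codiff_curvature_none_none (hn : 2 ≤ n) (hD : IsSmoothTorsionFree D) (hΦ : IsEndForm Φ)
    (hρ : ∀ p a (v : TMat n), v.IsSymm → ∀ c, Φ p a v (some c) none =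
      - (1 / (n : ℝ)) * ∑ r, ∑ t, weyl D p r a c t * v (some r) (some t))
    (hU : IsOpen U) (hs : IsTractorFormOn s U) (hq : q ∈ U) (a : Fin n) :
    codiff (extDMod D Φ (extDMod D Φ s) q) ![a] none none =
      ((n : ℝ) - 1) * (Φ q a (s q ![]) none none -
        2 / n * ∑ r, ∑ t, cotton D q r a t * s q ![] (some t) (some r)) := by
  have hn0 : (n : ℝ) ≠ 0 := by
    have : n ≠ 0 := by omega
    exact_mod_cast this
  have hq' := self_mem_dom (n := n) q
  have hs' := (isTractorFormOn_iff hU).1 hs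
  have hse : ∀ᶠ z in nhds q, IsTractorFormAt s z := Filter.mem_of_superset (hU.mem_nhds hq) hs'
  have hE := (isTractorFormOn_iff hU).1 (hΦ.smooth U hU s hs)
  have hG := isSymm_extDMod hD hΦ hU hs hq
  have h1 := codiff_extD_none_none (hE q hq) (eventually_im_codiff hΦ hU hs hq) hD ![a]
  set E : TFormField n M 1 := fun p (a : Fin 1 → Fin n) => Φ p (a 0) (s p ![]) with hEdef
  -- The hypothesis `hρ` makes the `ρ`-slot of `Φ s` equal to `-(4/n)` times `weylSigma`: a factor
  -- two from the definition of `rho`, and another from the `1/2` in `weylSigma_section`.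
  have h2 : ∑ c, cov D (-2) (rho E) q c ![a] ![c] = -(4 / (n : ℝ)) * divWeylSigma D s q ![a] := by
    rw [divWeylSigma, Finset.mul_sum]
    refine Finset.sum_congr rfl fun c _ => ?_
    have h3 : SmoothAt n (fun z => inChart (-2) (rho E) q z ![a] ![c]) q := by
      simp only [← loc_some_none]
      exact (smoothAt_const 2).fun_mul ((hE q hq).smooth ![a] (some c) none)
    have h4 : weylSigma D s =ᶠ[nhds q] fun z b d => -((n : ℝ) / 4) * rho E z b d := by
      filter_upwards [hse] with z hz
      funext b d
      rw [weylSigma_section hn hD]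
      simp only [rho, hEdef, hρ z _ _ (hz.skewSymm.self_of_nhds.2 ![]), sigma,
        Matrix.cons_val_zero, Matrix.cons_val_one]
      field_simp
      ring
    have h5 : SmoothAt n (fun z => inChart (-2) (fun z b d => -((n : ℝ) / 4) * rho E z b d) q z
        ![a] ![c]) q := by
      refine ((smoothAt_const (-((n : ℝ) / 4))).fun_mul h3).congr_of_eventuallyEq
        (Filter.Eventually.of_forall fun z => ?_)
      simp only [inChart, Finset.mul_sum]
      refine Finset.sum_congr rfl fun _ _ => Finset.sum_congr rfl fun _ _ => ?_
      ring
    rw [cov_congr h4 c _ _ h5, cov_const_mul _ _ _ _ _ _ h3]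
    field_simp
  have h3 : codiff (alt fun b : Fin 2 → Fin n => Φ q (b 0) (extDMod D Φ s q (Fin.tail b))) ![a]
      none none =
      1 / n * ∑ r, ∑ c, ∑ t, weyl D q r a c t * cov D (-2) (sigma s) q c ![] ![r, t] := by
    rw [codiff_alt_end hΦ q hG, Finset.sum_sub_distrib]
    -- Half of the skew term is a trace of the Weyl tensor and vanishes.
    have h4 : ∑ r, Φ q r (extDMod D Φ s q ![a]) (some r) none = 0 := by
      simp only [hρ q _ _ (hG _)]
      rw [← Finset.mul_sum]
      have : ∑ c, ∑ r, ∑ t, weyl D q r c c t * extDMod D Φ s q ![a] (some r) (some t) = 0 := by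
        rw [Finset.sum_comm]
        refine Finset.sum_eq_zero fun r _ => ?_
        rw [Finset.sum_comm]
        refine Finset.sum_eq_zero fun t _ => ?_
        simp only [← Finset.sum_mul, weyl_eq hn hD, tcurv_trace_right hn hD hq', zero_mul]
      rw [this, mul_zero]
    have h5 : ∀ c r t, extDMod D Φ s q ![c] (some r) (some t) =
        cov D (-2) (sigma s) q c ![] ![r, t] + ((if r = c then s q ![] none (some t) else 0) +
          if t = c then s q ![] (some r) none else 0) := by
      intro c r t
      rw [extDMod_section_apply, Matrix.add_apply,
        hΦ.some_some (hse.self_of_nhds.skewSymm.self_of_nhds.2 ![]), add_zero, covTractor_some_some]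
    -- The `σ`-slot of the tractor derivative contains `ρ` times Kronecker deltas; against the Weyl
    -- tensor these give its two traces, `h6` and `h7`, both zero.
    have h6 : ∑ c, ∑ t, weyl D q c a c t * s q ![] none (some t) = 0 := by
      rw [Finset.sum_comm]
      simp only [← Finset.sum_mul, weyl_eq hn hD, tcurv_trace hn hD hq', zero_mul,
        Finset.sum_const_zero]
    have h7 : ∑ c, ∑ r, weyl D q r a c c * s q ![] (some r) none = 0 := by
      rw [Finset.sum_comm]
      simp only [← Finset.sum_mul, weyl_eq hn hD, tcurv_trace' hn hD hq', zero_mul,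
        Finset.sum_const_zero]
    have h8 : ∀ c, ∑ r, ∑ t, weyl D q r a c t * ((if r = c then s q ![] none (some t) else 0) +
        if t = c then s q ![] (some r) none else 0) =
        ∑ t, weyl D q c a c t * s q ![] none (some t) +
          ∑ r, weyl D q r a c c * s q ![] (some r) none := by
      intro c
      simp only [mul_add, Finset.sum_add_distrib, mul_ite, mul_zero]
      congr 1
      · rw [Finset.sum_comm]
        simp
      · simp
    rw [h4, zero_sub]
    simp only [hρ q _ _ (hG _), h5]
    rw [← Finset.mul_sum, neg_mul, neg_neg]
    congr 1
    rw [Finset.sum_comm]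
    conv_rhs => rw [Finset.sum_comm]
    conv_lhs => rw [Finset.sum_comm]
    simp only [mul_add (weyl _ _ _ _ _ _) (cov _ _ _ _ _ _ _), Finset.sum_add_distrib, h8]
    rw [h6, h7]
    simp
  have h4 := divWeylSigma_section hn hD hse a
  rw [extDMod_extDMod hD hΦ hU hs hq, codiff_add, codiff_add]
  simp only [Pi.add_apply, Matrix.add_apply]
  rw [h3, h1, h2, codiff_extD_extD_none_none hse hn hD, weylRhoCottonSigma_section hn hD]
  simp only [Matrix.cons_val_zero, sigma, Matrix.cons_val_one] at h4 ⊢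
  have h6 : divWeylSigma D s q ![a] = _ := (eq_div_of_mul_eq two_ne_zero
    ((mul_comm _ _).trans h4))
  rw [h6]
  push_cast
  field_simp
  ring

end curvature

end prolongation

/-! ### Comparison with the Eastwood–Matveev connection. -/

section prolongation

variable {n : ℕ} {M : Type*} [TopologicalSpace M] [ChartedSpace (EuclideanSpace ℝ (Fin n)) M]
  [IsManifold (𝓡 n) ∞ M] [T2Space M] {D : AffineConnection n M}

theorem prolong_some_none (D : AffineConnection n M) (x : M) (a : Fin n) {v : TMat n} (hv : v.IsSymm)
    (c : Fin n) : prolong D x a v (some c) none =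
      - (1 / (n : ℝ)) * ∑ r, ∑ t, weyl D x r a c t * v (some r) (some t) := by
  have h : ∀ i j, v i j = v j i := fun i j => congr_fun (congr_fun hv j) i
  have h1 : ∑ r, ∑ t, weyl D x r a c t * v (some r) (some t) =
      ∑ r, ∑ t, weyl D x r a c t * v (some t) (some r) :=
    Finset.sum_congr rfl fun r _ => Finset.sum_congr rfl fun t _ => by rw [h]
  rw [h1]
  simp [prolong_apply, injXX, injXY]
  ring

theorem prolong_none_none (D : AffineConnection n M) (x : M) (a : Fin n) (v : TMat n) :
    prolong D x a v none none = 2 / (n : ℝ) * ∑ r, ∑ p, cotton D x r a p * v (some p) (some r) := by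
  simp [prolong_apply, injXX, injXY]

/-- The prolongation connection is the Eastwood–Matveev connection. -/
theorem covTractor_add_prolong (hn : 2 ≤ n) (hD : IsSmoothTorsionFree D) {σ : TensorField n M 0 2}
    {μ : TensorField n M 0 1} {ρ : TensorField n M 0 0} (hμ : TensorSmoothOn (-2) μ Set.univ)
    (hσ : ∀ x b c, σ x ![] ![b, c] = σ x ![] ![c, b]) (x : M) (a : Fin n) :
    covTractor D (fun y (_ : Fin 0 → Fin n) => emInj (σ y) (μ y) (ρ y)) x a ![] +
        prolong D x a (emInj (σ x) (μ x) (ρ x)) =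
      emInj (emConnection D σ μ ρ x a).1 (emConnection D σ μ ρ x a).2.1
        (emConnection D σ μ ρ x a).2.2 := by
  have h0 : ∀ b : Fin 0 → Fin n, b = ![] := fun b => Subsingleton.elim _ _
  set F : TFormField n M 0 := fun y _ => emInj (σ y) (μ y) (ρ y) with hF
  have hsig : sigma F = σ := by
    funext y b c
    have : ![c 0, c 1] = c := by funext i; fin_cases i <;> rfl
    simp only [sigma, hF, emInj, ofSlots, this, h0 b]
  have hrho : rho F = fun y b c => -2 * μ y b c := by
    funext y b c
    have : ![c 0] = c := by funext i; fin_cases i; rfl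
    simp only [rho, hF, emInj, ofSlots, this, h0 b]
    ring
  have hnu : nu F = ρ := by
    funext y b c
    simp only [nu, hF, emInj, ofSlots, h0 b, h0 c]
  have hcov : ∀ b : Fin n, cov D (-2) (rho F) x a ![] ![b] = -2 * cov D (-2) μ x a ![] ![b] := by
    intro b
    rw [hrho]
    refine cov_const_mul _ _ _ _ _ _ ?_
    exact (hμ x ![] ![b]).contMDiffAt (Filter.inter_mem
      (dom_mem_nhds (n := n) (self_mem_dom x)) Filter.univ_mem)
  have hsymm : (emInj (σ x) (μ x) (ρ x) : TMat n).IsSymm := by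
    ext i j
    rcases i with _ | i <;> rcases j with _ | j <;> simp [emInj, ofSlots, hσ x]
  -- The two conventions place the direction `a` in different skew slots of the Weyl and Cotton
  -- tensors, which accounts for the signs here and in `h2`.
  have h1 : ∀ b : Fin n, ∑ r, ∑ t, weyl D x r a b t * σ x ![] ![r, t] =
      - ∑ c, ∑ d, weyl D x a c b d * σ x ![] ![c, d] := by
    intro b
    simp only [weyl_swap hn hD x a, neg_mul, Finset.sum_neg_distrib]
  have h2 : ∑ r, ∑ p, cotton D x r a p * σ x ![] ![p, r] =
      - ∑ b, ∑ c, cotton D x a b c * σ x ![] ![b, c] := by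
    simp only [cotton_swap hD x a, neg_mul, Finset.sum_neg_distrib, hσ x]
  have hsn : ∀ b : Fin n, (covTractor D F x a ![] + prolong D x a (emInj (σ x) (μ x) (ρ x)))
      (some b) none = emInj (emConnection D σ μ ρ x a).1 (emConnection D σ μ ρ x a).2.1
        (emConnection D σ μ ρ x a).2.2 (some b) none := by
    intro b
    rw [Matrix.add_apply, prolong_some_none D x a hsymm]
    have h3 : covTractor D F x a ![] (some b) none = - cov D (-2) μ x a ![] ![b] +
        ((if a = b then ρ x ![] ![] else 0) - ∑ c, schouten D x a c * σ x ![] ![b, c]) := by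
      rw [covTractor, Matrix.add_apply, ofSlots, hcov]
      simp [act, Matrix.mul_apply, connMatrix, hF, emInj, ofSlots, eq_comm, mul_comm]
      ring
    have h4 : ∀ r t, emInj (σ x) (μ x) (ρ x) (some r) (some t) = σ x ![] ![r, t] := fun _ _ => rfl
    have h5 : emInj (emConnection D σ μ ρ x a).1 (emConnection D σ μ ρ x a).2.1
        (emConnection D σ μ ρ x a).2.2 (some b) none = -2 * (cov D (-2) μ x a ![] ![b] -
          (if a = b then ρ x ![] ![] else 0) + ∑ c, schouten D x a c * σ x ![] ![b, c] -
          1 / (n : ℝ) * ∑ c, ∑ d, weyl D x a c b d * σ x ![] ![c, d]) / 2 := rfl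
    rw [h5]
    simp only [h3, h4, h1]
    ring
  have hns : ∀ b : Fin n, (covTractor D F x a ![] + prolong D x a (emInj (σ x) (μ x) (ρ x)))
      none (some b) = (covTractor D F x a ![] + prolong D x a (emInj (σ x) (μ x) (ρ x)))
        (some b) none := by
    intro b
    have h3 : act (connMatrix D x a) (F x ![]) none (some b) =
        act (connMatrix D x a) (F x ![]) (some b) none :=
      congr_fun (congr_fun (act_isSymm _ hsymm) (some b)) none
    have h4 := congr_fun (congr_fun (isSymm_prolong D x a (emInj (σ x) (μ x) (ρ x))) (some b)) none
    rw [Matrix.transpose_apply] at h4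
    rw [Matrix.add_apply, Matrix.add_apply, h4, covTractor, Matrix.add_apply, Matrix.add_apply, h3]
    rfl
  have hact : act (connMatrix D x a) (F x ![]) none none =
      2 * ∑ b, schouten D x a b * μ x ![] ![b] := by
    rw [two_mul]
    have h3 : ∀ b, -2 * μ x ![] ![b] / 2 = - μ x ![] ![b] := fun b => by ring
    simp only [act, Matrix.add_apply, Matrix.mul_apply, Matrix.transpose_apply, Fintype.sum_option,
      connMatrix, hF, emInj, ofSlots, h3]
    simp [mul_comm]
  ext i j
  rcases i with _ | i <;> rcases j with _ | j
  · rw [Matrix.add_apply, prolong_none_none, covTractor, Matrix.add_apply, ofSlots, hnu, hact]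
    have h4 : ∀ r t, emInj (σ x) (μ x) (ρ x) (some r) (some t) = σ x ![] ![r, t] := fun _ _ => rfl
    simp only [h4, h2]
    simp only [emInj, ofSlots, emConnection, div_mul_eq_mul_div, ← Finset.sum_div]
    ring
  · exact (hns j).trans (hsn j)
  · exact hsn i
  · rw [Matrix.add_apply, covTractor_some_some, hsig, prolong_apply]
    simp [injXX, injXY, hF, emInj, ofSlots, emConnection, eq_comm]
    split_ifs <;> ring

end prolongation

/-! ### Existence and uniqueness of the prolongation connection, and `d̃` on sections. -/

namespace ProjectiveStructure

variable {n : ℕ} {M : Type*} [TopologicalSpace M] [ChartedSpace (EuclideanSpace ℝ (Fin n)) M]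
  [IsManifold (𝓡 n) ∞ M] [T2Space M] {Pr : ProjectiveStructure n M}

theorem isProlongation_prolong (hn : 2 ≤ n) :
    IsProlongation (Pr := Pr) fun D => prolong D.1 := by
  have hn0 : (n : ℝ) ≠ 0 := by
    have : n ≠ 0 := by omega
    exact_mod_cast this
  have hE := fun D : Pr.conns => isEndForm_prolong hn (isSmoothTorsionFree D)
  refine ⟨fun D => (hE D).symm, fun D => (hE D).smooth, fun D D' Υ h p a v hv => ?_,
    fun D p a v hv _ => (hE D).some_some hv p a, fun D p a v hv h => ?_, fun D => (hE D).im_codiff,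
    fun D U hU s hs p hp => ?_⟩
  · exact prolong_splitChange hn (isSmoothTorsionFree D) (isSmoothTorsionFree D') h p a hv
  · refine ⟨(hE D).some_some hv p a, fun b => ?_⟩
    have h1 : prolong D.1 p a v (some b) none = 0 := by
      rw [prolong_some_none _ _ _ hv]
      simp [h.1 _ _]
    exact ⟨h1, (congr_fun (congr_fun (isSymm_prolong D.1 p a v) (some b)) none).trans h1⟩
  · have hD := isSmoothTorsionFree D
    have hv := (hs.skewSymm p hp).2 ![]
    have hS := (isSkewSymm_extDMod_extDMod hD (hE D) hU hs hp).codiff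
    funext b
    obtain ⟨a, rfl⟩ : ∃ a, b = ![a] := ⟨b 0, by funext i; fin_cases i; rfl⟩
    refine ext_of_im_codiff (hS.2 _) (codiff_some_some _ _) (fun c => ?_) ?_
    · rw [codiff_curvature_some_none hn hD (hE D) hU hs hp, prolong_some_none _ _ _ hv]
      field_simp
      ring
    · rw [codiff_curvature_none_none hn hD (hE D)
        (fun p a v hv c => prolong_some_none D.1 p a hv c) hU hs hp, prolong_none_none, sub_self,
        mul_zero]

variable {Φ : Pr.conns → M → Fin n → TMat n →ₗ[ℝ] TMat n}

/-- The two slot formulas determine `Φ`: `n/2` and `n - 1` are non-zero, and the `σ`-slot vanishes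
because `Φ` has values in `im ∂^*`. -/
theorem IsProlongation.eq_prolong (hn : 2 ≤ n) (h : IsProlongation Φ) (D : Pr.conns) (x : M)
    (a : Fin n) {v : TMat n} (hv : v.IsSymm) : Φ D x a v = prolong D.1 x a v := by
  have hn0 : (n : ℝ) ≠ 0 := by
    have : n ≠ 0 := by omega
    exact_mod_cast this
  have hn1 : (n : ℝ) - 1 ≠ 0 := by
    have : (2 : ℝ) ≤ n := by exact_mod_cast hn
    have : 0 < (n : ℝ) - 1 := by linarith
    exact this.ne'
  have hD := isSmoothTorsionFree D
  have hE : IsEndForm (Φ D) := ⟨h.symm D, h.smooth D, h.im_codiff D⟩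
  have hU : ∀ p : M, IsOpen (dom n p) := fun p =>
    (chartAt (EuclideanSpace ℝ (Fin n)) p).open_source
  have hz : ∀ p (v : TMat n), v.IsSymm → ∀ a : Fin n,
      -- The normalization is a condition on sections, whereas `Φ` is wanted at a single vector; the
      -- local section with constant components realizes any symmetric `v` at the point.
      codiff (extDMod D.1 (Φ D) (extDMod D.1 (Φ D) (constSection p v)) p) ![a] = 0 :=
    fun p v hv a => congr_fun (h.normalized D _ (hU p) _ (isTractorFormOn_constSection p hv) p
      (self_mem_dom p)) ![a]
  have hρ : ∀ p a (v : TMat n), v.IsSymm → ∀ c, Φ D p a v (some c) none =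
      - (1 / (n : ℝ)) * ∑ r, ∑ t, weyl D.1 p r a c t * v (some r) (some t) := by
    intro p a v hv c
    have h1 := codiff_curvature_some_none hn hD hE (hU p) (isTractorFormOn_constSection p hv)
      (self_mem_dom p) a c
    rw [hz p v hv a, constSection_self, Matrix.zero_apply] at h1
    field_simp
    linarith
  have hν := codiff_curvature_none_none hn hD hE hρ (hU x) (isTractorFormOn_constSection x hv)
      (self_mem_dom x) a
  rw [hz x v hv a, constSection_self, Matrix.zero_apply, zero_eq_mul, or_iff_right hn1,
    sub_eq_zero] at hν
  rw [← sub_eq_zero]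
  refine ext_of_im_codiff ((h.symm D x a v hv).sub (isSymm_prolong D.1 x a v)) (fun b c => ?_)
    (fun c => ?_) ?_
  · rw [Matrix.sub_apply, hE.some_some hv, (isEndForm_prolong hn hD).some_some hv, sub_self]
  · rw [Matrix.sub_apply, hρ x a v hv, prolong_some_none _ _ _ hv, sub_self]
  · rw [Matrix.sub_apply, hν, prolong_none_none, sub_self]

/-- For `k = 0` the divergence identity gives `2 div - n μ = 2(n - 1) A σ + W ∇σ`, which is then
divided by `n(n - 1)`. -/
theorem normT_section (hn : 2 ≤ n) (F : Pr.TractorForm 0) (D : Pr.conns) (x : M) (a : Fin n) :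
    (normT Pr 0 hn F).1 D x ![a] = covTractor D.1 (F.1 D) x a ![] -
      (2 / (n : ℝ)) • injXY (fun c => ∑ r, ∑ p,
        weyl D.1 x r a c p * sigma (F.1 D) x ![] ![r, p]) +
      (1 / (n : ℝ)) • injXX (
        2 * ∑ r, ∑ p, cotton D.1 x r a p * sigma (F.1 D) x ![] ![p, r] +
        1 / ((n : ℝ) - 1) * ∑ r, ∑ s, ∑ p,
          weyl D.1 x r a s p * cov D.1 (-2) (sigma (F.1 D)) x s ![] ![r, p]) := by
  have hn0 : (n : ℝ) ≠ 0 := by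
    have : n ≠ 0 := by omega
    exact_mod_cast this
  have hn1 : (n : ℝ) - 1 ≠ 0 := by
    have : (2 : ℝ) ≤ n := by exact_mod_cast hn
    have : 0 < (n : ℝ) - 1 := by linarith
    exact this.ne'
  have hD := isSmoothTorsionFree D
  have h1 : extD D.1 (F.1 D) x ![a] = covTractor D.1 (F.1 D) x a ![] := by
    rw [extD, alt_one, show Fin.tail ![a] = ![] from Subsingleton.elim _ _]
    rfl
  rw [normT_apply hn (by omega), h1, sub_add]
  congr 1
  simp only [weylSigma_section hn hD, weylRhoCottonSigma_section hn hD,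
    divWeylSigma_section hn hD (eventually_isTractorFormAt F D x), Matrix.cons_val_zero]
  ext i j
  rcases i with _ | i <;> rcases j with _ | j <;> simp [injXY, injXX]
  field_simp
  ring

end ProjectiveStructure

end ProjectiveTractor

end

/-! ### The main theorem. -/

open ProjectiveTractor ProjectiveStructure in
theorem proposition3p5 {n : ℕ} (hn : 2 ≤ n) {M : Type*} [TopologicalSpace M] [T2Space M]
    [ChartedSpace (EuclideanSpace ℝ (Fin n)) M] [IsManifold (𝓡 n) ∞ M]
    (Pr : ProjectiveStructure n M) :
    -- existence, uniqueness and explicit form of `d̃` on `k`-forms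
    (∀ k : ℕ,
      (∃! dt : Pr.TractorForm k →ₗ[ℝ] Pr.TractorForm (k + 1), IsNormalizedExtD dt) ∧
      ∀ dt : Pr.TractorForm k →ₗ[ℝ] Pr.TractorForm (k + 1), IsNormalizedExtD dt →
        (k + 2 ≤ n → ∀ (F : Pr.TractorForm k) (D : Pr.conns) (x : M) (a : Fin (k + 1) → Fin n),
          (dt F).1 D x a = extD D.1 (F.1 D) x a -
            (((k : ℝ) + 2) / (n - k)) •
              (injXY (fun c => 2 * weylSigma D.1 (F.1 D) x a ![c]) -
                (1 / (2 * ((n : ℝ) - k - 1))) •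
                  injXX (2 * divWeylSigma D.1 (F.1 D) x a -
                    (n - k) * weylRhoCottonSigma D.1 (F.1 D) x a))) ∧
        (n ≤ k + 1 → ∀ (F : Pr.TractorForm k) (D : Pr.conns), (dt F).1 D = extD D.1 (F.1 D))) ∧
    -- the simplified form of `d̃` for `k = 0`
    (∀ dt : Pr.TractorForm 0 →ₗ[ℝ] Pr.TractorForm 1, IsNormalizedExtD dt →
      ∀ (F : Pr.TractorForm 0) (D : Pr.conns) (x : M) (a : Fin n),
        (dt F).1 D x ![a] = covTractor D.1 (F.1 D) x a ![] -
          (2 / (n : ℝ)) • injXY (fun c => ∑ r, ∑ p,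
            weyl D.1 x r a c p * sigma (F.1 D) x ![] ![r, p]) +
          (1 / (n : ℝ)) • injXX (
            2 * ∑ r, ∑ p, cotton D.1 x r a p * sigma (F.1 D) x ![] ![p, r] +
            1 / ((n : ℝ) - 1) * ∑ r, ∑ s, ∑ p,
              weyl D.1 x r a s p * cov D.1 (-2) (sigma (F.1 D)) x s ![] ![r, p])) ∧
    -- existence, uniqueness and explicit form of the prolongation connection `∇̃ = ∇ + Φ`,
    -- and its agreement with the Eastwood-Matveev connection
    (∃ Φ : Pr.conns → M → Fin n → TMat n →ₗ[ℝ] TMat n, IsProlongation Φ) ∧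
    ∀ Φ : Pr.conns → M → Fin n → TMat n →ₗ[ℝ] TMat n, IsProlongation Φ →
      (∀ (D : Pr.conns) (x : M) (a : Fin n) (v : TMat n), v.IsSymm →
        Φ D x a v = -((2 / (n : ℝ)) •
          (injXY (fun c => ∑ r, ∑ p, weyl D.1 x r a c p * v (some p) (some r)) -
            injXX (∑ r, ∑ p, cotton D.1 x r a p * v (some p) (some r))))) ∧
      ∀ (D : Pr.conns) (σ : TensorField n M 0 2) (μ : TensorField n M 0 1)
        (ρ : TensorField n M 0 0),
        TensorSmoothOn (-2) σ Set.univ → TensorSmoothOn (-2) μ Set.univ →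
        TensorSmoothOn (-2) ρ Set.univ → (∀ x b c, σ x ![] ![b, c] = σ x ![] ![c, b]) →
        ∀ (x : M) (a : Fin n),
          covTractor D.1 (fun y (_ : Fin 0 → Fin n) => emInj (σ y) (μ y) (ρ y)) x a ![] +
              Φ D x a (emInj (σ x) (μ x) (ρ x)) =
            emInj (emConnection D.1 σ μ ρ x a).1 (emConnection D.1 σ μ ρ x a).2.1
              (emConnection D.1 σ μ ρ x a).2.2 := by
  refine ⟨fun k => ?_, fun dt h F D x a => ?_, ⟨_, isProlongation_prolong hn⟩, fun Φ h => ⟨?_, ?_⟩⟩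
  -- The operator is `normT` as long as `(k + 2)`-forms can be non-zero; beyond that it is `d^∇`
  -- itself.
  · by_cases hk : k + 2 ≤ n
    · have h0 := isNormalizedExtD_normT (Pr := Pr) hn hk
      refine ⟨⟨_, h0, fun dt h => h.unique hn h0⟩, fun dt h => ⟨fun _ F D x a => ?_, fun hk' => ?_⟩⟩
      · rw [h.unique hn h0]
        exact normT_apply hn hk F D x a
      · omega
    · have h0 := isNormalizedExtD_extDT (Pr := Pr) hn (k := k) (by omega)
      refine ⟨⟨_, h0, fun dt h => h.unique hn h0⟩, fun dt h => ⟨fun hk' => ?_, fun _ F D => ?_⟩⟩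
      · omega
      · rw [h.unique hn h0]
        exact extDT_apply hn F D
  · rw [h.unique hn (isNormalizedExtD_normT hn (by omega))]
    exact normT_section hn F D x a
  · intro D x a v hv
    rw [h.eq_prolong hn D x a hv, prolong_apply]
  · intro D σ μ ρ _ hμ _ hσ x a
    have hsymm : (emInj (σ x) (μ x) (ρ x) : TMat n).IsSymm := by
      ext i j
      rcases i with _ | i <;> rcases j with _ | j <;> simp [emInj, ofSlots, hσ x]
    rw [h.eq_prolong hn D x a hsymm]
    exact covTractor_add_prolong hn (isSmoothTorsionFree D) hμ hσ x a
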